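/- **Setting.** A seller has one copy of each of $n$ items and faces $m$ bidders. Bidder $i$ has a type $v_i\in\mathbb R^n$ and is additive up to a capacity (demand) $C_i\in\mathbb N$. An allocation is feasible if every item goes to at most one bidder and bidder $i$ receives at most $C_i$ items; $T$ is the maximum number of items awarded by a feasible allocation. A mechanism $M$ assigns to each profile $v$ of reported types a probability distribution over feasible allocations and an expected price $p_i(v)$ for each bidder; $\phi_{ij}(v)$ is the probability that bidder $i$ receives item $j$. For a product distribution $\mathcal F=\times_i\mathcal F_i$ of types put $\pi_{ij}(w_i)=\mathbb E_{v_{-i}\sim\mathcal F_{-i}}\phi_{ij}(w_i;v_{-i})$, $q_i(w_i)=\mathbb E_{v_{-i}\sim\mathcal F_{-i}}p_i(w_i;v_{-i})$, $u_i(v_i,w_i)=\sum_j v_{ij}\pi_{ij}(w_i)-q_i(w_i)$, and $R^M(\mathcal F)=\mathbb E_{v\sim \mathcal F}\sum_i p_i(v)$. For given sets of types, $M$ is $\varepsilon$-BIC for $\mathcal F$ if $u_i(v_i,v_i)\ge u_i(v_i,w_i)-\varepsilon\, v_{\max}\sum_j\pi_{ij}(w_i)$ for all $i$ and all types $v_i,w_i$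 of bidder $i$, where $v_{\max}$ is the maximum value of any bidder for any item in the support of $\mathcal F$; BIC means $0$-BIC; $M$ is (ex-interim) individually rational (IR) if $u_i(v_i,v_i)\ge0$ for all $i$ and all types $v_i$. **Theorem.** Let $\delta\in(0,1)$ and let $\mathcal D=\times_{i=1}^m\mathcal D_i$, $\mathcal D'=\times_{i=1}^m\mathcal D'_i$ be product distributions with each $\mathcal D_i,\mathcal D'_i$ supported in $[0,1]^n$, such that $\mathcal D'_i$ samples vectors whose coordinates are integer multiples of $\delta$, and such that $\mathcal D_i$ and $\mathcal D'_i$ can be coupled so that, with probability $1$, $v_{ij}\ge v'_{ij}\ge v_{ij}-\delta$ for all $j$. Let $\eta,\varepsilon>0$, and let $M_1$ be a mechanism that is $\varepsilon$-BIC and IR for $\mathcal D'$ (types in the supports of the $\mathcal D'_i$); if $\eta>1$, assume also $R^{M_1}(\mathcal D')\ge0$. Then: 1. There is a mechanism $M_2$ that is BIC and IR for $\mathcal D$, for all true and reported types in $[0,1]^n$, with $$R^{M_2}(\mathcal D)\ \ge\ (1-\eta)\,R^{M_1}(\mathcal D')-\frac{\varepsilon+2\delta}{\eta}\,T .$$ 2.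 ($k$-items.) There is one randomized algorithm such that, whenever the number of items is $n=k$, all $\mathcal D_i$ are equal, all $\mathcal D'_i$ are equal and all $C_i$ are equal, some $M_2$ as in 1 is implemented by the algorithm: on any reports in $[0,1]^n$ it outputs, with probability $1$, a feasible allocation, distributed as prescribed by $M_2$, and prices whose expectations are those of $M_2$, in at most $P(n+m)$ steps, where $P$ is a polynomial that depends only on $k,\delta,\eta$. 3. ($k$-bidders.) There is likewise one randomized algorithm such that, whenever the number of bidders is $m=k$, every $\mathcal D_i$ and every $\mathcal D_i'$ is invariant under all permutations of the items, and $M_1$ respects all permutations of the items, i.e. permuting the items in a profile from the support of $\mathcal D'$ permutes the probabilities $\phi_{ij}$ accordingly and does not change the expected prices, some $M_2$ as in 1 is implemented by the algorithm in the same sense, in at most $P(n+m)$ steps, where $P$ is a polynomial that depends only on $k,\delta,\eta$. 4. For $k$ items and $m$ bidders with common demand $c$, $T\le k$, with equality if $k\le mc$. For $k$ bidders, $T\le k\max_iC_i$. The algorithms are programs with exact real arithmetic and comparisons at unit cost. The input consists of $\delta,\eta,m,n$, the $C_i$ and the reports. The program may also query independent samples from each $\mathcal D_i$ and $\mathcal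 D'_i$, uniform $[0,1]$ coins, the probability that $\mathcal D'_i$ gives to a box, the expected outcome $(\pi_{ij}(s))_j,q_i(s)$ of $M_1$ under $\mathcal D'$ for a report $s$ of bidder $i$, and the outcome (sampled allocation and expected prices) of playing $M_1$ on a profile; a query costs one step plus the sizes of the question and the answer. -/

import Mathlib

open MeasureTheory

noncomputable section

namespace BICMech

/-! ### Bidders, allocations, mechanisms -/

/-- A type: the values of one bidder for the `n` items. -/
abbrev Typ (n : ℕ) := Fin n → ℝ

/-- A profile: one type for each of the `m` bidders. -/
abbrev Profile (m n : ℕ) := Fin m → Typ n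

/-- The types with all values in `[0,1]`. -/
def cube (n : ℕ) : Set (Typ n) := {v | ∀ j, 0 ≤ v j ∧ v j ≤ 1}

/-- Feasible deterministic allocations: every item goes to at most one bidder (`none` means that it
is not sold), and bidder `i` receives at most `C i` items. -/
abbrev Alloc {m : ℕ} (C : Fin m → ℕ) (n : ℕ) :=
  {a : Fin n → Option (Fin m) //
    ∀ i, (Finset.univ.filter fun j => a j = some i).card ≤ C i}

/-- The maximum number of items that a feasible mechanism can award. -/
def maxAwarded {m : ℕ} (C : Fin m → ℕ) (n : ℕ) : ℕ :=
  Finset.univ.sup fun a : Alloc C n => (Finset.univ.filter fun j => a.1 j ≠ none).card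

/-- A (randomized, direct) mechanism: on each reported profile, a distribution over feasible
allocations and the expected price charged to each bidder. -/
structure Mechanism {m : ℕ} (C : Fin m → ℕ) (n : ℕ) where
  outcome : Profile m n → PMF (Alloc C n)
  price : Profile m n → Fin m → ℝ

namespace Mechanism

variable {m n : ℕ} {C : Fin m → ℕ}

/-- `φ_{ij}(v)`: the probability that bidder `i` receives item `j` on the reports `v`. -/
def phi (M : Mechanism C n) (v : Profile m n) (i : Fin m) (j : Fin n) : ℝ :=
  ∑ a : Alloc C n, if a.1 j = some i then (M.outcome v a).toReal else 0

/-- `π_{ij}(w)`: the expected value of `φ_{ij}(w ; v_{-i})`, over the types `v_{-i}` of the others.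
(The whole profile is sampled and the coordinate of bidder `i` is overwritten by `w`.) -/
def interimPhi (M : Mechanism C n) (D : Fin m → Measure (Typ n)) (i : Fin m) (w : Typ n)
    (j : Fin n) : ℝ :=
  ∫ v, M.phi (Function.update v i w) i j ∂(Measure.pi D)

/-- The expected price of bidder `i` when she reports `w`, over the types of the others. -/
def interimPrice (M : Mechanism C n) (D : Fin m → Measure (Typ n)) (i : Fin m) (w : Typ n) : ℝ :=
  ∫ v, M.price (Function.update v i w) i ∂(Measure.pi D)

/-- Expected quasi-linear utility of bidder `i` of type `v` who reports `w`. -/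
def interimUtility (M : Mechanism C n) (D : Fin m → Measure (Typ n)) (i : Fin m)
    (v w : Typ n) : ℝ :=
  (∑ j, v j * M.interimPhi D i w j) - M.interimPrice D i w

/-- The expected revenue `R^M(D)` under truthful reports. -/
def revenue (M : Mechanism C n) (D : Fin m → Measure (Typ n)) : ℝ :=
  ∫ v, (∑ i, M.price v i) ∂(Measure.pi D)

end Mechanism

/-- The supports of the bidders' type distributions. -/
def supports {m n : ℕ} (D : Fin m → Measure (Typ n)) (i : Fin m) : Set (Typ n) := (D i).support

/-- The maximum value of any bidder for any item in the support. -/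
def vMax {m n : ℕ} (D : Fin m → Measure (Typ n)) : ℝ :=
  sSup {x | ∃ i, ∃ v ∈ supports D i, ∃ j, x = v j}

/-- `ε`-BIC with respect to `D`, where `V i` is the set of types (true or reported) of bidder `i`.
The expectations in the definition are required to exist. -/
def IsEpsBIC {m n : ℕ} {C : Fin m → ℕ} (ε : ℝ) (D : Fin m → Measure (Typ n))
    (V : Fin m → Set (Typ n)) (M : Mechanism C n) : Prop :=
  ∀ i, ∀ w ∈ V i,
    (∀ j, Integrable (fun v => M.phi (Function.update v i w) i j) (Measure.pi D)) ∧
    Integrable (fun v => M.price (Function.update v i w) i) (Measure.pi D) ∧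
    ∀ v ∈ V i, M.interimUtility D i v v ≥
      M.interimUtility D i v w - ε * vMax D * ∑ j, M.interimPhi D i w j

/-- BIC means `0`-BIC. -/
def IsBIC {m n : ℕ} {C : Fin m → ℕ} (D : Fin m → Measure (Typ n))
    (V : Fin m → Set (Typ n)) (M : Mechanism C n) : Prop :=
  IsEpsBIC 0 D V M

/-- Ex-interim individual rationality. -/
def IsIR {m n : ℕ} {C : Fin m → ℕ} (D : Fin m → Measure (Typ n))
    (V : Fin m → Set (Typ n)) (M : Mechanism C n) : Prop :=
  ∀ i, ∀ v ∈ V i, 0 ≤ M.interimUtility D i v v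

/-! ### The hypotheses on the distributions -/

/-- All types are sampled from `[0,1]^n`, those of `D'` are integer multiples of `δ`, and each
`D i`, `D' i` can be coupled so that `v ≥ v' ≥ v - δ` coordinatewise, with probability `1`. -/
def DiscretizedCoupled {m n : ℕ} (δ : ℝ) (D D' : Fin m → Measure (Typ n)) : Prop :=
  (∀ i, ∀ᵐ v ∂(D i), v ∈ cube n) ∧
  (∀ i, ∀ᵐ v ∂(D' i), v ∈ cube n) ∧
  (∀ i, ∀ᵐ v ∂(D' i), ∀ j, ∃ z : ℤ, v j = z * δ) ∧
  (∀ i, ∃ γ : Measure (Typ n × Typ n), γ.map Prod.fst = D i ∧ γ.map Prod.snd = D' i ∧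
    ∀ᵐ p ∂γ, ∀ j, p.2 j ≤ p.1 j ∧ p.1 j - δ ≤ p.2 j)

/-- The bidders are drawn from one population and have a common demand. -/
def IdenticalBidders {m n : ℕ} (C : Fin m → ℕ) (D : Fin m → Measure (Typ n)) : Prop :=
  ∀ i i', C i = C i' ∧ D i = D i'

/-- Each bidder's distribution is invariant under all permutations of the items. -/
def ItemSymmetric {m n : ℕ} (D : Fin m → Measure (Typ n)) : Prop :=
  ∀ i, ∀ σ : Equiv.Perm (Fin n), (D i).map (fun v => v ∘ σ) = D i

/-- `M` respects all permutations of the items, on profiles from the support of `D`. -/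
def RespectsItemSymmetry {m n : ℕ} {C : Fin m → ℕ} (D : Fin m → Measure (Typ n))
    (M : Mechanism C n) : Prop :=
  ∀ σ : Equiv.Perm (Fin n), ∀ v : Profile m n, (∀ i, v i ∈ supports D i) → ∀ i,
    M.price (fun i' => v i' ∘ σ) i = M.price v i ∧
    ∀ j, M.phi (fun i' => v i' ∘ σ) i j = M.phi v i (σ j)

/-- `M₁` is an `ε`-BIC ex-interim IR mechanism for `D'` (a condition on the support of `D'`),
with nonnegative revenue in case `η > 1`. -/
def IsInputMechanism {m n : ℕ} {C : Fin m → ℕ} (D' : Fin m → Measure (Typ n)) (η ε : ℝ)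
    (M₁ : Mechanism C n) : Prop :=
  IsEpsBIC ε D' (supports D') M₁ ∧ IsIR D' (supports D') M₁ ∧ (1 < η → 0 ≤ M₁.revenue D')

/-- `M₂` is BIC and ex-interim IR for `D`, for all true and reported types in `[0,1]^n`, and has
the guaranteed revenue. -/
def IsBICTransform {m n : ℕ} {C : Fin m → ℕ} (D D' : Fin m → Measure (Typ n)) (δ η ε : ℝ)
    (M₁ M₂ : Mechanism C n) : Prop :=
  IsBIC D (fun _ => cube n) M₂ ∧ IsIR D (fun _ => cube n) M₂ ∧
  Integrable (fun v => ∑ i, M₂.price v i) (Measure.pi D) ∧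
  M₂.revenue D ≥ (1 - η) * M₁.revenue D' - (ε + 2 * δ) / η * maxAwarded C n

/-! ### A real-number machine with oracle queries

Programs compute on binary trees whose leaves carry real numbers (or nothing). Every elementary
operation takes one step, including exact real arithmetic and comparison; an oracle query also pays
for the sizes of the question and of the answer. The only built-in constant is `1`; there is no
rounding operation. -/

/-- Data: trees with real leaves. -/
inductive Val where
  | nil : Val
  | num : ℝ → Val
  | node : Val → Val → Val

namespace Val

/-- The number of constructors. -/
def size : Val → ℕ
  | nil => 1
  | num _ => 1
  | node a b => size a + size b + 1

/-- Lists, as right-nested trees ending in `nil`. -/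
def list : List Val → Val
  | [] => nil
  | x :: l => node x (list l)

/-- The list of the entries of a finite family. -/
def family {n : ℕ} (f : Fin n → Val) : Val := list (List.ofFn f)

/-- A vector of reals. -/
def vec {n : ℕ} (v : Fin n → ℝ) : Val := family fun j => num (v j)

/-- A profile, as the list of the type vectors. -/
def profile {m n : ℕ} (v : Profile m n) : Val := family fun i => vec (v i)

/-- A natural number, as a real. -/
def nat (t : ℕ) : Val := num (t : ℝ)

/-- An allocation, as the list of the receivers of the items. -/
def alloc {m n : ℕ} {C : Fin m → ℕ} (a : Alloc C n) : Val :=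
  family fun j => match a.1 j with
    | none => nil
    | some i => nat i

end Val

/-- Elementary operations. -/
inductive Prim where
  | id | nil | one | fst | snd | add | sub | mul | div | le | isNum | isNode

/-- Truth values: `nil` is false, every other value is true. -/
def Val.ofProp (p : Prop) : Val := open Classical in if p then .num 1 else .nil

/-- The effect of an elementary operation; an operation on data of the wrong shape yields `nil`. -/
def Prim.eval : Prim → Val → Val
  | .id, x => x
  | .nil, _ => .nil
  | .one, _ => .num 1
  | .fst, .node a _ => a
  | .snd, .node _ b => b
  | .add, .node (.num x) (.num y) => .num (x + y)
  | .sub, .node (.num x) (.num y) => .num (x - y)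
  | .mul, .node (.num x) (.num y) => .num (x * y)
  | .div, .node (.num x) (.num y) => .num (x / y)
  | .le, .node (.num x) (.num y) => Val.ofProp (x ≤ y)
  | .isNum, .num _ => .num 1
  | .isNode, .node _ _ => .num 1
  | _, _ => .nil

/-- Programs: each transforms an input value into an output value. -/
inductive Program where
  | prim : Prim → Program
  | query : Program
  | pair : Program → Program → Program
  | comp : Program → Program → Program
  | cond : Program → Program → Program → Program
  | loop : Program → Program

/-- `Exec O c x y s`: with answers given by the oracle `O` (a relation between questions and
answers), the program `c` started on `x` halts with result `y` after `s` steps. -/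
inductive Exec (O : Val → Val → Prop) : Program → Val → Val → ℕ → Prop
  | prim (p : Prim) (x : Val) : Exec O (.prim p) x (p.eval x) 1
  | query {x y : Val} : O x y → Exec O .query x y (1 + x.size + y.size)
  | pair {c d : Program} {x y z : Val} {s t : ℕ} :
      Exec O c x y s → Exec O d x z t → Exec O (.pair c d) x (.node y z) (s + t + 1)
  | comp {c d : Program} {x y z : Val} {s t : ℕ} :
      Exec O d x y s → Exec O c y z t → Exec O (.comp c d) x z (s + t + 1)
  | condTrue {b c d : Program} {x u y : Val} {s t : ℕ} :
      Exec O b x u s → u ≠ .nil → Exec O c x y t → Exec O (.cond b c d) x y (s + t + 1)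
  | condFalse {b c d : Program} {x y : Val} {s t : ℕ} :
      Exec O b x .nil s → Exec O d x y t → Exec O (.cond b c d) x y (s + t + 1)
  /-- The body of a loop returns a flag and a new state; the loop ends when the flag is `nil`. -/
  | loopStop {c : Program} {x y : Val} {s : ℕ} :
      Exec O c x (.node .nil y) s → Exec O (.loop c) x y (s + 1)
  | loopStep {c : Program} {x u y z : Val} {s t : ℕ} :
      Exec O c x (.node u y) s → u ≠ .nil → Exec O (.loop c) y z t →
        Exec O (.loop c) x z (s + t + 1)

/-! ### The data that the transformation can access -/

/-- The uniform distribution on `[0,1]`. -/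
def unif : Measure ℝ := volume.restrict (Set.Icc 0 1)

instance : IsProbabilityMeasure unif := ⟨by simp [unif]⟩

/-- What is sampled at one time index: a type of each bidder from `D`, one from `D'`, a uniform
coin for the program, and a uniform coin for the inner mechanism. -/
abbrev Draw (m n : ℕ) := (Profile m n × Profile m n) × (ℝ × ℝ)

/-- The law of an infinite sequence of independent draws. -/
def drawLaw {m n : ℕ} (D D' : Fin m → Measure (Typ n))
    [∀ i, IsProbabilityMeasure (D i)] [∀ i, IsProbabilityMeasure (D' i)] :
    Measure (ℕ → Draw m n) :=
  Measure.infinitePi fun _ : ℕ =>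
    ((Measure.pi D).prod (Measure.pi D')).prod (unif.prod unif)

/-- `run` realizes the random allocations of `M` as functions of a uniform coin. -/
def IsSampler {m n : ℕ} {C : Fin m → ℕ} (M : Mechanism C n)
    (run : Profile m n → ℝ → Alloc C n) : Prop :=
  ∀ s a, MeasurableSet {u | run s u = a} ∧ unif {u | run s u = a} = M.outcome s a

/-- The questions that may be asked, with their answers: independent samples from each `D i` and
`D' i`, coins, the mass that `D' i` gives to a box, the expected outcome (allocation probabilities
and price) of `M₁` for a report of bidder `i` when the others are sampled from `D'`, and the outcome
of playing `M₁` on a profile. -/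
inductive Answers {m n : ℕ} {C : Fin m → ℕ} (D' : Fin m → Measure (Typ n)) (M₁ : Mechanism C n)
    (run : Profile m n → ℝ → Alloc C n) (ω : ℕ → Draw m n) : Val → Val → Prop
  | sample (i : Fin m) (t : ℕ) :
      Answers D' M₁ run ω (.list [.nat 0, .nat i, .nat t]) (.vec ((ω t).1.1 i))
  | sample' (i : Fin m) (t : ℕ) :
      Answers D' M₁ run ω (.list [.nat 1, .nat i, .nat t]) (.vec ((ω t).1.2 i))
  | coin (t : ℕ) :
      Answers D' M₁ run ω (.list [.nat 2, .nat t]) (.num (ω t).2.1)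
  | mass' (i : Fin m) (a b : Typ n) :
      Answers D' M₁ run ω (.list [.nat 3, .nat i, .vec a, .vec b])
        (.num ((D' i).real (Set.Icc a b)))
  | interim (i : Fin m) (s : Typ n) :
      Answers D' M₁ run ω (.list [.nat 4, .nat i, .vec s])
        (.node (.vec (M₁.interimPhi D' i s)) (.num (M₁.interimPrice D' i s)))
  | play (t : ℕ) (s : Profile m n) :
      Answers D' M₁ run ω (.list [.nat 5, .nat t, .profile s])
        (.node (.alloc (run s (ω t).2.2)) (.vec (M₁.price s)))

/-- The input of the program: the parameters, the demands, and the reports of the bidders. -/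
def inputVal {m n : ℕ} (C : Fin m → ℕ) (δ η : ℝ) (v : Profile m n) : Val :=
  .list [.num δ, .num η, .nat m, .nat n, .family fun i => .nat (C i), .profile v]

/-- On all reports from `[0,1]^n`, with probability `1` the program halts within `B` steps and
outputs a feasible allocation and a price for each bidder; the allocation is distributed as in `M₂`,
and the expected prices are those of `M₂`. -/
def Implements {m n : ℕ} {C : Fin m → ℕ} (D D' : Fin m → Measure (Typ n))
    [∀ i, IsProbabilityMeasure (D i)] [∀ i, IsProbabilityMeasure (D' i)] (δ η : ℝ)
    (M₁ : Mechanism C n) (run : Profile m n → ℝ → Alloc C n) (prog : Program) (B : ℕ)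
    (M₂ : Mechanism C n) : Prop :=
  ∀ v : Profile m n, (∀ i, v i ∈ cube n) →
    ∃ (alloc : (ℕ → Draw m n) → Alloc C n) (pay : (ℕ → Draw m n) → Fin m → ℝ),
      (∀ a, MeasurableSet {ω | alloc ω = a} ∧
        drawLaw D D' {ω | alloc ω = a} = M₂.outcome v a) ∧
      (∀ i, Integrable (fun ω => pay ω i) (drawLaw D D') ∧
        ∫ ω, pay ω i ∂(drawLaw D D') = M₂.price v i) ∧
      ∀ᵐ ω ∂(drawLaw D D'), ∃ s ≤ B,
        Exec (Answers D' M₁ run ω) prog (inputVal C δ η v)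
          (.node (.alloc (alloc ω)) (.vec (pay ω))) s

end BICMech

end

open BICMech

/-! The transformation is a replica–surrogate matching. For each bidder, `r` replicas are drawn from
`D i` and `r` surrogates from `D' i`, and the report overwrites a replica at a random position. The
edge from a replica to a surrogate carries the positive part of the replica's value for the
surrogate's interim outcome under `M₁`, minus `β = max (1 - η) 0` times its interim price. A
maximum-weight perfect matching (`solve`) selects the surrogate that plays `M₁` for the bidder. She
always pays her Clarke externality; if her edge is positive she also pays `β` times the interim
price and keeps the items, otherwise they are withheld.

Incentives. For fixed randomness this is VCG on expected outcomes, hence truthful and individually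
rational (`truthful`, `charge_le`). What is delivered agrees with what was priced: the matching is
perfect, so a uniform position is matched to a uniform surrogate, and a truthful bidder's surrogate
has exactly the law `D' i` (`lintegral_pick`). Thus `M₁` faces the profile law `D'`
(`transformed_interim`).

Revenue. Bound the weight of the optimal matching twice (`Surrogates.sum_price_le`). From above, by
approximate incentive compatibility: an edge is worth at most the utility of the discretised
replica, plus `ε + δ` per item, plus the discount `(1 - β)·price` if it is sold. From below, by
matching replicas and surrogates of equal class: all surrogate utilities plus all discounts, minus
`T` per mismatch. In expectation the utilities cancel, as the discretised replicas and the
surrogates have the same law. So nearly the whole price mass is sold, and each sale brings at least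
`β·price`. The expected number of mismatches is a variance estimate (`integral_abs_cnt_sub_le`);
with `r` at least the number of classes times `(m/δ)²` its total cost over all bidders is `δT`. If
`η ≥ 1`, only externalities are charged and the claimed bound is nonpositive.

Symmetry. On the grid there are `levels ^ n` types, polynomially many in the other parameters only
for fixed `n`. If everything is invariant under permutations of the items, a replica is offered
every rearrangement of a surrogate's outcome; classes are then orbits, at most `(n + 1) ^ levels`
many. A random relabelling of the items removes the bias of deterministic tie-breaking. The flag
`sym` selects the full or the trivial group, so one construction serves both algorithmic statements.

Algorithm. `Comp` is a calculus of polynomial-time computations, closed under pairing, branching,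
folds and queries. The matching is found exactly over the reals in a fixed number of steps, with
deterministic ties, which also makes it measurable. Uniform positions and permutations arise by
sorting coins, and the count `r` is rounded up by counting down. -/

noncomputable section

namespace BICMech

/-! ### Polynomial bounds -/

/-- Monotone functions bounded by a polynomial. -/
def PolyBd (T : ℕ → ℕ) : Prop := Monotone T ∧ ∃ A d : ℕ, ∀ s, T s ≤ A * (s + 1) ^ d

namespace PolyBd

theorem const (c : ℕ) : PolyBd fun _ => c :=
  ⟨fun _ _ _ => le_rfl, c, 0, fun _ => by simp⟩

theorem id : PolyBd fun s => s := ⟨fun _ _ h => h, 1, 1, fun s => by simp⟩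

theorem add {S T : ℕ → ℕ} (hS : PolyBd S) (hT : PolyBd T) : PolyBd fun s => S s + T s := by
  obtain ⟨mS, A, d, hA⟩ := hS
  obtain ⟨mT, B, e, hB⟩ := hT
  refine ⟨fun a b h => add_le_add (mS h) (mT h), A + B, d + e, fun s => ?_⟩
  have h1 : (s + 1) ^ d ≤ (s + 1) ^ (d + e) := Nat.pow_le_pow_right (by omega) (by omega)
  have h2 : (s + 1) ^ e ≤ (s + 1) ^ (d + e) := Nat.pow_le_pow_right (by omega) (by omega)
  calc S s + T s ≤ A * (s + 1) ^ (d + e) + B * (s + 1) ^ (d + e) :=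
        add_le_add ((hA s).trans (Nat.mul_le_mul_left _ h1)) ((hB s).trans (Nat.mul_le_mul_left _ h2))
    _ = _ := by ring

theorem mul {S T : ℕ → ℕ} (hS : PolyBd S) (hT : PolyBd T) : PolyBd fun s => S s * T s := by
  obtain ⟨mS, A, d, hA⟩ := hS
  obtain ⟨mT, B, e, hB⟩ := hT
  refine ⟨fun a b h => Nat.mul_le_mul (mS h) (mT h), A * B, d + e, fun s => ?_⟩
  calc S s * T s ≤ (A * (s + 1) ^ d) * (B * (s + 1) ^ e) := Nat.mul_le_mul (hA s) (hB s)
    _ = _ := by ring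

theorem comp {S T : ℕ → ℕ} (hS : PolyBd S) (hT : PolyBd T) : PolyBd fun s => S (T s) := by
  obtain ⟨mS, A, d, hA⟩ := hS
  obtain ⟨mT, B, e, hB⟩ := hT
  refine ⟨fun a b h => mS (mT h), A * (B + 1) ^ d, e * d, fun s => ?_⟩
  have h1 : 1 ≤ (s + 1) ^ e := Nat.one_le_pow _ _ (by omega)
  have h2 : T s + 1 ≤ (B + 1) * (s + 1) ^ e := by nlinarith [hB s]
  calc S (T s) ≤ A * (T s + 1) ^ d := hA _
    _ ≤ A * ((B + 1) * (s + 1) ^ e) ^ d := Nat.mul_le_mul_left _ (Nat.pow_le_pow_left h2 _)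
    _ = _ := by rw [mul_pow, ← pow_mul]; ring

theorem pow {S : ℕ → ℕ} (hS : PolyBd S) (d : ℕ) : PolyBd fun s => S s ^ d := by
  induction d with
  | zero => simpa using const 1
  | succ d ih => simpa [pow_succ] using ih.mul hS

end PolyBd

/-! ### Runs within a time bound -/

/-- The program halts with the given result within `t` steps. -/
def Ev (O : Val → Val → Prop) (p : Program) (x y : Val) (t : ℕ) : Prop := ∃ s ≤ t, Exec O p x y s

namespace Ev

variable {O : Val → Val → Prop} {p q b : Program} {x y z u : Val} {s t k : ℕ}

theorem mono (h : Ev O p x y s) (hst : s ≤ t) : Ev O p x y t :=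
  let ⟨r, hr, e⟩ := h; ⟨r, hr.trans hst, e⟩

theorem prim (c : Prim) (x : Val) : Ev O (.prim c) x (c.eval x) 1 := ⟨1, le_rfl, .prim c x⟩

theorem pair (h1 : Ev O p x y s) (h2 : Ev O q x z t) :
    Ev O (.pair p q) x (.node y z) (s + t + 1) :=
  let ⟨r, hr, e⟩ := h1; let ⟨r', hr', e'⟩ := h2; ⟨r + r' + 1, by omega, .pair e e'⟩

theorem comp (h1 : Ev O q x y s) (h2 : Ev O p y z t) : Ev O (.comp p q) x z (s + t + 1) :=
  let ⟨r, hr, e⟩ := h1; let ⟨r', hr', e'⟩ := h2; ⟨r + r' + 1, by omega, .comp e e'⟩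

theorem condTrue (hb : Ev O b x u s) (hu : u ≠ .nil) (h : Ev O p x y t) :
    Ev O (.cond b p q) x y (s + t + 1) :=
  let ⟨r, hr, e⟩ := hb; let ⟨r', hr', e'⟩ := h; ⟨r + r' + 1, by omega, .condTrue e hu e'⟩

theorem condFalse (hb : Ev O b x .nil s) (h : Ev O q x y t) :
    Ev O (.cond b p q) x y (s + t + 1) :=
  let ⟨r, hr, e⟩ := hb; let ⟨r', hr', e'⟩ := h; ⟨r + r' + 1, by omega, .condFalse e e'⟩

theorem loopStop (h : Ev O p x (.node .nil y) s) : Ev O (.loop p) x y (s + 1) :=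
  let ⟨r, hr, e⟩ := h; ⟨r + 1, by omega, .loopStop e⟩

theorem loopStep (h : Ev O p x (.node u y) s) (hu : u ≠ .nil) (h' : Ev O (.loop p) y z t) :
    Ev O (.loop p) x z (s + t + 1) :=
  let ⟨r, hr, e⟩ := h; let ⟨r', hr', e'⟩ := h'; ⟨r + r' + 1, by omega, .loopStep e hu e'⟩

end Ev

/-- The body of the loop that folds `p` over a list: the state is `(context, (accumulator, list))`. -/
def foldBody (p : Program) : Program :=
  .cond (.comp (.prim .isNode) (.comp (.prim .snd) (.prim .snd)))
    (.pair (.prim .one)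
      (.pair (.prim .fst)
        (.pair (.comp p (.pair (.prim .fst) (.pair (.comp (.prim .fst) (.prim .snd))
            (.comp (.prim .fst) (.comp (.prim .snd) (.prim .snd))))))
          (.comp (.prim .snd) (.comp (.prim .snd) (.prim .snd))))))
    (.pair (.prim .nil) (.prim .id))

/-- The body is assumed to run in time `t` only from states reached along the list, so a size bound
on reachable accumulators controls the whole loop. The constant 40 pays for the plumbing of one
round. -/
theorem Ev.foldLoop {O : Val → Val → Prop} {p : Program} {f : Val} {S E : Type*} {encS : S → Val}
    {encE : E → Val} {step : S → E → S} {t : ℕ} (post : List E) : ∀ (s : S),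
    (∀ pre e post', post = pre ++ e :: post' →
      Ev O p (.node f (.node (encS (pre.foldl step s)) (encE e)))
        (encS (step (pre.foldl step s) e)) t) →
    Ev O (.loop (foldBody p)) (.node f (.node (encS s) (.list (post.map encE))))
      (.node f (.node (encS (post.foldl step s)) .nil)) ((t + 40) * (post.length + 1)) := by
  induction post with
  | nil =>
    intro s _
    refine Ev.mono (Ev.loopStop (s := 20) ?_) (by simp)
    exact (Ev.condFalse (Ev.comp (Ev.comp (Ev.prim _ _) (Ev.prim _ _)) (Ev.prim _ _))
      (Ev.pair (Ev.prim _ _) (Ev.prim _ _))).mono (by omega)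
  | cons e post ih =>
    intro s h
    have h1 := h [] e post rfl
    have h2 := ih (step s e) (fun pre e' post' hp => by
      have := h (e :: pre) e' post' (by simp [hp])
      simpa using this)
    have hb : Ev O (foldBody p) (.node f (.node (encS s) (.list ((e :: post).map encE))))
        (.node (.num 1) (.node f (.node (encS (step s e)) (.list (post.map encE))))) (t + 39) := by
      refine (Ev.condTrue (u := .num 1)
        (Ev.comp (Ev.comp (Ev.prim _ _) (Ev.prim _ _)) (Ev.prim _ _)) (by simp)
        (Ev.pair (Ev.prim _ _) (Ev.pair (Ev.prim _ _) (Ev.pair (Ev.comp (Ev.pair (Ev.prim _ _)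
          (Ev.pair (Ev.comp (Ev.prim _ _) (Ev.prim _ _))
            (Ev.comp (Ev.comp (Ev.prim _ _) (Ev.prim _ _)) (Ev.prim _ _)))) h1)
          (Ev.comp (Ev.comp (Ev.prim _ _) (Ev.prim _ _)) (Ev.prim _ _)))))).mono (by omega)
    refine (Ev.loopStep hb (by simp) h2).mono ?_
    simp only [List.length_cons]
    ring_nf
    omega

/-! ### Computations in polynomial time -/

/-- One program computes `G x` from `F x`, in time polynomial in the size of `F x`, with an output of
polynomial size. -/
def Comp {X : Type*} (O : X → Val → Val → Prop) (F G : X → Val) : Prop :=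
  ∃ (p : Program) (T : ℕ → ℕ), PolyBd T ∧
    ∀ x, Ev (O x) p (F x) (G x) (T (F x).size) ∧ (G x).size ≤ T (F x).size

namespace Comp

variable {X : Type*} {O : X → Val → Val → Prop} {F G H K : X → Val}

theorem refl (O : X → Val → Val → Prop) (F : X → Val) : Comp O F F :=
  ⟨.prim .id, fun s => s + 1, PolyBd.id.add (.const 1),
    fun x => by beta_reduce; exact ⟨(Ev.prim _ _).mono (by omega), by omega⟩⟩

theorem trans (h1 : Comp O F G) (h2 : Comp O G H) : Comp O F H := by
  obtain ⟨p, T, hT, hp⟩ := h1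
  obtain ⟨q, U, hU, hq⟩ := h2
  refine ⟨.comp q p, fun s => T s + U (T s) + 1, (hT.add (hU.comp hT)).add (.const 1), fun x => ?_⟩
  have := hU.1 (hp x).2
  beta_reduce
  exact ⟨((hp x).1.comp (hq x).1).mono (by omega), by have := (hq x).2; omega⟩

theorem pair (h1 : Comp O F G) (h2 : Comp O F H) : Comp O F fun x => .node (G x) (H x) := by
  obtain ⟨p, T, hT, hp⟩ := h1
  obtain ⟨q, U, hU, hq⟩ := h2
  refine ⟨.pair p q, fun s => T s + U s + 1, (hT.add hU).add (.const 1), fun x => ?_⟩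
  exact ⟨((hp x).1.pair (hq x).1), by have := (hq x).2; have := (hp x).2; simp [Val.size]; omega⟩

theorem comap {Y : Type*} (h : Comp O F G) (φ : Y → X) :
    Comp (fun y => O (φ y)) (fun y => F (φ y)) (fun y => G (φ y)) := by
  obtain ⟨p, T, hT, hp⟩ := h
  exact ⟨p, T, hT, fun y => hp (φ y)⟩

theorem of_prim (c : Prim) (h : ∀ x, c.eval (F x) = G x) (hs : ∀ x, (G x).size ≤ (F x).size) :
    Comp O F G :=
  ⟨.prim c, fun s => s + 1, PolyBd.id.add (.const 1),
    fun x => by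
      beta_reduce
      have h1 : Ev (O x) (.prim c) (F x) (G x) 1 := h x ▸ Ev.prim c (F x)
      exact ⟨h1.mono (by omega), by have := hs x; omega⟩⟩

theorem _root_.BICMech.Val.one_le_size (v : Val) : 1 ≤ v.size := by
  cases v <;> simp [Val.size]

theorem fst (h : Comp O F fun x => .node (G x) (H x)) : Comp O F G :=
  h.trans (of_prim .fst (fun _ => rfl) fun _ => by simp [Val.size]; omega)

theorem snd (h : Comp O F fun x => .node (G x) (H x)) : Comp O F H :=
  h.trans (of_prim .snd (fun _ => rfl) fun _ => by simp [Val.size]; omega)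

theorem nil : Comp O F fun _ => .nil :=
  of_prim .nil (fun _ => by simp [Prim.eval]) fun x => by simpa [Val.size] using (F x).one_le_size

theorem one : Comp O F fun _ => .num 1 :=
  of_prim .one (fun _ => by simp [Prim.eval]) fun x => by simpa [Val.size] using (F x).one_le_size

variable {a b : X → ℝ}

theorem add (ha : Comp O F fun x => .num (a x)) (hb : Comp O F fun x => .num (b x)) :
    Comp O F fun x => .num (a x + b x) :=
  (ha.pair hb).trans (of_prim .add (fun _ => rfl) fun _ => by simp [Val.size])

theorem sub (ha : Comp O F fun x => .num (a x)) (hb : Comp O F fun x => .num (b x)) :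
    Comp O F fun x => .num (a x - b x) :=
  (ha.pair hb).trans (of_prim .sub (fun _ => rfl) fun _ => by simp [Val.size])

theorem mul (ha : Comp O F fun x => .num (a x)) (hb : Comp O F fun x => .num (b x)) :
    Comp O F fun x => .num (a x * b x) :=
  (ha.pair hb).trans (of_prim .mul (fun _ => rfl) fun _ => by simp [Val.size])

theorem div (ha : Comp O F fun x => .num (a x)) (hb : Comp O F fun x => .num (b x)) :
    Comp O F fun x => .num (a x / b x) :=
  (ha.pair hb).trans (of_prim .div (fun _ => rfl) fun _ => by simp [Val.size])

theorem le (ha : Comp O F fun x => .num (a x)) (hb : Comp O F fun x => .num (b x)) :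
    Comp O F fun x => .ofProp (a x ≤ b x) :=
  (ha.pair hb).trans (of_prim .le (fun _ => rfl) fun _ => by
    simp only [Val.ofProp]; split <;> simp [Val.size])

theorem zero : Comp O F fun _ => .num 0 := by
  simpa using (one (O := O) (F := F)).sub one

theorem natConst (k : ℕ) : Comp O F fun _ => .num (k : ℝ) := by
  induction k with
  | zero => simpa using (zero (O := O) (F := F))
  | succ k ih => simpa using ih.add one

theorem neg (ha : Comp O F fun x => .num (a x)) : Comp O F fun x => .num (-a x) := by
  simpa using (zero (O := O) (F := F)).sub ha

/-- Case distinction; each branch is only run where it applies. -/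
theorem cond {P : X → Prop} [DecidablePred P] (hP : Comp O F fun x => .ofProp (P x))
    (hG : Comp (fun x : {x // P x} => O x) (fun x => F x) (fun x => G x))
    (hH : Comp (fun x : {x // ¬ P x} => O x) (fun x => F x) (fun x => H x)) :
    Comp O F fun x => if P x then G x else H x := by
  obtain ⟨b, U, hU, hb⟩ := hP
  obtain ⟨p, T, hT, hp⟩ := hG
  obtain ⟨q, V, hV, hq⟩ := hH
  refine ⟨.cond b p q, fun s => U s + (T s + V s) + 1, (hU.add (hT.add hV)).add (.const 1),
    fun x => ?_⟩
  by_cases hx : P x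
  · have h1 := hp ⟨x, hx⟩
    simp only [hx, if_true]
    refine ⟨(Ev.condTrue (hb x).1 (by simp [Val.ofProp, hx]) h1.1).mono (by dsimp only; omega), ?_⟩
    have := h1.2
    dsimp only at this ⊢
    omega
  · have h1 := hq ⟨x, hx⟩
    have hb' := (hb x).1
    simp only [Val.ofProp, hx, if_false] at hb' ⊢
    refine ⟨(Ev.condFalse hb' h1.1).mono (by dsimp only; omega), ?_⟩
    have := h1.2
    dsimp only at this ⊢
    omega

theorem ite {P : X → Prop} [DecidablePred P] (hP : Comp O F fun x => .ofProp (P x))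
    (hG : Comp O F G) (hH : Comp O F H) : Comp O F fun x => if P x then G x else H x :=
  cond hP (hG.comap Subtype.val) (hH.comap Subtype.val)

theorem congr (h : Comp O F G) (hGH : ∀ x, G x = H x) : Comp O F H := by
  rwa [show H = G from (funext hGH).symm]

theorem and {P Q : X → Prop} (hP : Comp O F fun x => .ofProp (P x))
    (hQ : Comp O F fun x => .ofProp (Q x)) : Comp O F fun x => .ofProp (P x ∧ Q x) := by
  classical
  exact (ite hP hQ nil).congr fun x => by by_cases h : P x <;> simp [Val.ofProp, h]

theorem not {P : X → Prop} (hP : Comp O F fun x => .ofProp (P x)) :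
    Comp O F fun x => .ofProp (¬ P x) := by
  classical
  exact (ite hP nil one).congr fun x => by by_cases h : P x <;> simp [Val.ofProp, h]

theorem or {P Q : X → Prop} (hP : Comp O F fun x => .ofProp (P x))
    (hQ : Comp O F fun x => .ofProp (Q x)) : Comp O F fun x => .ofProp (P x ∨ Q x) := by
  classical
  exact (ite hP one hQ).congr fun x => by by_cases h : P x <;> simp [Val.ofProp, h]

theorem lt (ha : Comp O F fun x => .num (a x)) (hb : Comp O F fun x => .num (b x)) :
    Comp O F fun x => .ofProp (a x < b x) := by
  simpa using (le hb ha).not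

theorem eq (ha : Comp O F fun x => .num (a x)) (hb : Comp O F fun x => .num (b x)) :
    Comp O F fun x => .ofProp (a x = b x) := by
  simpa [le_antisymm_iff] using (le ha hb).and (le hb ha)

theorem max (ha : Comp O F fun x => .num (a x)) (hb : Comp O F fun x => .num (b x)) :
    Comp O F fun x => .num (max (a x) (b x)) := by
  exact (ite (le ha hb) hb ha).congr fun x => by
    split <;> rename_i h
    · rw [max_eq_right h]
    · rw [max_eq_left (le_of_not_ge h)]

/-- A query, when the answers have polynomial size. -/
theorem query (hF : Comp O F G) (hO : ∀ x, O x (G x) (H x))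
    (hs : ∃ T, PolyBd T ∧ ∀ x, (H x).size ≤ T (F x).size) : Comp O F H := by
  obtain ⟨p, U, hU, hp⟩ := hF
  obtain ⟨T, hT, hs⟩ := hs
  refine ⟨.comp .query p, fun s => U s + (1 + U s + T s) + 1,
    (hU.add (((PolyBd.const 1).add hU).add hT)).add (.const 1), fun x => ?_⟩
  have h1 : Ev (O x) .query (G x) (H x) (1 + (G x).size + (H x).size) :=
    ⟨_, le_rfl, .query (hO x)⟩
  have h2 := (hp x).2
  have h3 := hs x
  beta_reduce
  exact ⟨((hp x).1.comp h1).mono (by omega), by omega⟩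

theorem _root_.BICMech.Val.size_le_size_list {v : Val} {l : List Val} (h : v ∈ l) :
    v.size ≤ (Val.list l).size := by
  induction l with
  | nil => simp at h
  | cons w l ih =>
    rcases List.mem_cons.1 h with rfl | h
    · simp [Val.list, Val.size]; omega
    · have := ih h
      simp [Val.list, Val.size]; omega

theorem _root_.BICMech.Val.length_le_size_list (l : List Val) : l.length ≤ (Val.list l).size := by
  induction l with
  | nil => simp
  | cons w l ih =>
    have := w.one_le_size
    simp [Val.list, Val.size]; omega

/-- Folding over a list, when the intermediate results have polynomial size. -/
theorem foldl {S E : X → Type*} {encS : ∀ x, S x → Val} {encE : ∀ x, E x → Val}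
    {step : ∀ x, S x → E x → S x} {l : ∀ x, List (E x)} {init : ∀ x, S x}
    (hl : Comp O F fun x => .list ((l x).map (encE x)))
    (hi : Comp O F fun x => encS x (init x))
    (hstep : Comp (fun y : (x : X) × (S x × E x) => O y.1)
      (fun y => .node (F y.1) (.node (encS y.1 y.2.1) (encE y.1 y.2.2)))
      (fun y => encS y.1 (step y.1 y.2.1 y.2.2)))
    (hsize : ∃ T, PolyBd T ∧ ∀ x pre post, l x = pre ++ post →
      (encS x (pre.foldl (step x) (init x))).size ≤ T (F x).size) :
    Comp O F fun x => encS x ((l x).foldl (step x) (init x)) := by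
  obtain ⟨pl, U, hU, hl⟩ := hl
  obtain ⟨pi, V, hV, hi⟩ := hi
  obtain ⟨ps, W, hW, hstep⟩ := hstep
  obtain ⟨T, hT, hsize⟩ := hsize
  -- The argument of `W` bounds what one step receives: the context, the accumulator and a list
  -- entry. `U` also bounds the number of rounds.
  refine ⟨.comp (.comp (.prim .fst) (.prim .snd)) (.comp (.loop (foldBody ps))
    (.pair (.prim .id) (.pair pi pl))),
    fun s => (W (s + (T s + U s + 1) + 1) + 40) * (U s + 1) + (U s + V s + 20) + T s, ?_, fun x => ?_⟩
  · exact ((((hW.comp ((PolyBd.id.add ((hT.add hU).add (.const 1))).add (.const 1))).add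
      (.const 40)).mul (hU.add (.const 1))).add ((hU.add hV).add (.const 20))).add hT
  have hlen : (l x).length ≤ U (F x).size := by
    have := Val.length_le_size_list ((l x).map (encE x))
    have := (hl x).2
    simp at *; omega
  have hloop := Ev.foldLoop (O := O x) (p := ps) (f := F x) (encS := encS x) (encE := encE x)
    (step := step x) (t := W ((F x).size + (T (F x).size + U (F x).size + 1) + 1)) (l x) (init x)
    (fun pre e post hp => by
      have h1 := hstep ⟨x, pre.foldl (step x) (init x), e⟩
      refine h1.1.mono (hW.1 ?_)
      have h2 := hsize x pre (e :: post) hp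
      have h3 : (encE x e).size ≤ U (F x).size :=
        (Val.size_le_size_list (List.mem_map_of_mem (by simp [hp]))).trans (hl x).2
      simp only [Val.size]
      omega)
  have hfin := hsize x (l x) [] (by simp)
  have h0 := (((Ev.prim (O := O x) .id (F x)).pair ((hi x).1.pair (hl x).1)).comp hloop).comp
    ((Ev.prim (O := O x) .snd _).comp (Ev.prim .fst _))
  refine ⟨h0.mono ?_, by dsimp only; omega⟩
  have : (W ((F x).size + (T (F x).size + U (F x).size + 1) + 1) + 40) * ((l x).length + 1) ≤
      (W ((F x).size + (T (F x).size + U (F x).size + 1) + 1) + 40) * (U (F x).size + 1) :=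
    Nat.mul_le_mul_left _ (by omega)
  beta_reduce
  omega

/-! ### Lists and families -/

/-- Weakening. `F` acts as a context to which bound variables are paired on the right; nested
tabulations are compiled in this way. -/
theorem wk {Y : Type*} (h : Comp O F G) (φ : Y → X) {H : Y → Val} :
    Comp (fun y => O (φ y)) (fun y => .node (F (φ y)) (H y)) (fun y => G (φ y)) :=
  (fst (refl _ _)).trans (h.comap φ)

theorem _root_.BICMech.Val.size_list_le {l : List Val} {B : ℕ} (h : ∀ v ∈ l, v.size ≤ B) :
    (Val.list l).size ≤ l.length * (B + 1) + 1 := by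
  induction l with
  | nil => simp [Val.list, Val.size]
  | cons w l ih =>
    have h1 := h w (by simp)
    have h2 := ih fun v hv => h v (by simp [hv])
    simp only [Val.list, Val.size, List.length_cons]
    ring_nf at h2 ⊢
    omega

/-- A fold pushes onto the front of the accumulator, so the images come out reversed; `map` restores
the order by a second pass. -/
theorem revMap {E : X → Type*} {encE : ∀ x, E x → Val} {l : ∀ x, List (E x)} {g : ∀ x, E x → Val}
    (hl : Comp O F fun x => .list ((l x).map (encE x)))
    (hg : Comp (fun y : (x : X) × E x => O y.1) (fun y => .node (F y.1) (encE y.1 y.2))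
      (fun y => g y.1 y.2)) :
    Comp O F fun x => .list ((l x).map (g x)).reverse := by
  have key : ∀ x (l : List (E x)) (s : List Val),
      l.foldl (fun s e => g x e :: s) s = (l.map (g x)).reverse ++ s := by
    intro x l
    induction l with
    | nil => simp
    | cons e l ih => intro s; simp [ih]
  refine (foldl (S := fun _ => List Val) (encS := fun _ => Val.list) (encE := encE) (l := l)
    (step := fun x s e => g x e :: s) (init := fun _ => []) hl nil ?_ ?_).congr fun x => ?_
  · have h0 := refl (fun y : (x : X) × (List Val × E x) => O y.1)
      (fun y => .node (F y.1) (.node (Val.list y.2.1) (encE y.1 y.2.2)))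
    exact pair ((h0.fst.pair h0.snd.snd).trans
      (hg.comap fun y : (x : X) × (List Val × E x) => (⟨y.1, y.2.2⟩ : (x : X) × E x))) h0.snd.fst
  · obtain ⟨_, U, hU, hl⟩ := hl
    obtain ⟨_, W, hW, hg⟩ := hg
    refine ⟨fun s => U s * (W (s + U s + 1) + 1) + 1,
      (hU.mul ((hW.comp ((PolyBd.id.add hU).add (.const 1))).add (.const 1))).add (.const 1),
      fun x pre post hp => ?_⟩
    have hlen : (l x).length ≤ U (F x).size := by
      have := Val.length_le_size_list ((l x).map (encE x))
      have := (hl x).2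
      simp at *; omega
    rw [key]
    refine (Val.size_list_le (B := W ((F x).size + U (F x).size + 1)) fun v hv => ?_).trans ?_
    · simp only [List.append_nil, List.mem_reverse, List.mem_map] at hv
      obtain ⟨e, he, rfl⟩ := hv
      refine (hg ⟨x, e⟩).2.trans (hW.1 ?_)
      have : (encE x e).size ≤ U (F x).size :=
        (Val.size_le_size_list (List.mem_map_of_mem (by simp [hp, he]))).trans (hl x).2
      simp only [Val.size]; omega
    · have h3 : pre.length ≤ U (F x).size := by
        rw [hp] at hlen; simp at hlen; omega
      simp only [List.append_nil, List.length_reverse, List.length_map]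
      exact Nat.add_le_add_right (Nat.mul_le_mul_right _ h3) 1
  · rw [key]; simp

theorem map {E : X → Type*} {encE : ∀ x, E x → Val} {l : ∀ x, List (E x)} {g : ∀ x, E x → Val}
    (hl : Comp O F fun x => .list ((l x).map (encE x)))
    (hg : Comp (fun y : (x : X) × E x => O y.1) (fun y => .node (F y.1) (encE y.1 y.2))
      (fun y => g y.1 y.2)) :
    Comp O F fun x => .list ((l x).map (g x)) := by
  have h := revMap hl hg
  refine (revMap (E := fun _ => Val) (encE := fun _ => id) (g := fun _ => id)
    (l := fun x => ((l x).map (g x)).reverse) (by simpa using h) (refl _ _).snd).congr fun x => ?_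
  simp

end Comp

/-! ### Ranges as loop bounds: tabulation, iteration, lookup. -/

/-- The list of the numbers below `r`. -/
def Val.rng (r : ℕ) : Val := Val.family fun i : Fin r => Val.nat i

theorem Val.family_eq {r : ℕ} (f : Fin r → Val) :
    Val.family f = Val.list ((List.finRange r).map f) := by
  rw [Val.family, List.ofFn_eq_map]

theorem Val.size_family_le {r : ℕ} {f : Fin r → Val} {B : ℕ} (h : ∀ i, (f i).size ≤ B) :
    (Val.family f).size ≤ r * (B + 1) + 1 := by
  have := Val.size_list_le (l := List.ofFn f) (B := B) (by simpa [List.mem_ofFn] using h)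
  simpa [Val.family] using this

theorem Val.le_size_family {r : ℕ} (f : Fin r → Val) : r ≤ (Val.family f).size := by
  simpa [Val.family] using Val.length_le_size_list (List.ofFn f)

namespace Comp

variable {X : Type*} {O : X → Val → Val → Prop} {F G H K : X → Val} {r : X → ℕ}

/-- Numbers are reals without rounding, so a loop bound has to be a list. Counting along a list of
the right length produces the range. -/
theorem rng_length {l : X → List Val} (hl : Comp O F fun x => .list (l x)) :
    Comp O F fun x => .rng (l x).length := by
  have key : ∀ (l : List Val) (s : ℕ), l.foldl (fun k _ => k + 1) s = s + l.length := by
    intro l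
    induction l with
    | nil => simp
    | cons e l ih => intro s; simp [ih]; omega
  have h := foldl (S := fun _ => ℕ) (E := fun _ => Val) (encE := fun _ => id)
    (encS := fun _ k => .node (.nat k) (.list ((List.range k).map Val.nat).reverse))
    (step := fun _ k _ => k + 1) (init := fun _ => 0) (l := l) (O := O) (F := F)
    (by simpa using hl) ?_ ?_ ?_
  · refine (revMap (E := fun _ => Val) (encE := fun _ => id) (g := fun _ => id)
      (by simpa using h.snd) (refl _ _).snd).congr fun x => ?_
    rw [List.map_id, List.reverse_reverse, Val.rng, Val.family_eq, ← List.map_coe_finRange_eq_range, List.map_map]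
    rfl
  · simp only [Val.nat, Nat.cast_zero]
    exact zero.pair nil
  · have h0 := refl (fun y : (x : X) × (ℕ × Val) => O y.1) (fun y => .node (F y.1) (.node
      (.node (.nat y.2.1) (.list ((List.range y.2.1).map Val.nat).reverse)) y.2.2))
    refine (pair (add h0.snd.fst.fst one) (pair h0.snd.fst.fst h0.snd.fst.snd)).congr fun y => ?_
    simp [Val.nat, List.range_succ, Val.list]
  · obtain ⟨_, U, hU, hl⟩ := hl
    refine ⟨fun s => 1 + (U s * (1 + 1) + 1) + 1, ((PolyBd.const 1).add ((hU.mul (.const 2)).add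
      (.const 1))).add (.const 1), fun x pre post hp => ?_⟩
    have h1 : pre.length ≤ U (F x).size := by
      have := Val.length_le_size_list (l x)
      have := (hl x).2
      simp [hp] at *; omega
    rw [key]
    simp only [Val.size, Val.nat, zero_add]
    have h2 := Val.size_list_le (B := 1) (l := ((List.range pre.length).map Val.nat).reverse) (by
      simp only [List.mem_reverse, List.mem_map]
      rintro v ⟨k, _, rfl⟩
      simp [Val.nat, Val.size])
    simp only [List.length_reverse, List.length_map, List.length_range] at h2
    have := Nat.mul_le_mul_right (1 + 1) h1
    omega

theorem rng_of_family {g : ∀ x, Fin (r x) → Val} (hg : Comp O F fun x => .family (g x)) :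
    Comp O F fun x => .rng (r x) := by
  simpa using rng_length (l := fun x => List.ofFn (g x)) hg

/-- Tabulation. -/
theorem lam {g : ∀ x, Fin (r x) → Val} (hr : Comp O F fun x => .rng (r x))
    (hg : Comp (fun y : (x : X) × Fin (r x) => O y.1) (fun y => .node (F y.1) (.nat y.2))
      (fun y => g y.1 y.2)) :
    Comp O F fun x => .family (g x) := by
  rw [show (fun x => Val.family (g x)) = fun x => Val.list ((List.finRange (r x)).map (g x)) from
    funext fun x => Val.family_eq _]
  simp only [Val.family_eq, Val.rng] at hr
  exact map (E := fun x => Fin (r x)) (encE := fun x i => .nat i) hr hg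

/-- The size bound is asked of all states, not only of reachable ones; this is enough for encodings
whose size depends on the dimensions alone. -/
theorem foldFin {S : X → Type*} {encS : ∀ x, S x → Val} {step : ∀ x, S x → Fin (r x) → S x}
    {init : ∀ x, S x} (hr : Comp O F fun x => .rng (r x))
    (hi : Comp O F fun x => encS x (init x))
    (hstep : Comp (fun y : (x : X) × (S x × Fin (r x)) => O y.1)
      (fun y => .node (F y.1) (.node (encS y.1 y.2.1) (.nat y.2.2)))
      (fun y => encS y.1 (step y.1 y.2.1 y.2.2)))
    (hsize : ∃ T, PolyBd T ∧ ∀ x s, (encS x s).size ≤ T (F x).size) :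
    Comp O F fun x => encS x ((List.finRange (r x)).foldl (step x) (init x)) := by
  simp only [Val.family_eq, Val.rng] at hr
  obtain ⟨T, hT, h⟩ := hsize
  exact foldl (E := fun x => Fin (r x)) (encE := fun x i => .nat i) hr hi hstep
    ⟨T, hT, fun x _ _ _ => h x _⟩

theorem iterate {S : X → Type*} {encS : ∀ x, S x → Val} {step : ∀ x, S x → S x}
    {init : ∀ x, S x} (hr : Comp O F fun x => .rng (r x))
    (hi : Comp O F fun x => encS x (init x))
    (hstep : Comp (fun y : (x : X) × S x => O y.1)
      (fun y => .node (F y.1) (encS y.1 y.2)) (fun y => encS y.1 (step y.1 y.2)))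
    (hsize : ∃ T, PolyBd T ∧ ∀ x s, (encS x s).size ≤ T (F x).size) :
    Comp O F fun x => encS x ((step x)^[r x] (init x)) := by
  have h0 := refl (fun y : (x : X) × (S x × Fin (r x)) => O y.1)
      (fun y => .node (F y.1) (.node (encS y.1 y.2.1) (.nat y.2.2)))
  refine (foldFin (step := fun x s _ => step x s) hr hi ((h0.fst.pair h0.snd.fst).trans
    (hstep.comap fun y : (x : X) × (S x × Fin (r x)) => (⟨y.1, y.2.1⟩ : (x : X) × S x)))
    hsize).congr fun x => ?_
  rw [List.foldl_const, List.length_finRange]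

theorem sum {g : ∀ x, Fin (r x) → ℝ} (hr : Comp O F fun x => .rng (r x))
    (hg : Comp (fun y : (x : X) × Fin (r x) => O y.1) (fun y => .node (F y.1) (.nat y.2))
      (fun y => .num (g y.1 y.2))) :
    Comp O F fun x => .num (∑ i, g x i) := by
  have h0 := refl (fun y : (x : X) × (ℝ × Fin (r x)) => O y.1)
      (fun y => .node (F y.1) (.node (.num y.2.1) (.nat y.2.2)))
  refine (foldFin (S := fun _ => ℝ) (encS := fun _ => Val.num) (step := fun x s i => s + g x i)
    (init := fun _ => 0) hr zero (add h0.snd.fst ((h0.fst.pair h0.snd.snd).trans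
    (hg.comap fun y : (x : X) × (ℝ × Fin (r x)) => (⟨y.1, y.2.2⟩ : (x : X) × Fin (r x)))))
    ⟨fun _ => 1, .const 1, fun _ _ => by simp [Val.size]⟩).congr fun x => ?_
  have key : ∀ (l : List (Fin (r x))) (s : ℝ),
      l.foldl (fun s i => s + g x i) s = s + (l.map (g x)).sum := by
    intro l
    induction l with
    | nil => simp
    | cons e l ih => intro s; simp [ih]; ring
  rw [key, Fin.sum_univ_def, zero_add]

/-- Lookup. -/
theorem app {g : ∀ x, Fin (r x) → Val} {c : ∀ x, Fin (r x)}
    (hg : Comp O F fun x => .family (g x)) (hc : Comp O F fun x => .nat (c x)) :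
    Comp O F fun x => g x (c x) := by
  classical
  -- The index is decreased by one at every entry and the entry met at zero is retained. A negative
  -- counter never returns to zero, so the retained entry survives.
  have key0 : ∀ (l : List Val) (a : ℝ) (v : Val), a < 0 →
      (l.foldl (fun (s : ℝ × Val) e => (s.1 - 1, if s.1 = 0 then e else s.2)) (a, v)).2 = v := by
    intro l
    induction l with
    | nil => simp
    | cons e l ih => intro a v ha; simp [ih (a - 1) v (by linarith), ha.ne]
  have key : ∀ (l : List Val) (k : ℕ) (v : Val) (hk : k < l.length),
      (l.foldl (fun (s : ℝ × Val) e => (s.1 - 1, if s.1 = 0 then e else s.2)) ((k : ℝ), v)).2 =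
        l[k] := by
    intro l
    induction l with
    | nil => simp
    | cons e l ih =>
      intro k v hk
      cases k with
      | zero => simpa using key0 l (-1) e (by norm_num)
      | succ k =>
        have h1 : ((k + 1 : ℕ) : ℝ) ≠ 0 := by positivity
        have h2 : ((k + 1 : ℕ) : ℝ) - 1 = k := by push_cast; ring
        simp only [List.foldl_cons, h1, if_false, h2, List.getElem_cons_succ]
        exact ih k v (by simpa using hk)
  have key2 : ∀ (l : List Val) (s : ℝ × Val),
      (l.foldl (fun (s : ℝ × Val) e => (s.1 - 1, if s.1 = 0 then e else s.2)) s).2 ∈ s.2 :: l := by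
    intro l
    induction l with
    | nil => simp
    | cons e l ih =>
      intro s
      have := ih (s.1 - 1, if s.1 = 0 then e else s.2)
      rw [List.foldl_cons]
      by_cases h : s.1 = 0 <;> simp [h] at this ⊢ <;> tauto
  have h0 := refl (fun y : (x : X) × ((ℝ × Val) × Val) => O y.1)
      (fun y => .node (F y.1) (.node (.node (.num y.2.1.1) y.2.1.2) y.2.2))
  have h := foldl (S := fun _ => ℝ × Val) (E := fun _ => Val) (encE := fun _ => id)
    (encS := fun _ s => .node (.num s.1) s.2) (l := fun x => List.ofFn (g x))
    (step := fun _ s e => (s.1 - 1, if s.1 = 0 then e else s.2))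
    (init := fun x => (((c x : ℕ) : ℝ), .nil)) (O := O) (F := F) (by simpa [Val.family] using hg)
    (pair hc nil)
    (pair (sub h0.snd.fst.fst one) (ite (eq h0.snd.fst.fst zero) h0.snd.snd h0.snd.fst.snd)) ?_
  · refine h.snd.congr fun x => ?_
    rw [key _ _ _ (by simp)]
    simp
  · obtain ⟨_, U, hU, hg⟩ := hg
    refine ⟨fun s => 1 + (1 + U s) + 1, ((PolyBd.const 1).add ((PolyBd.const 1).add hU)).add
      (.const 1), fun x pre post hp => ?_⟩
    simp only [Val.size]
    have h1 := key2 pre (((c x : ℕ) : ℝ), .nil)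
    rcases List.mem_cons.1 h1 with h1 | h1
    · rw [h1]; simp only [Val.size]; omega
    · have h2 := (Val.size_le_size_list (l := List.ofFn (g x)) (by rw [hp]; exact List.mem_append_left _ h1)).trans (hg x).2
      omega

end Comp

/-! ### Minimisation with a fixed order of scanning. -/

open Classical in
/-- The first of the candidates with the least value of `g`, among those that improve on `d`. -/
def argmin {r : ℕ} (cand : Fin r → Prop) (g : Fin r → ℝ) (d : Fin r) : Fin r :=
  (List.finRange r).foldl (fun a c => if cand c ∧ g c < g a then c else a) d

/-- The default has to be a candidate itself. The fixed scan makes the minimiser a function of the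
data, the same one in the proofs, in the programs and in the measurability arguments. -/
theorem argmin_spec {r : ℕ} (cand : Fin r → Prop) (g : Fin r → ℝ) (d : Fin r) (hd : cand d) :
    cand (argmin cand g d) ∧ ∀ c, cand c → g (argmin cand g d) ≤ g c := by
  classical
  have key : ∀ (l : List (Fin r)) (a : Fin r), cand a →
      cand (l.foldl (fun a c => if cand c ∧ g c < g a then c else a) a) ∧
      ∀ c, c = a ∨ c ∈ l → cand c →
        g (l.foldl (fun a c => if cand c ∧ g c < g a then c else a) a) ≤ g c := by
    intro l
    induction l with
    | nil => intro a ha; simp [ha]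
    | cons e l ih =>
      intro a ha
      rw [List.foldl_cons]
      by_cases h : cand e ∧ g e < g a
      · simp only [h, and_self, if_true]
        obtain ⟨h1, h2⟩ := ih e h.1
        refine ⟨h1, ?_⟩
        rintro c (rfl | hc) hcc
        · exact (h2 e (.inl rfl) h.1).trans h.2.le
        · exact h2 c (by simpa using hc) hcc
      · simp only [h, if_false]
        obtain ⟨h1, h2⟩ := ih a ha
        refine ⟨h1, ?_⟩
        rintro c (rfl | hc) hcc
        · exact h2 c (.inl rfl) hcc
        · rcases List.mem_cons.1 hc with rfl | hc
          · exact (h2 a (.inl rfl) ha).trans (not_lt.1 fun h' => h ⟨hcc, h'⟩)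
          · exact h2 c (.inr hc) hcc
  obtain ⟨h1, h2⟩ := key (List.finRange r) d hd
  exact ⟨h1, fun c hc => h2 c (.inr (List.mem_finRange c)) hc⟩

theorem Comp.argmin {X : Type*} {O : X → Val → Val → Prop} {F : X → Val} {r : X → ℕ}
    {cand : ∀ x, Fin (r x) → Prop} {g : ∀ x, Fin (r x) → ℝ} {d : ∀ x, Fin (r x)}
    (hr : Comp O F fun x => .rng (r x))
    (hc : Comp (fun y : (x : X) × Fin (r x) => O y.1) (fun y => .node (F y.1) (.nat y.2))
      (fun y => .ofProp (cand y.1 y.2)))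
    (hg : Comp (fun y : (x : X) × Fin (r x) => O y.1) (fun y => .node (F y.1) (.nat y.2))
      (fun y => .num (g y.1 y.2)))
    (hd : Comp O F fun x => .nat (d x)) :
    Comp O F fun x => .nat (argmin (cand x) (g x) (d x)) := by
  classical
  have h0 := refl (fun y : (x : X) × (Fin (r x) × Fin (r x)) => O y.1)
      (fun y => .node (F y.1) (.node (.nat y.2.1) (.nat y.2.2)))
  have e1 := h0.fst.pair h0.snd.snd
  have e2 := h0.fst.pair h0.snd.fst
  have c1 := e1.trans (hc.comap fun y : (x : X) × (Fin (r x) × Fin (r x)) =>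
    (⟨y.1, y.2.2⟩ : (x : X) × Fin (r x)))
  have g1 := e1.trans (hg.comap fun y : (x : X) × (Fin (r x) × Fin (r x)) =>
    (⟨y.1, y.2.2⟩ : (x : X) × Fin (r x)))
  have g2 := e2.trans (hg.comap fun y : (x : X) × (Fin (r x) × Fin (r x)) =>
    (⟨y.1, y.2.1⟩ : (x : X) × Fin (r x)))
  exact foldFin (S := fun x => Fin (r x)) (encS := fun x i => .nat i)
    (step := fun x a c => if cand x c ∧ g x c < g x a then c else a) hr hd
    ((ite (c1.and (lt g1 g2)) h0.snd.snd h0.snd.fst).congr fun y => by dsimp only; split <;> rfl)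
    ⟨fun _ => 1, .const 1, fun _ _ => by simp [Val.size, Val.nat]⟩

/-! ### Optimal assignment -/

section Assignment

variable {r : ℕ}

/-- At the given prices, no column is better for row `k` than `c`. -/
def Fav (A : Fin r → Fin r → ℝ) (price : Fin r → ℝ) (k c : Fin r) : Prop :=
  ∀ c', A k c' - price c' ≤ A k c - price c

/-- The loss of row `k` from taking column `c` instead of a favourite column. -/
def slack (A : Fin r → Fin r → ℝ) (price : Fin r → ℝ) (k c : Fin r) : ℝ :=
  let best := argmin (fun _ => True) (fun c => -(A k c - price c)) c
  (A k best - price best) - (A k c - price c)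

/-- Slack plus net value is the best net value of the row. The favourite inside `slack` is searched
starting from `c` and may vary with `c` under ties, so the comparison of two columns goes through
this inequality. -/
theorem le_slack_add (A : Fin r → Fin r → ℝ) (price : Fin r → ℝ) (k c c' : Fin r) :
    A k c' - price c' ≤ slack A price k c + (A k c - price c) := by
  have := (argmin_spec (fun _ => True) (fun c => -(A k c - price c)) c trivial).2 c' trivial
  simp only [slack]
  linarith

theorem slack_nonneg (A : Fin r → Fin r → ℝ) (price : Fin r → ℝ) (k c : Fin r) :
    0 ≤ slack A price k c := by
  have := le_slack_add A price k c c
  linarith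

theorem slack_add_le (A : Fin r → Fin r → ℝ) (price : Fin r → ℝ) (k c c' : Fin r) :
    slack A price k c' + (A k c' - price c') ≤ slack A price k c + (A k c - price c) := by
  have := le_slack_add A price k c
    (argmin (fun _ => True) (fun c => -(A k c - price c)) c')
  conv_lhs => rw [slack]
  linarith

theorem slack_add_le_of_fav {A : Fin r → Fin r → ℝ} {price : Fin r → ℝ} {k b : Fin r}
    (h : Fav A price k b) (c : Fin r) : slack A price k c + (A k c - price c) ≤ A k b - price b := by
  simp only [slack]
  linarith [h (argmin (fun _ => True) (fun c => -(A k c - price c)) c)]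

/-- The state of the search for an exchange that frees column `c₀`: prices, the columns reached, for
each of them the assignment after the exchange that leads to it, and the current assignment. -/
structure TreeState (r : ℕ) where
  done : Bool
  price : Fin r → ℝ
  tree : Fin r → Bool
  rot : Fin r → Equiv.Perm (Fin r)
  asg : Equiv.Perm (Fin r)

/-- The columns that can be reached next. -/
def TreeState.Open (st : TreeState r) (c₀ c : Fin r) : Prop := st.tree c = false ∨ c = c₀

/-- The best open column for the owner of column `c`. -/
def TreeState.target (A : Fin r → Fin r → ℝ) (c₀ : Fin r) (st : TreeState r) (c : Fin r) : Fin r :=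
  argmin (st.Open c₀) (slack A st.price (st.asg⁻¹ c)) c₀

/-- The column whose owner is closest to wanting an open column. -/
def TreeState.source (A : Fin r → Fin r → ℝ) (c₀ : Fin r) (st : TreeState r) : Fin r :=
  argmin (fun c => st.tree c = true)
    (fun c => slack A st.price (st.asg⁻¹ c) (st.target A c₀ c)) c₀

open Classical in
/-- The prices of the open columns are lowered until an owner of a reached column wants one. -/
def TreeState.newPrice (A : Fin r → Fin r → ℝ) (c₀ : Fin r) (st : TreeState r) (x : Fin r) : ℝ :=
  if st.Open c₀ x then
    st.price x - slack A st.price (st.asg⁻¹ (st.source A c₀)) (st.target A c₀ (st.source A c₀))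
  else st.price x

/-- One step of the search. -/
def TreeState.next (A : Fin r → Fin r → ℝ) (c₀ : Fin r) (st : TreeState r) : TreeState r :=
  let s := st.source A c₀
  let c := st.target A c₀ s
  { done := st.done || decide (c = c₀)
    price := fun x => if st.done then st.price x else st.newPrice A c₀ x
    tree := fun x => st.tree x || decide (x = c)
    -- The owner of `s`, who sat at `c₀`, takes `c`; the former holder of `c` moves to `c₀`.
    rot := fun x => if x = c then Equiv.swap c c₀ * st.rot s else st.rot x
    asg := if st.done = false ∧ c = c₀ then st.rot s else st.asg }

/-- Makes row `t` content, in addition to the rows that are. -/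
def insertRow (A : Fin r → Fin r → ℝ) (s : Equiv.Perm (Fin r) × (Fin r → ℝ)) (t : Fin r) :
    Equiv.Perm (Fin r) × (Fin r → ℝ) :=
  -- Every unfinished step reaches a new column, so `r` steps are enough and no termination test is
  -- needed.
  let fin := (TreeState.next A (s.1 t))^[r] ⟨false, s.2, fun c => decide (c = s.1 t), fun _ => s.1, s.1⟩
  (fin.asg, fin.price)

/-- An optimal assignment of the rows to the columns. -/
def solve (A : Fin r → Fin r → ℝ) : Equiv.Perm (Fin r) :=
  ((List.finRange r).foldl (insertRow A) (1, fun _ => 0)).1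

/-- The invariant of the search. -/
structure TreeInv (A : Fin r → Fin r → ℝ) (P : Fin r → Prop) (c₀ : Fin r) (st : TreeState r) :
    Prop where
  root : st.tree c₀ = true
  -- Under `rot c` the owner of `c` sits at `c₀` and is the only row of `P` that may be discontent;
  -- owners of unreached columns have not moved.
  fav : ∀ c, st.tree c = true → ∀ j, P j → st.asg j ≠ c → Fav A st.price j (st.rot c j)
  fix : ∀ c, st.tree c = true → ∀ j, st.tree (st.asg j) = false → st.rot c j = st.asg j
  free : ∀ c, st.tree c = true → st.rot c (st.asg⁻¹ c) = c₀

/-- The open columns become cheaper by the least slack `Δ` of an owner of a reached column. An open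
favourite gains as much as any rival; a row with a reached column has slack at least `Δ` at every
open one, so its favourite survives as well. The root `c₀` itself counts as open: if it is the new
target, the exchange closes and all rows are content, otherwise a new column joins the tree. -/
theorem TreeInv.next {A : Fin r → Fin r → ℝ} {P : Fin r → Prop} {c₀ : Fin r} {st : TreeState r}
    (h : TreeInv A P c₀ st) (hd : st.done = false) :
    ((st.next A c₀).done = true ∧ ∀ j, P j → Fav A (st.next A c₀).price j ((st.next A c₀).asg j)) ∨
    ((st.next A c₀).done = false ∧ TreeInv A P c₀ (st.next A c₀) ∧
      (Finset.univ.filter fun c => st.tree c = true).card <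
        (Finset.univ.filter fun c => (st.next A c₀).tree c = true).card) := by
  classical
  set s := st.source A c₀ with hs
  set c := st.target A c₀ s with hc
  set Δ := slack A st.price (st.asg⁻¹ s) c with hΔ
  have hopen : ∀ x, st.Open c₀ (st.target A c₀ x) ∧ ∀ c', st.Open c₀ c' →
      slack A st.price (st.asg⁻¹ x) (st.target A c₀ x) ≤ slack A st.price (st.asg⁻¹ x) c' :=
    fun x => argmin_spec _ _ _ (.inr rfl)
  have hsrc : st.tree s = true ∧ ∀ x, st.tree x = true →
      Δ ≤ slack A st.price (st.asg⁻¹ x) (st.target A c₀ x) :=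
    argmin_spec (fun c => st.tree c = true)
      (fun c => slack A st.price (st.asg⁻¹ c) (st.target A c₀ c)) c₀ h.root
  have hΔle : ∀ x c', st.tree x = true → st.Open c₀ c' →
      Δ ≤ slack A st.price (st.asg⁻¹ x) c' :=
    fun x c' hx hc' => (hsrc.2 x hx).trans ((hopen x).2 c' hc')
  have hΔ0 : 0 ≤ Δ := slack_nonneg _ _ _ _
  have hcopen : st.Open c₀ c := (hopen s).1
  have hprice : ∀ x, (st.next A c₀).price x = if st.Open c₀ x then st.price x - Δ else st.price x := by
    intro x; simp [TreeState.next, hd, TreeState.newPrice, hΔ, hc, hs]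
  -- favourites stay favourites
  have keep : ∀ j b, Fav A st.price j b → (st.Open c₀ b ∨ st.tree (st.asg j) = true) →
      Fav A (st.next A c₀).price j b := by
    intro j b hb hor c'
    rw [hprice, hprice]
    by_cases h1 : st.Open c₀ b
    · simp only [h1, if_true]
      split_ifs <;> linarith [hb c']
    · have h2 := hor.resolve_left h1
      simp only [h1, if_false]
      split_ifs with h3
      · have := hΔle _ c' h2 h3
        have h4 := slack_add_le_of_fav hb c'
        simp only [Equiv.Perm.coe_inv, Equiv.symm_apply_apply] at this
        linarith
      · exact hb c'
  -- the new column is a favourite of the owner of `s`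
  have hnew : Fav A (st.next A c₀).price (st.asg⁻¹ s) c := by
    intro c'
    rw [hprice, hprice]
    have h4 := le_slack_add A st.price (st.asg⁻¹ s) c c'
    simp only [hcopen, if_true]
    split_ifs with h3
    · have h5 := slack_add_le A st.price (st.asg⁻¹ s) c c'
      have h6 := hΔle s c' hsrc.1 h3
      rw [← hΔ] at h5
      linarith
    · rw [← hΔ] at h4
      linarith
  have favkeep : ∀ x, st.tree x = true → ∀ j, P j → st.asg j ≠ x →
      Fav A (st.next A c₀).price j (st.rot x j) := by
    intro x hx j hj hjx
    refine keep j _ (h.fav x hx j hj hjx) ?_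
    by_cases h1 : st.tree (st.asg j) = true
    · exact .inr h1
    · left; left
      rw [h.fix x hx j (by simpa using h1)]
      simpa using h1
  by_cases hcc : c = c₀
  · left
    refine ⟨by simp [TreeState.next, ← hs, ← hc, hcc], fun j hj => ?_⟩
    have hasg : (st.next A c₀).asg = st.rot s := by
      simp [TreeState.next, ← hs, ← hc, hcc, hd]
    rw [hasg]
    by_cases h1 : st.asg j = s
    · have h2 : j = st.asg⁻¹ s := by rw [← h1]; simp
      rw [h2, h.free s hsrc.1]
      exact hcc ▸ hnew
    · exact favkeep s hsrc.1 j hj h1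
  · right
    have hct : st.tree c = false := hcopen.resolve_right hcc
    have hasg : (st.next A c₀).asg = st.asg := by
      simp [TreeState.next, ← hs, ← hc, hcc]
    have htree : ∀ x, (st.next A c₀).tree x = (st.tree x || decide (x = c)) := by
      intro x; simp [TreeState.next, ← hs, ← hc]
    have hrot : ∀ x, (st.next A c₀).rot x = if x = c then Equiv.swap c c₀ * st.rot s else st.rot x := by
      intro x; simp [TreeState.next, ← hs, ← hc]
    refine ⟨by simp [TreeState.next, ← hs, ← hc, hcc, hd], ⟨by simp [htree, h.root], ?_, ?_, ?_⟩, ?_⟩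
    · intro x hx j hj hjx
      rw [hasg] at hjx
      rw [hrot]
      by_cases hxc : x = c
      · subst hxc
        simp only [if_true, Equiv.Perm.mul_apply]
        by_cases h1 : st.asg j = s
        · have h2 : j = st.asg⁻¹ s := by rw [← h1]; simp
          rw [h2, h.free s hsrc.1, Equiv.swap_apply_right]
          exact hnew
        · have e1 : st.rot s j ≠ c₀ := by
            rw [← h.free s hsrc.1]
            intro h3
            exact h1 (by rw [(st.rot s).injective h3]; simp)
          have e2 : st.rot s j ≠ c := by
            have : st.rot s (st.asg⁻¹ c) = c := by
              have := h.fix s hsrc.1 (st.asg⁻¹ c) (by simpa using hct)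
              simpa using this
            intro h3
            rw [← this] at h3
            exact hjx (by rw [(st.rot s).injective h3]; simp)
          rw [Equiv.swap_apply_of_ne_of_ne e2 e1]
          exact favkeep s hsrc.1 j hj h1
      · simp only [hxc, if_false]
        rw [htree] at hx
        exact favkeep x (by simpa [hxc] using hx) j hj hjx
    · intro x hx j hj
      rw [hasg] at hj ⊢
      rw [htree] at hx hj
      simp only [Bool.or_eq_false_iff, decide_eq_false_iff_not] at hj
      rw [hrot]
      by_cases hxc : x = c
      · simp only [hxc, if_true, Equiv.Perm.mul_apply]
        rw [h.fix s hsrc.1 j hj.1]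
        refine Equiv.swap_apply_of_ne_of_ne hj.2 fun h1 => ?_
        rw [h1, h.root] at hj
        simp at hj
      · simp only [hxc, if_false]
        exact h.fix x (by simpa [hxc] using hx) j hj.1
    · intro x hx
      rw [hasg, hrot]
      rw [htree] at hx
      by_cases hxc : x = c
      · simp only [hxc, if_true, Equiv.Perm.mul_apply]
        have := h.fix s hsrc.1 (st.asg⁻¹ c) (by simpa using hct)
        rw [this]; simp
      · simp only [hxc, if_false]
        exact h.free x (by simpa [hxc] using hx)
    · apply Finset.card_lt_card
      rw [Finset.ssubset_iff_of_subset (fun x hx => by simp [htree] at hx ⊢; exact .inl hx)]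
      exact ⟨c, by simp [htree], by simp [hct]⟩

theorem TreeState.next_of_done {A : Fin r → Fin r → ℝ} {c₀ : Fin r} {st : TreeState r}
    (hd : st.done = true) : (st.next A c₀).done = true ∧ (st.next A c₀).asg = st.asg ∧
      (st.next A c₀).price = st.price := by
  simp [TreeState.next, hd]

/-- The search is rooted at the column of `t`, so initially only `t` may be discontent. After `i`
unfinished steps the tree has at least `i + 1` columns, which is impossible for `i = r`. -/
theorem insertRow_fav {A : Fin r → Fin r → ℝ} {s : Equiv.Perm (Fin r) × (Fin r → ℝ)}
    {P : Fin r → Prop} (hP : ∀ j, P j → Fav A s.2 j (s.1 j)) (t : Fin r) :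
    ∀ j, (P j ∨ j = t) → Fav A (insertRow A s t).2 j ((insertRow A s t).1 j) := by
  set st₀ : TreeState r := ⟨false, s.2, fun c => decide (c = s.1 t), fun _ => s.1, s.1⟩ with hst
  have h0 : TreeInv A (fun j => P j ∨ j = t) (s.1 t) st₀ := by
    refine ⟨by simp [hst], ?_, ?_, ?_⟩
    · intro c hc j hj hjc
      have hc' : c = s.1 t := by simpa [hst] using hc
      rcases hj with hj | rfl
      · exact hP j hj
      · exact absurd hc'.symm hjc
    · intro c _ j _; rfl
    · intro c hc
      have hc' : c = s.1 t := by simpa [hst] using hc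
      simp [hst, hc']
  have key : ∀ i, (((TreeState.next A (s.1 t))^[i] st₀).done = true ∧
      ∀ j, (P j ∨ j = t) → Fav A ((TreeState.next A (s.1 t))^[i] st₀).price j
        (((TreeState.next A (s.1 t))^[i] st₀).asg j)) ∨
      (((TreeState.next A (s.1 t))^[i] st₀).done = false ∧
        TreeInv A (fun j => P j ∨ j = t) (s.1 t) ((TreeState.next A (s.1 t))^[i] st₀) ∧
        i + 1 ≤ (Finset.univ.filter fun c =>
          ((TreeState.next A (s.1 t))^[i] st₀).tree c = true).card) := by
    intro i
    induction i with
    | zero =>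
      refine .inr ⟨rfl, h0, ?_⟩
      rw [zero_add, Nat.one_le_iff_ne_zero, Finset.card_ne_zero]
      exact ⟨s.1 t, by simp [hst]⟩
    | succ i ih =>
      rw [Function.iterate_succ_apply']
      rcases ih with ⟨h1, h2⟩ | ⟨h1, h2, h3⟩
      · obtain ⟨e1, e2, e3⟩ := TreeState.next_of_done (A := A) (c₀ := s.1 t) h1
        left
        rw [e2, e3]
        exact ⟨e1, h2⟩
      · rcases h2.next h1 with h4 | ⟨h4, h5, h6⟩
        · exact .inl h4
        · exact .inr ⟨h4, h5, by omega⟩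
  rcases key r with h | ⟨_, _, h⟩
  · exact h.2
  · exfalso
    have := Finset.card_le_univ (Finset.univ.filter fun c =>
          ((TreeState.next A (s.1 t))^[r] st₀).tree c = true)
    rw [Fintype.card_fin] at this
    omega

/-- The rows are made content one after another; the final prices are a dual certificate of
optimality. -/
theorem solve_fav (A : Fin r → Fin r → ℝ) : ∃ price, ∀ j, Fav A price j (solve A j) := by
  have key : ∀ (l : List (Fin r)) (s : Equiv.Perm (Fin r) × (Fin r → ℝ)) (P : Fin r → Prop),
      (∀ j, P j → Fav A s.2 j (s.1 j)) → ∀ j, (P j ∨ j ∈ l) →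
        Fav A (l.foldl (insertRow A) s).2 j ((l.foldl (insertRow A) s).1 j) := by
    intro l
    induction l with
    | nil => intro s P h j hj; exact h j (by simpa using hj)
    | cons e l ih =>
      intro s P h j hj
      refine ih _ (fun j => P j ∨ j = e) (insertRow_fav h e) j ?_
      rcases hj with hj | hj
      · exact .inl (.inl hj)
      · rcases List.mem_cons.1 hj with hj | hj
        · exact .inl (.inr hj)
        · exact .inr hj
  exact ⟨_, fun j => key _ (1, fun _ => 0) (fun _ => False) (by simp) j (.inr (List.mem_finRange j))⟩

/-- The assignment computed by `solve` has maximum weight. -/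
theorem sum_le_solve (A : Fin r → Fin r → ℝ) (τ : Equiv.Perm (Fin r)) :
    ∑ k, A k (τ k) ≤ ∑ k, A k (solve A k) := by
  obtain ⟨price, h⟩ := solve_fav A
  -- Any assignment uses each column once, so the prices contribute the same total on both sides.
  have h1 : ∑ k, (A k (τ k) - price (τ k)) ≤ ∑ k, (A k (solve A k) - price (solve A k)) :=
    Finset.sum_le_sum fun k _ => h k (τ k)
  rw [Finset.sum_sub_distrib, Finset.sum_sub_distrib, Equiv.sum_comp τ price,
    Equiv.sum_comp (solve A) price] at h1
  linarith

end Assignment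

/-! ### Measurability -/

instance {r : ℕ} : MeasurableSpace (Equiv.Perm (Fin r)) := ⊤

instance {r : ℕ} : DiscreteMeasurableSpace (Equiv.Perm (Fin r)) := ⟨fun _ => trivial⟩

section Measurability

variable {Ω : Type*} [MeasurableSpace Ω] {r : ℕ}

theorem measurable_apply_of_countable {ι α : Type*} [Countable ι] [MeasurableSpace ι]
    [MeasurableSingletonClass ι] [MeasurableSpace α] {f : Ω → ι → α} {i : Ω → ι}
    (hf : ∀ k, Measurable fun ω => f ω k) (hi : Measurable i) : Measurable fun ω => f ω (i ω) := by
  intro s hs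
  have : (fun ω => f ω (i ω)) ⁻¹' s = ⋃ k, (i ⁻¹' {k} ∩ (fun ω => f ω k) ⁻¹' s) := by
    ext ω; simp
  rw [this]
  exact MeasurableSet.iUnion fun k => (hi (measurableSet_singleton k)).inter (hf k hs)

theorem measurable_of_discrete_left {ι α : Type*} [Countable ι] [MeasurableSpace ι]
    [DiscreteMeasurableSpace ι] [MeasurableSpace α] {i : Ω → ι} (hi : Measurable i) (f : ι → α) :
    Measurable fun ω => f (i ω) :=
  (Measurable.of_discrete (f := f)).comp hi

theorem measurable_argmin {cand : Ω → Fin r → Prop} {g : Ω → Fin r → ℝ} {d : Ω → Fin r}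
    (hc : ∀ k, MeasurableSet {ω | cand ω k}) (hg : ∀ k, Measurable fun ω => g ω k)
    (hd : Measurable d) : Measurable fun ω => argmin (cand ω) (g ω) (d ω) := by
  classical
  have key : ∀ (l : List (Fin r)) (d : Ω → Fin r), Measurable d → Measurable fun ω =>
      l.foldl (fun a c => if cand ω c ∧ g ω c < g ω a then c else a) (d ω) := by
    intro l
    induction l with
    | nil => exact fun d hd => hd
    | cons e l ih =>
      intro d hd
      simp only [List.foldl_cons]
      exact ih _ (Measurable.ite ((hc e).inter
        (measurableSet_lt (hg e) (measurable_apply_of_countable hg hd))) measurable_const hd)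
  exact key _ d hd

variable {A : Ω → Fin r → Fin r → ℝ}

theorem measurable_slack {price : Ω → Fin r → ℝ} {k c : Ω → Fin r}
    (hA : ∀ k c, Measurable fun ω => A ω k c) (hp : ∀ c, Measurable fun ω => price ω c)
    (hk : Measurable k) (hc : Measurable c) :
    Measurable fun ω => slack (A ω) (price ω) (k ω) (c ω) := by
  have h1 : ∀ x, Measurable fun ω => A ω (k ω) x - price ω x := fun x =>
    (measurable_apply_of_countable (f := fun ω k => A ω k x) (fun k => hA k x) hk).sub (hp x)
  have h2 : Measurable fun ω =>
      argmin (fun _ => True) (fun x => -(A ω (k ω) x - price ω x)) (c ω) :=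
    measurable_argmin (fun _ => by simp) (fun x => (h1 x).neg) hc
  exact (measurable_apply_of_countable (f := fun ω x => A ω (k ω) x - price ω x) h1 h2).sub
    (measurable_apply_of_countable (f := fun ω x => A ω (k ω) x - price ω x) h1 hc)

/-- A measurable family of search states. -/
structure MeasurableState (st : Ω → TreeState r) : Prop where
  done : Measurable fun ω => (st ω).done
  price : ∀ c, Measurable fun ω => (st ω).price c
  tree : ∀ c, Measurable fun ω => (st ω).tree c
  rot : ∀ c, Measurable fun ω => (st ω).rot c
  asg : Measurable fun ω => (st ω).asg

theorem MeasurableState.next {st : Ω → TreeState r} {c₀ : Ω → Fin r} (h : MeasurableState st)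
    (hA : ∀ k c, Measurable fun ω => A ω k c) (hc₀ : Measurable c₀) :
    MeasurableState fun ω => (st ω).next (A ω) (c₀ ω) := by
  classical
  have hopen : ∀ c, MeasurableSet {ω | (st ω).Open (c₀ ω) c} := fun c =>
    ((h.tree c) (measurableSet_singleton false)).union
      (measurableSet_eq_fun measurable_const hc₀)
  have hinv : ∀ c, Measurable fun ω => (st ω).asg⁻¹ c := fun c =>
    measurable_of_discrete_left h.asg fun σ => σ⁻¹ c
  have htarget : ∀ c, Measurable fun ω => (st ω).target (A ω) (c₀ ω) c := fun c =>
    measurable_argmin hopen (fun x => measurable_slack hA h.price (hinv c) measurable_const) hc₀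
  have hsource : Measurable fun ω => (st ω).source (A ω) (c₀ ω) :=
    measurable_argmin (fun c => (h.tree c) (measurableSet_singleton true))
      (fun x => measurable_slack hA h.price (hinv x) (htarget x)) hc₀
  have hts : Measurable fun ω => (st ω).target (A ω) (c₀ ω) ((st ω).source (A ω) (c₀ ω)) :=
    measurable_apply_of_countable htarget hsource
  have hrs : Measurable fun ω => (st ω).rot ((st ω).source (A ω) (c₀ ω)) :=
    measurable_apply_of_countable h.rot hsource
  have hdone : ∀ b, MeasurableSet {ω | (st ω).done = b} := fun b =>
    h.done (measurableSet_singleton b)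
  have heq : MeasurableSet {ω | (st ω).target (A ω) (c₀ ω) ((st ω).source (A ω) (c₀ ω)) = c₀ ω} :=
    measurableSet_eq_fun hts hc₀
  have hdec : ∀ {P : Ω → Prop} [DecidablePred P], MeasurableSet {ω | P ω} →
      Measurable fun ω => decide (P ω) := fun {P} _ hP => by
    have : (fun ω => decide (P ω)) = fun ω => if P ω then true else false := by
      ext ω; by_cases hω : P ω <;> simp [hω]
    rw [this]
    exact Measurable.ite hP measurable_const measurable_const
  have hor : ∀ {a b : Ω → Bool}, Measurable a → Measurable b → Measurable fun ω => a ω || b ω :=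
    fun {a b} ha hb => measurable_of_discrete_left (ha.prodMk hb) fun p => p.1 || p.2
  refine ⟨hor h.done (hdec heq), fun c => ?_, fun c => hor (h.tree c) (hdec ?_), fun c => ?_, ?_⟩
  · refine Measurable.ite (hdone true) (h.price c) (Measurable.ite (hopen c) ((h.price c).sub ?_)
      (h.price c))
    exact measurable_slack hA h.price
      (measurable_apply_of_countable (f := fun ω x => (st ω).asg⁻¹ x) hinv hsource) hts
  · exact measurableSet_eq_fun measurable_const hts
  · refine Measurable.ite (measurableSet_eq_fun measurable_const hts) ?_ (h.rot c)
    exact measurable_of_discrete_left ((hts.prodMk hc₀).prodMk hrs)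
      fun p : (Fin r × Fin r) × Equiv.Perm (Fin r) => Equiv.swap p.1.1 p.1.2 * p.2
  · exact Measurable.ite ((hdone false).inter heq) hrs h.asg

/-- The assignment is a fixed number of rounds of arithmetic, comparisons and scans with a
deterministic treatment of ties. Hence random matchings are measurable without any selection
argument. -/
theorem measurable_solve (hA : ∀ k c, Measurable fun ω => A ω k c) :
    Measurable fun ω => solve (A ω) := by
  have key : ∀ (l : List (Fin r)) (s : Ω → Equiv.Perm (Fin r) × (Fin r → ℝ)),
      Measurable (fun ω => (s ω).1) → (∀ c, Measurable fun ω => (s ω).2 c) →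
      Measurable fun ω => (l.foldl (insertRow (A ω)) (s ω)).1 := by
    intro l
    induction l with
    | nil => exact fun s h _ => h
    | cons t l ih =>
      intro s h1 h2
      have hc : Measurable fun ω => (s ω).1 t := measurable_of_discrete_left h1 fun σ => σ t
      have h0 : MeasurableState fun ω => (⟨false, (s ω).2, fun c => decide (c = (s ω).1 t),
          fun _ => (s ω).1, (s ω).1⟩ : TreeState r) :=
        ⟨measurable_const, h2, fun c => measurable_of_discrete_left hc fun x => decide (c = x),
          fun _ => h1, h1⟩
      have hk : ∀ i, MeasurableState fun ω => (TreeState.next (A ω) ((s ω).1 t))^[i]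
          (⟨false, (s ω).2, fun c => decide (c = (s ω).1 t),
          fun _ => (s ω).1, (s ω).1⟩ : TreeState r) := by
        intro i
        induction i with
        | zero => exact h0
        | succ i ih =>
          simp only [Function.iterate_succ_apply']
          exact ih.next hA hc
      exact ih (fun ω => insertRow (A ω) (s ω) t) (hk r).asg (hk r).price
  exact key _ (fun _ => (1, fun _ => 0)) measurable_const fun _ => measurable_const

end Measurability


/-! ### The assignment algorithm as a program -/

/-- A matrix, as the list of its rows. -/
def Val.mat {r s : ℕ} (A : Fin r → Fin s → ℝ) : Val := Val.family fun k => Val.vec (A k)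

/-- A permutation, as the list of its values. -/
def Val.perm {r : ℕ} (σ : Equiv.Perm (Fin r)) : Val := Val.family fun i => Val.nat (σ i)

/-- The search state as a value. -/
def TreeState.val {r : ℕ} (st : TreeState r) : Val :=
  .node (.ofProp (st.done = true)) (.node (.vec st.price)
    (.node (.family fun c => .ofProp (st.tree c = true))
      (.node (.family fun c => .perm (st.rot c)) (.perm st.asg))))

theorem Val.size_ofProp (p : Prop) : (Val.ofProp p).size = 1 := by
  simp only [Val.ofProp]; split <;> rfl

theorem Val.size_vec_le {r : ℕ} (v : Fin r → ℝ) : (Val.vec v).size ≤ r * 2 + 1 :=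
  Val.size_family_le fun _ => le_rfl

theorem Val.size_perm_le {r : ℕ} (σ : Equiv.Perm (Fin r)) : (Val.perm σ).size ≤ r * 2 + 1 :=
  Val.size_family_le fun _ => le_rfl

theorem TreeState.size_val_le {r : ℕ} (st : TreeState r) :
    st.val.size ≤ (r * 2 + 1) + (r * 2 + 1) + (r * (r * 2 + 1 + 1) + 1) + (r * 2 + 1) + 5 := by
  have h1 := Val.size_vec_le st.price
  have h2 : (Val.family fun c => Val.ofProp (st.tree c = true)).size ≤ r * 2 + 1 :=
    Val.size_family_le fun _ => (Val.size_ofProp _).le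
  have h3 : (Val.family fun c => Val.perm (st.rot c)).size ≤ r * (r * 2 + 1 + 1) + 1 :=
    Val.size_family_le fun c => Val.size_perm_le _
  have h4 := Val.size_perm_le st.asg
  simp only [TreeState.val, Val.size, Val.size_ofProp]
  omega

namespace Comp

variable {X : Type*} {O : X → Val → Val → Prop} {F : X → Val} {r s : X → ℕ}

theorem polyBd_of_rng (hr : Comp O F fun x => .rng (r x)) :
    ∃ U, PolyBd U ∧ ∀ x, r x ≤ U (F x).size := by
  obtain ⟨_, U, hU, h⟩ := hr
  exact ⟨U, hU, fun x => (Val.le_size_family _).trans (h x).2⟩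

theorem natEq {a b : X → ℕ} (ha : Comp O F fun x => .nat (a x))
    (hb : Comp O F fun x => .nat (b x)) : Comp O F fun x => .ofProp (a x = b x) := by
  simpa using eq ha hb

theorem finEq {a b : ∀ x, Fin (r x)} (ha : Comp O F fun x => .nat (a x))
    (hb : Comp O F fun x => .nat (b x)) : Comp O F fun x => .ofProp (a x = b x) := by
  simpa [Fin.ext_iff] using natEq ha hb

theorem vecApp {v : ∀ x, Fin (r x) → ℝ} {c : ∀ x, Fin (r x)} (hv : Comp O F fun x => .vec (v x))
    (hc : Comp O F fun x => .nat (c x)) : Comp O F fun x => .num (v x (c x)) :=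
  app (g := fun x k => .num (v x k)) hv hc

theorem matApp {A : ∀ x, Fin (r x) → Fin (s x) → ℝ} {c : ∀ x, Fin (r x)}
    (hv : Comp O F fun x => .mat (A x)) (hc : Comp O F fun x => .nat (c x)) :
    Comp O F fun x => .vec (A x (c x)) :=
  app (g := fun x k => .vec (A x k)) hv hc

theorem permApp {σ : ∀ x, Equiv.Perm (Fin (r x))} {c : ∀ x, Fin (r x)}
    (hv : Comp O F fun x => .perm (σ x)) (hc : Comp O F fun x => .nat (c x)) :
    Comp O F fun x => .nat (σ x (c x)) :=
  app (g := fun x k => .nat (σ x k)) hv hc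

theorem vecLam {v : ∀ x, Fin (r x) → ℝ} (hr : Comp O F fun x => .rng (r x))
    (hg : Comp (fun y : (x : X) × Fin (r x) => O y.1) (fun y => .node (F y.1) (.nat y.2))
      (fun y => .num (v y.1 y.2))) : Comp O F fun x => .vec (v x) :=
  lam (g := fun x i => .num (v x i)) hr hg

theorem matLam {A : ∀ x, Fin (r x) → Fin (s x) → ℝ} (hr : Comp O F fun x => .rng (r x))
    (hg : Comp (fun y : (x : X) × Fin (r x) => O y.1) (fun y => .node (F y.1) (.nat y.2))
      (fun y => .vec (A y.1 y.2))) : Comp O F fun x => .mat (A x) :=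
  lam (g := fun x i => .vec (A x i)) hr hg

theorem permLam {σ : ∀ x, Equiv.Perm (Fin (r x))} (hr : Comp O F fun x => .rng (r x))
    (hg : Comp (fun y : (x : X) × Fin (r x) => O y.1) (fun y => .node (F y.1) (.nat y.2))
      (fun y => .nat (σ y.1 y.2))) : Comp O F fun x => .perm (σ x) :=
  lam (g := fun x i => .nat (σ x i)) hr hg

/-- The bound variable of a tabulation. -/
theorem idx : Comp (fun y : (x : X) × Fin (r x) => O y.1) (fun y => .node (F y.1) (.nat y.2))
    (fun y => .nat y.2) := (refl _ _).snd

/-- The preimage of `c` is found as a minimiser of the indicator of `σ k ≠ c`; starting the scan at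
`c` is arbitrary. -/
theorem permInvApp {σ : ∀ x, Equiv.Perm (Fin (r x))} {c : ∀ x, Fin (r x)}
    (hv : Comp O F fun x => .perm (σ x)) (hc : Comp O F fun x => .nat (c x)) :
    Comp O F fun x => .nat ((σ x)⁻¹ (c x)) := by
  classical
  have hr : Comp O F fun x => .rng (r x) := rng_of_family hv
  have hg : Comp (fun y : (x : X) × Fin (r x) => O y.1) (fun y => .node (F y.1) (.nat y.2))
      (fun y => .num (if σ y.1 y.2 = c y.1 then 0 else 1)) :=
    (ite (finEq (r := fun y : (x : X) × Fin (r x) => r y.1)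
      (permApp (r := fun y : (x : X) × Fin (r x) => r y.1) (hv.wk Sigma.fst) idx)
      (hc.wk Sigma.fst)) zero one).congr fun y => by split <;> rfl
  refine (argmin (cand := fun _ _ => True) (g := fun x k => if σ x k = c x then 0 else 1)
    (d := c) hr (one.congr fun y => by simp [Val.ofProp])
    hg hc).congr fun x => ?_
  have h := (argmin_spec (fun _ => True) (fun k => if σ x k = c x then (0 : ℝ) else 1) (c x)
    trivial).2 ((σ x)⁻¹ (c x)) trivial
  simp only [Equiv.Perm.coe_inv, Equiv.apply_symm_apply, if_true] at h
  split_ifs at h with h1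
  · congr 2
    rw [Equiv.Perm.coe_inv, Equiv.eq_symm_apply]
    exact h1
  · norm_num at h

theorem permInv {σ : ∀ x, Equiv.Perm (Fin (r x))} (hv : Comp O F fun x => .perm (σ x)) :
    Comp O F fun x => .perm (σ x)⁻¹ :=
  permLam (rng_of_family hv)
    (permInvApp (r := fun y : (x : X) × Fin (r x) => r y.1) (hv.wk Sigma.fst) idx)

theorem permMul {σ τ : ∀ x, Equiv.Perm (Fin (r x))} (h : Comp O F fun x => .perm (σ x))
    (h' : Comp O F fun x => .perm (τ x)) : Comp O F fun x => .perm (σ x * τ x) :=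
  permLam (rng_of_family h) (permApp (r := fun y : (x : X) × Fin (r x) => r y.1)
    (σ := fun y => σ y.1) (c := fun y => τ y.1 y.2) (h.wk Sigma.fst)
    (permApp (r := fun y : (x : X) × Fin (r x) => r y.1) (h'.wk Sigma.fst) idx))

theorem permSwap {a b : ∀ x, Fin (r x)} (hr : Comp O F fun x => .rng (r x))
    (ha : Comp O F fun x => .nat (a x)) (hb : Comp O F fun x => .nat (b x)) :
    Comp O F fun x => .perm (Equiv.swap (a x) (b x)) := by
  classical
  refine permLam hr ?_
  have ha' := ha.wk (Sigma.fst : ((x : X) × Fin (r x)) → X) (H := fun y => .nat y.2)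
  have hb' := hb.wk (Sigma.fst : ((x : X) × Fin (r x)) → X) (H := fun y => .nat y.2)
  refine (ite (finEq (r := fun y : (x : X) × Fin (r x) => r y.1) idx ha') hb'
    (ite (finEq (r := fun y : (x : X) × Fin (r x) => r y.1) idx hb') ha' idx)).congr fun y => ?_
  rw [Equiv.swap_apply_def]
  split
  · rfl
  · split <;> rfl

theorem permOne (hr : Comp O F fun x => .rng (r x)) :
    Comp O F fun x => .perm (1 : Equiv.Perm (Fin (r x))) := permLam hr idx

variable {A : ∀ x, Fin (r x) → Fin (r x) → ℝ}

theorem slack {price : ∀ x, Fin (r x) → ℝ} {k c : ∀ x, Fin (r x)}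
    (hA : Comp O F fun x => .mat (A x)) (hp : Comp O F fun x => .vec (price x))
    (hk : Comp O F fun x => .nat (k x)) (hc : Comp O F fun x => .nat (c x)) :
    Comp O F fun x => .num (slack (A x) (price x) (k x) (c x)) := by
  have hr : Comp O F fun x => .rng (r x) := rng_of_family hA
  have hrow := matApp hA hk
  have hbest : Comp O F fun x => .nat (BICMech.argmin (fun _ => True)
      (fun c => -(A x (k x) c - price x c)) (c x)) :=
    argmin hr (one.congr fun y => by simp [Val.ofProp])
      (neg (sub (vecApp (r := fun y : (x : X) × Fin (r x) => r y.1) (v := fun y => A y.1 (k y.1))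
        (hrow.wk Sigma.fst) idx) (vecApp (r := fun y : (x : X) × Fin (r x) => r y.1)
        (v := fun y => price y.1) (hp.wk Sigma.fst) idx))) hc
  exact sub (sub (vecApp hrow hbest) (vecApp hp hbest)) (sub (vecApp hrow hc) (vecApp hp hc))

section Tree

variable {c₀ : ∀ x, Fin (r x)} {st : ∀ x, TreeState (r x)}

theorem treeApp {c : ∀ x, Fin (r x)} (hs : Comp O F fun x => (st x).val)
    (hc : Comp O F fun x => .nat (c x)) :
    Comp O F fun x => .ofProp ((st x).tree (c x) = true) :=
  app (g := fun x k => .ofProp ((st x).tree k = true)) hs.snd.snd.fst hc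

theorem rotApp {c : ∀ x, Fin (r x)} (hs : Comp O F fun x => (st x).val)
    (hc : Comp O F fun x => .nat (c x)) : Comp O F fun x => .perm ((st x).rot (c x)) :=
  app (g := fun x k => .perm ((st x).rot k)) hs.snd.snd.snd.fst hc

theorem isOpen {c : ∀ x, Fin (r x)} (hs : Comp O F fun x => (st x).val)
    (hc₀ : Comp O F fun x => .nat (c₀ x)) (hc : Comp O F fun x => .nat (c x)) :
    Comp O F fun x => .ofProp ((st x).Open (c₀ x) (c x)) := by
  simpa [TreeState.Open] using (treeApp hs hc).not.or (finEq hc hc₀)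

theorem target {c : ∀ x, Fin (r x)} (hA : Comp O F fun x => .mat (A x))
    (hs : Comp O F fun x => (st x).val) (hc₀ : Comp O F fun x => .nat (c₀ x))
    (hc : Comp O F fun x => .nat (c x)) :
    Comp O F fun x => .nat ((st x).target (A x) (c₀ x) (c x)) := by
  have hi := permInvApp (σ := fun x => (st x).asg) hs.snd.snd.snd.snd hc
  have hr : Comp O F fun x => .rng (r x) := rng_of_family hA
  exact argmin hr (isOpen (r := fun y : (x : X) × Fin (r x) => r y.1) (hs.wk Sigma.fst)
    (hc₀.wk Sigma.fst) idx) (slack (r := fun y : (x : X) × Fin (r x) => r y.1)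
      (A := fun y => A y.1) (price := fun y => (st y.1).price)
      (k := fun y => (st y.1).asg⁻¹ (c y.1)) (hA.wk Sigma.fst) (hs.snd.fst.wk Sigma.fst)
      (hi.wk Sigma.fst) idx) hc₀

theorem source (hA : Comp O F fun x => .mat (A x))
    (hs : Comp O F fun x => (st x).val) (hc₀ : Comp O F fun x => .nat (c₀ x)) :
    Comp O F fun x => .nat ((st x).source (A x) (c₀ x)) := by
  have hr : Comp O F fun x => .rng (r x) := rng_of_family hA
  have hs' := hs.wk (Sigma.fst : ((x : X) × Fin (r x)) → X) (H := fun y => .nat y.2)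
  exact argmin hr (treeApp (r := fun y : (x : X) × Fin (r x) => r y.1) hs' idx)
    (slack (r := fun y : (x : X) × Fin (r x) => r y.1)
      (A := fun y => A y.1) (price := fun y => (st y.1).price)
      (k := fun y => (st y.1).asg⁻¹ y.2)
      (c := fun y => (st y.1).target (A y.1) (c₀ y.1) y.2) (hA.wk Sigma.fst) hs'.snd.fst
      (permInvApp (r := fun y : (x : X) × Fin (r x) => r y.1) (σ := fun y => (st y.1).asg)
        hs'.snd.snd.snd.snd idx)
      (target (r := fun y : (x : X) × Fin (r x) => r y.1) (A := fun y => A y.1)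
        (st := fun y => st y.1) (c₀ := fun y => c₀ y.1) (c := fun y => y.2)
        (hA.wk Sigma.fst) hs' (hc₀.wk Sigma.fst) idx)) hc₀

theorem next (hA : Comp O F fun x => .mat (A x))
    (hs : Comp O F fun x => (st x).val) (hc₀ : Comp O F fun x => .nat (c₀ x)) :
    Comp O F fun x => ((st x).next (A x) (c₀ x)).val := by
  classical
  have hr : Comp O F fun x => .rng (r x) := rng_of_family hA
  have hsrc := source hA hs hc₀
  have htgt := target hA hs hc₀ hsrc
  have hdone : Comp O F fun x => .ofProp ((st x).done = true) := hs.fst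
  have hsl := slack hA (price := fun x => (st x).price) hs.snd.fst
    (permInvApp (σ := fun x => (st x).asg) hs.snd.snd.snd.snd hsrc) htgt
  have heq := finEq htgt hc₀
  have hrs := rotApp hs hsrc
  have hs' := hs.wk (Sigma.fst : ((x : X) × Fin (r x)) → X) (H := fun y => .nat y.2)
  have hsl' := hsl.wk (Sigma.fst : ((x : X) × Fin (r x)) → X) (H := fun y => .nat y.2)
  have hpr : Comp (fun y : (x : X) × Fin (r x) => O y.1) (fun y => .node (F y.1) (.nat y.2))
      (fun y => .num ((st y.1).price y.2)) :=
    vecApp (r := fun y : (x : X) × Fin (r x) => r y.1) (v := fun y => (st y.1).price) hs'.snd.fst idx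
  have hxc : Comp (fun y : (x : X) × Fin (r x) => O y.1) (fun y => .node (F y.1) (.nat y.2))
      (fun y => .ofProp (y.2 = (st y.1).target (A y.1) (c₀ y.1) ((st y.1).source (A y.1) (c₀ y.1)))) :=
    finEq (r := fun y : (x : X) × Fin (r x) => r y.1) idx (htgt.wk Sigma.fst)
  refine pair ?_ (pair ?_ (pair ?_ (pair ?_ ?_)))
  · exact (hdone.or heq).congr fun x => by simp [TreeState.next]
  · refine vecLam hr ((ite (hdone.wk Sigma.fst) hpr (ite (isOpen
      (r := fun y : (x : X) × Fin (r x) => r y.1) (st := fun y => st y.1) (c₀ := fun y => c₀ y.1)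
      hs' (hc₀.wk Sigma.fst) idx) (sub hpr hsl') hpr)).congr fun y => ?_)
    simp only [TreeState.next, TreeState.newPrice]
    split
    · rfl
    · split <;> rfl
  · exact lam hr (((treeApp (r := fun y : (x : X) × Fin (r x) => r y.1) (st := fun y => st y.1)
      hs' idx).or hxc).congr fun y => by simp [TreeState.next])
  · refine lam hr ((ite hxc ((permMul (permSwap hr htgt hc₀) hrs).wk Sigma.fst)
      (rotApp (r := fun y : (x : X) × Fin (r x) => r y.1) (st := fun y => st y.1)
        hs' idx)).congr fun y => ?_)
    simp only [TreeState.next]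
    split <;> rfl
  · refine (ite (hdone.not.and heq) hrs hs.snd.snd.snd.snd).congr fun x => ?_
    simp only [TreeState.next, Bool.not_eq_true]
    split <;> rfl

end Tree

theorem insertRow {s : ∀ x, Equiv.Perm (Fin (r x)) × (Fin (r x) → ℝ)} {t : ∀ x, Fin (r x)}
    (hA : Comp O F fun x => .mat (A x)) (hs : Comp O F fun x => .perm (s x).1)
    (hs' : Comp O F fun x => .vec (s x).2) (ht : Comp O F fun x => .nat (t x)) :
    Comp O F fun x => .node (.perm (insertRow (A x) (s x) (t x)).1)
      (.vec (insertRow (A x) (s x) (t x)).2) := by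
  classical
  have hr : Comp O F fun x => .rng (r x) := rng_of_family hA
  have hc := permApp hs ht
  have h := iterate (S := fun x => TreeState (r x)) (encS := fun _ st => st.val)
    (step := fun x => TreeState.next (A x) ((s x).1 (t x)))
    (init := fun x => ⟨false, (s x).2, fun c => decide (c = (s x).1 (t x)), fun _ => (s x).1,
      (s x).1⟩) hr ?_ (next (r := fun y : (x : X) × TreeState (r x) => r y.1)
        (A := fun y => A y.1) (st := fun y => y.2) (c₀ := fun y => (s y.1).1 (t y.1))
        (hA.wk Sigma.fst) (refl _ _).snd (hc.wk Sigma.fst)) ?_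
  · exact pair h.snd.snd.snd.snd h.snd.fst
  · refine pair (nil.congr fun x => by simp [Val.ofProp]) (pair hs' (pair (lam hr
      ((finEq (r := fun y : (x : X) × Fin (r x) => r y.1) idx (hc.wk Sigma.fst)).congr fun y =>
        by simp)) (pair (lam hr (hs.wk Sigma.fst)) hs)))
  · obtain ⟨U, hU, hb⟩ := polyBd_of_rng hr
    have hlin : PolyBd fun s => U s * 2 + 1 := (hU.mul (.const 2)).add (.const 1)
    refine ⟨fun s => (U s * 2 + 1) + (U s * 2 + 1) + (U s * (U s * 2 + 1 + 1) + 1) + (U s * 2 + 1) + 5,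
      (((hlin.add hlin).add ((hU.mul (hlin.add (.const 1))).add (.const 1))).add hlin).add (.const 5),
      fun x st => st.size_val_le.trans ?_⟩
    have h1 := hb x
    have h2 : r x * (r x * 2 + 1 + 1) ≤ U (F x).size * (U (F x).size * 2 + 1 + 1) :=
      Nat.mul_le_mul h1 (by omega)
    beta_reduce
    omega

theorem solve (hA : Comp O F fun x => .mat (A x)) : Comp O F fun x => .perm (solve (A x)) := by
  have hr : Comp O F fun x => .rng (r x) := rng_of_family hA
  have h0 := refl (fun y : (x : X) × ((Equiv.Perm (Fin (r x)) × (Fin (r x) → ℝ)) × Fin (r x)) =>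
    O y.1) (fun y => .node (F y.1) (.node (.node (.perm y.2.1.1) (.vec y.2.1.2)) (.nat y.2.2)))
  have h := foldFin (S := fun x => Equiv.Perm (Fin (r x)) × (Fin (r x) → ℝ))
    (encS := fun _ s => .node (.perm s.1) (.vec s.2)) (step := fun x => BICMech.insertRow (A x))
    (init := fun _ => (1, fun _ => 0)) hr (pair (permOne hr) (vecLam hr zero))
    (insertRow (r := fun y : (x : X) × ((Equiv.Perm (Fin (r x)) × (Fin (r x) → ℝ)) × Fin (r x)) =>
      r y.1) (A := fun y => A y.1) (s := fun y => y.2.1) (t := fun y => y.2.2)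
      (hA.wk Sigma.fst) h0.snd.fst.fst h0.snd.fst.snd h0.snd.snd) ?_
  · exact h.fst
  · obtain ⟨U, hU, hb⟩ := polyBd_of_rng hr
    refine ⟨fun s => (U s * 2 + 1) + (U s * 2 + 1) + 1, (((hU.mul (.const 2)).add (.const 1)).add
      ((hU.mul (.const 2)).add (.const 1))).add (.const 1), fun x s => ?_⟩
    have h1 := Val.size_perm_le s.1
    have h2 := Val.size_vec_le s.2
    have h3 := hb x
    simp only [Val.size]
    omega

end Comp


/-! ### Arrangements of the items -/

section Arrangement

variable {n : ℕ}

/-- The group of permutations of the items that is used: all of them, or only the identity. -/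
def Grp (sym : Bool) (g : Equiv.Perm (Fin n)) : Prop := sym = true ∨ g = 1

/-- The permutation of the items for which the lottery `p` suits the type `v` best. -/
def arr (sym : Bool) (v p : Typ n) : Equiv.Perm (Fin n) :=
  if sym then solve (fun j l => v j * p l) else 1

/-- The expected value of the best arrangement of `p` for type `v`. -/
def arrVal (sym : Bool) (v p : Typ n) : ℝ := ∑ j, v j * p (arr sym v p j)

variable {sym : Bool} {g h : Equiv.Perm (Fin n)}

theorem Grp.mul (hg : Grp sym g) (hh : Grp sym h) : Grp sym (g * h) := by
  rcases hg with hg | rfl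
  · exact .inl hg
  · simpa using hh

theorem Grp.inv (hg : Grp sym g) : Grp sym g⁻¹ := by
  rcases hg with hg | rfl
  · exact .inl hg
  · simp [Grp]

theorem Grp.one : Grp sym (1 : Equiv.Perm (Fin n)) := .inr rfl

theorem grp_arr (v p : Typ n) : Grp sym (arr sym v p) := by
  cases sym <;> simp [Grp, arr]

theorem le_arrVal (hg : Grp sym g) (v p : Typ n) : ∑ j, v j * p (g j) ≤ arrVal sym v p := by
  cases sym with
  | true => exact sum_le_solve (fun j l => v j * p l) g
  | false =>
    rcases hg with hg | rfl
    · simp at hg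
    · simp [arrVal, arr]

theorem sum_comp_left (v p : Typ n) (g h : Equiv.Perm (Fin n)) :
    ∑ j, (v ∘ g) j * p (h j) = ∑ j, v j * p ((h * g⁻¹) j) := by
  rw [← Equiv.sum_comp g (fun j => v j * p ((h * g⁻¹) j))]
  simp

/-- A relabelling of the type can be absorbed into the arrangement because the admissible
arrangements form a group. The edge weights therefore depend only on the orbit of a replica. -/
theorem arrVal_comp_left (hg : Grp sym g) (v p : Typ n) :
    arrVal sym (v ∘ g) p = arrVal sym v p := by
  refine le_antisymm ?_ ?_
  · rw [arrVal, sum_comp_left]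
    exact le_arrVal ((grp_arr _ _).mul hg.inv) v p
  · have h := le_arrVal (sym := sym) ((grp_arr v p).mul hg) (v ∘ g) p
    rw [sum_comp_left] at h
    simpa [arrVal, mul_assoc] using h

end Arrangement

/-! ### The matching of replicas and surrogates -/

section Matching

variable {n r : ℕ} (sym : Bool) (β : ℝ)

/-- The value of the expected outcome `(p, q)` for type `v`, when the price is discounted by `β`. -/
def wt (v p : Typ n) (q : ℝ) : ℝ := arrVal sym v p - β * q

/-- The weights of the edges between the replicas and the surrogates. -/
def bidMat (R : Fin r → Typ n) (p : Fin r → Typ n) (q : Fin r → ℝ) (k l : Fin r) : ℝ :=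
  max 0 (wt sym β (R k) (p l) (q l))

/-- The matrix with row `τ` replaced by zeros. -/
def zeroRow (A : Fin r → Fin r → ℝ) (τ k l : Fin r) : ℝ := if k = τ then 0 else A k l

/-- The externality of row `τ` on the other rows. -/
def externality (A : Fin r → Fin r → ℝ) (τ : Fin r) : ℝ :=
  ∑ k, zeroRow A τ k (solve (zeroRow A τ) k) - ∑ k, zeroRow A τ k (solve A k)

/-- Whether replica `τ` buys the outcome of the surrogate to which it is matched. -/
def Buys (R : Fin r → Typ n) (p : Fin r → Typ n) (q : Fin r → ℝ) (τ : Fin r) : Prop :=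
  0 < wt sym β (R τ) (p (solve (bidMat sym β R p q) τ)) (q (solve (bidMat sym β R p q) τ))

open Classical in
/-- The price charged to replica `τ`. -/
def charge (R : Fin r → Typ n) (p : Fin r → Typ n) (q : Fin r → ℝ) (τ : Fin r) : ℝ :=
  externality (bidMat sym β R p q) τ +
    if Buys sym β R p q τ then β * q (solve (bidMat sym β R p q) τ) else 0

theorem externality_nonneg (A : Fin r → Fin r → ℝ) (τ : Fin r) : 0 ≤ externality A τ :=
  sub_nonneg.2 (sum_le_solve _ _)

open Classical in
theorem sum_update_zeroRow (A B : Fin r → Fin r → ℝ) (τ : Fin r)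
    (h : ∀ k, k ≠ τ → A k = B k) (σ : Equiv.Perm (Fin r)) :
    ∑ k, A k (σ k) = A τ (σ τ) + ∑ k, zeroRow B τ k (σ k) := by
  rw [← Finset.add_sum_erase _ _ (Finset.mem_univ τ),
    ← Finset.add_sum_erase (a := τ) (f := fun k => zeroRow B τ k (σ k)) _ (Finset.mem_univ τ)]
  simp only [zeroRow, if_true, zero_add]
  congr 1
  refine Finset.sum_congr rfl fun k hk => ?_
  have hk' := Finset.ne_of_mem_erase hk
  rw [if_neg hk', h k hk']

open Classical in
/-- Reporting another type `R' τ` does not help replica `τ`, whatever the arrangement `g`. -/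
theorem truthful {R R' : Fin r → Typ n} {p : Fin r → Typ n} {q : Fin r → ℝ} {τ : Fin r}
    (hRR : ∀ k, k ≠ τ → R' k = R k) {g : Equiv.Perm (Fin n)} (hg : Grp sym g) :
    (if Buys sym β R' p q τ then ∑ j, R τ j * p (solve (bidMat sym β R' p q) τ) (g j) else 0) -
      charge sym β R' p q τ ≤
    (if Buys sym β R p q τ then arrVal sym (R τ) (p (solve (bidMat sym β R p q) τ)) else 0) -
      charge sym β R p q τ := by
  set A := bidMat sym β R p q with hA
  set A' := bidMat sym β R' p q with hA'
  have hrow : ∀ k, k ≠ τ → A k = A' k := fun k hk => by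
    ext l; simp [hA, hA', bidMat, hRR k hk]
  -- The first term of the externality does not see row `τ`. Zeroing the row, instead of deleting
  -- it, keeps the matrix square.
  have hz : zeroRow A τ = zeroRow A' τ := by
    ext k l
    by_cases hk : k = τ
    · simp [zeroRow, hk]
    · simp [zeroRow, hk, hrow k hk]
  -- The matching induced by the false report is one of the competitors of the optimum at the true
  -- weights.
  have h1 := sum_le_solve A (solve A')
  rw [sum_update_zeroRow A A' τ hrow, sum_update_zeroRow A A' τ hrow] at h1
  -- Purchase and arrangement were decided for the false report, whereas the true weight takes the
  -- positive part of the value of the best arrangement.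
  have hl : (if Buys sym β R' p q τ then ∑ j, R τ j * p (solve A' τ) (g j) else 0) -
      (if Buys sym β R' p q τ then β * q (solve A' τ) else 0) ≤ A τ (solve A' τ) := by
    split
    · have := le_arrVal hg (R τ) (p (solve A' τ))
      refine le_trans ?_ (le_max_right _ _)
      simp only [wt]; linarith
    · simp [hA, bidMat]
  have hr : A τ (solve A τ) = (if Buys sym β R p q τ then arrVal sym (R τ) (p (solve A τ)) else 0) -
      (if Buys sym β R p q τ then β * q (solve A τ) else 0) := by
    by_cases hb : Buys sym β R p q τ
    · simp only [hb, if_true]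
      exact max_eq_right hb.le
    · simp only [hb, if_false, sub_zero]
      exact max_eq_left (not_lt.1 hb)
  simp only [charge, externality, ← hA, ← hA', hz]
  linarith

open Classical in
/-- A replica that reports its type has nonnegative utility. -/
theorem charge_le {R : Fin r → Typ n} {p : Fin r → Typ n} {q : Fin r → ℝ} {τ : Fin r} :
    charge sym β R p q τ ≤
    (if Buys sym β R p q τ then arrVal sym (R τ) (p (solve (bidMat sym β R p q) τ)) else 0) := by
  set A := bidMat sym β R p q with hA
  -- The competitor is the optimum of the other rows, in which row `τ` receives some nonnegative
  -- weight.
  have h1 := sum_le_solve A (solve (zeroRow A τ))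
  rw [sum_update_zeroRow A A τ (fun _ _ => rfl), sum_update_zeroRow A A τ (fun _ _ => rfl)] at h1
  have h0 : 0 ≤ A τ (solve (zeroRow A τ) τ) := le_max_left _ _
  have hr : A τ (solve A τ) = (if Buys sym β R p q τ then arrVal sym (R τ) (p (solve A τ)) else 0) -
      (if Buys sym β R p q τ then β * q (solve A τ) else 0) := by
    by_cases hb : Buys sym β R p q τ
    · simp only [hb, if_true]
      exact max_eq_right hb.le
    · simp only [hb, if_false, sub_zero]
      exact max_eq_left (not_lt.1 hb)
  simp only [charge, externality, ← hA]
  linarith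

theorem bidMat_comp {R R' : Fin r → Typ n} (h : ∀ k, ∃ g, Grp sym g ∧ R' k = R k ∘ g)
    (p : Fin r → Typ n) (q : Fin r → ℝ) : bidMat sym β R' p q = bidMat sym β R p q := by
  ext k l
  obtain ⟨g, hg, h⟩ := h k
  simp only [bidMat, wt, h, arrVal_comp_left hg]

end Matching

/-! ### Matching equal classes -/

open Classical in
/-- The number of indices at which `f` takes the value `c`. -/
def cnt {r : ℕ} {K : Type*} (f : Fin r → K) (c : K) : ℝ :=
  ∑ k, if f k = c then 1 else 0

-- Take `μ` with the most agreements. If some class had unmatched members on both sides, a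
-- transposition would gain an agreement. So in each class only one side has a surplus, of size
-- `|cnt f c - cnt g c|`, and the sum of these counts every mismatch twice.
open Classical in
theorem exists_perm_mismatch_le {r : ℕ} {K : Type*} [Fintype K] (f g : Fin r → K) :
    ∃ μ : Equiv.Perm (Fin r), (∑ k, if f k = g (μ k) then (0 : ℝ) else 1) ≤
      (∑ c, |cnt f c - cnt g c|) / 2 := by
  obtain ⟨μ, -, hμ⟩ := Finset.exists_max_image (Finset.univ : Finset (Equiv.Perm (Fin r)))
    (fun μ => ∑ k, if f k = g (μ k) then (1 : ℕ) else 0) ⟨1, Finset.mem_univ _⟩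
  refine ⟨μ, ?_⟩
  let a : K → ℝ := fun c => ∑ k, if f k = c ∧ g (μ k) ≠ c then 1 else 0
  let b : K → ℝ := fun c => ∑ k, if f k ≠ c ∧ g (μ k) = c then 1 else 0
  have hab : ∀ c, cnt f c - cnt g c = a c - b c := by
    intro c
    have : cnt g c = ∑ k, if g (μ k) = c then (1 : ℝ) else 0 :=
      (Equiv.sum_comp μ fun k => if g k = c then (1 : ℝ) else 0).symm
    rw [this]
    simp only [cnt, a, b, ← Finset.sum_sub_distrib]
    refine Finset.sum_congr rfl fun k _ => ?_
    by_cases h1 : f k = c <;> by_cases h2 : g (μ k) = c <;> simp [h1, h2]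
  have hor : ∀ c, a c = 0 ∨ b c = 0 := by
    intro c
    by_contra hcon
    push Not at hcon
    obtain ⟨k, -, hk⟩ := Finset.exists_ne_zero_of_sum_ne_zero hcon.1
    obtain ⟨k', -, hk'⟩ := Finset.exists_ne_zero_of_sum_ne_zero hcon.2
    have h1 : f k = c ∧ g (μ k) ≠ c := by by_contra h; simp [h] at hk
    have h2 : f k' ≠ c ∧ g (μ k') = c := by by_contra h; simp [h] at hk'
    have hne : k ≠ k' := fun h => h2.1 (h ▸ h1.1)
    refine absurd (hμ (μ * Equiv.swap k k') (Finset.mem_univ _)) (not_le.2 ?_)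
    refine Finset.sum_lt_sum (fun x _ => ?_) ⟨k, Finset.mem_univ _, ?_⟩
    · by_cases hx : x = k
      · have : ¬ f k = g (μ k) := fun h => h1.2 (h ▸ h1.1)
        simp [hx, this]
      · by_cases hx' : x = k'
        · have : ¬ f k' = g (μ k') := fun h => h2.1 (h.trans h2.2)
          simp [hx', this]
        · simp [Equiv.swap_apply_of_ne_of_ne hx hx']
    · simp [h1.1, h2.2, Ne.symm h1.2]
  have habs : ∀ c, |cnt f c - cnt g c| = a c + b c := by
    intro c
    have ha : 0 ≤ a c := Finset.sum_nonneg fun k _ => by split <;> norm_num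
    have hb : 0 ≤ b c := Finset.sum_nonneg fun k _ => by split <;> norm_num
    rw [hab]
    rcases hor c with h | h <;> rw [h]
    · simp [abs_of_nonneg hb]
    · simp [abs_of_nonneg ha]
  have hsa : ∑ c, a c = ∑ k, if f k = g (μ k) then (0 : ℝ) else 1 := by
    simp only [a]
    rw [Finset.sum_comm]
    refine Finset.sum_congr rfl fun k _ => ?_
    rw [Finset.sum_eq_single (f k)]
    · by_cases h : f k = g (μ k)
      · simp [h]
      · simp [h, Ne.symm h]
    · intro c _ hc; simp [Ne.symm hc]
    · simp
  have hsb : ∑ c, b c = ∑ k, if f k = g (μ k) then (0 : ℝ) else 1 := by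
    simp only [b]
    rw [Finset.sum_comm]
    refine Finset.sum_congr rfl fun k _ => ?_
    rw [Finset.sum_eq_single (g (μ k))]
    · by_cases h : f k = g (μ k)
      · simp [h]
      · simp [h]
    · intro c _ hc; simp [Ne.symm hc]
    · simp
  rw [Finset.sum_congr rfl fun c _ => habs c, Finset.sum_add_distrib, hsa, hsb]
  linarith

/-! ### The discounted prices of the matched surrogates -/

/-- Data about the surrogate types `G` of one bidder: their values, the expected outcomes that they
yield, and an action of the permutations of the items. -/
structure Surrogates (n : ℕ) (G : Type) where
  val : G → Typ n
  phi : G → Typ n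
  price : G → ℝ
  act : G → Equiv.Perm (Fin n) → G

namespace Surrogates

variable {n r : ℕ} {G : Type} (Γ : Surrogates n G)

/-- The utility of a surrogate that reports its own type. -/
def util (s : G) : ℝ := ∑ j, Γ.val s j * Γ.phi s j - Γ.price s

/-- The expected number of items that a surrogate receives. -/
def items (s : G) : ℝ := ∑ j, Γ.phi s j

/-- The action is compatible with the values and the outcomes. -/
structure Compatible (sym : Bool) : Prop where
  val : ∀ s g, Grp sym g → Γ.val (Γ.act s g) = Γ.val s ∘ g
  phi : ∀ s g, Grp sym g → Γ.phi (Γ.act s g) = Γ.phi s ∘ g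
  price : ∀ s g, Grp sym g → Γ.price (Γ.act s g) = Γ.price s

/-- The outcomes are `ε`-incentive compatible and individually rational, with at most `T` items. -/
structure Admissible (ε T : ℝ) : Prop where
  val_nonneg : ∀ s j, 0 ≤ Γ.val s j
  val_le_one : ∀ s j, Γ.val s j ≤ 1
  phi_nonneg : ∀ s j, 0 ≤ Γ.phi s j
  items_le : ∀ s, Γ.items s ≤ T
  ic : ∀ s t, ∑ j, Γ.val s j * Γ.phi t j - Γ.price t - ε * Γ.items t ≤ Γ.util s
  ir : ∀ s, 0 ≤ Γ.util s

variable {Γ} {sym : Bool} {ε T δ β : ℝ}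

theorem Compatible.util (h : Γ.Compatible sym) (s : G) {g : Equiv.Perm (Fin n)} (hg : Grp sym g) :
    Γ.util (Γ.act s g) = Γ.util s := by
  simp only [Surrogates.util, h.val s g hg, h.phi s g hg, h.price s g hg, Function.comp]
  rw [Equiv.sum_comp g fun j => Γ.val s j * Γ.phi s j]

theorem Compatible.items (h : Γ.Compatible sym) (s : G) {g : Equiv.Perm (Fin n)}
    (hg : Grp sym g) : Γ.items (Γ.act s g) = Γ.items s := by
  simp only [Surrogates.items, h.phi s g hg, Function.comp]
  exact Equiv.sum_comp g fun j => Γ.phi s j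

open Classical in
/-- The sum of the discounts is nearly what it would be if all surrogates were sold. -/
theorem sum_price_le {K : Type*} [Fintype K] (hc : Γ.Compatible sym) (ha : Γ.Admissible ε T)
    (hε : 0 ≤ ε) (hδ : 0 ≤ δ) (cls : G → K)
    (hcls : ∀ s t, cls s = cls t → ∃ g, Grp sym g ∧ Γ.act s g = t)
    (R : Fin r → Typ n) (V S : Fin r → G)
    (hRV : ∀ k j, Γ.val (V k) j ≤ R k j ∧ R k j ≤ Γ.val (V k) j + δ) :
    ∑ k, Γ.util (S k) + (1 - β) * ∑ k, Γ.price (S k) -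
        T * ((∑ c, |cnt (fun k => cls (V k)) c - cnt (fun k => cls (S k)) c|) / 2) ≤
      ∑ k, Γ.util (V k) + (ε + δ) * ∑ k, Γ.items (S k) + (1 - β) * ∑ k,
        if Buys sym β R (fun k => Γ.phi (S k)) (fun k => Γ.price (S k)) k then
          Γ.price (S (solve (bidMat sym β R (fun k => Γ.phi (S k)) (fun k => Γ.price (S k))) k))
        else 0 := by
  set A := bidMat sym β R (fun k => Γ.phi (S k)) (fun k => Γ.price (S k)) with hA
  set B := Buys sym β R (fun k => Γ.phi (S k)) (fun k => Γ.price (S k)) with hB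
  have hit : ∀ s, 0 ≤ Γ.items s := fun s => Finset.sum_nonneg fun j _ => ha.phi_nonneg s j
  -- That `T` is nonnegative is only known from the existence of a surrogate.
  have hT : r = 0 ∨ 0 ≤ T := by
    rcases Nat.eq_zero_or_pos r with h | h
    · exact .inl h
    · exact .inr ((hit (S ⟨0, h⟩)).trans (ha.items_le _))
  -- Upper bound on an edge of the optimal matching. The replica exceeds `V k` by at most `δ` per
  -- item, and `V k` gains at most `ε` per item from reporting the rearranged surrogate; what
  -- remains is the discount. An unsold edge has weight zero, below the right side by individual
  -- rationality.
  have hup : ∀ k, A k (solve A k) ≤ Γ.util (V k) + (ε + δ) * Γ.items (S (solve A k)) +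
      (1 - β) * if B k then Γ.price (S (solve A k)) else 0 := by
    intro k
    set t := S (solve A k) with ht
    by_cases hb : B k
    · have h1 : A k (solve A k) = wt sym β (R k) (Γ.phi t) (Γ.price t) := max_eq_right hb.le
      set g := arr sym (R k) (Γ.phi t) with hg
      have hgg : Grp sym g := grp_arr _ _
      have h2 : arrVal sym (R k) (Γ.phi t) ≤ ∑ j, Γ.val (V k) j * Γ.phi (Γ.act t g) j +
          δ * Γ.items (Γ.act t g) := by
        rw [arrVal, items, Finset.mul_sum, ← Finset.sum_add_distrib, hc.phi t g hgg]
        refine Finset.sum_le_sum fun j _ => ?_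
        rw [← hg, ← add_mul]
        exact mul_le_mul_of_nonneg_right (hRV k j).2 (ha.phi_nonneg _ _)
      have h3 := ha.ic (V k) (Γ.act t g)
      rw [hc.items t hgg] at h2 h3
      rw [hc.price t g hgg] at h3
      rw [h1, wt, if_pos hb]
      linarith
    · have h1 : A k (solve A k) = 0 := max_eq_left (not_lt.1 hb)
      rw [h1, if_neg hb]
      have := ha.ir (V k)
      have := mul_nonneg (add_nonneg hε hδ) (hit t)
      linarith
  obtain ⟨μ, hμ⟩ := exists_perm_mismatch_le (fun k => cls (V k)) fun k => cls (S k)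
  -- Lower bound on an edge of the class matching. Within a class the replica can imitate the
  -- surrogate's own utility. Across classes its value is at least zero, and at most `T` is lost
  -- because values are at most one.
  have hlow : ∀ k, Γ.util (S (μ k)) + (1 - β) * Γ.price (S (μ k)) -
      T * (if cls (V k) = cls (S (μ k)) then 0 else 1) ≤ A k (μ k) := by
    intro k
    refine le_trans ?_ (le_max_right _ _)
    simp only [wt]
    by_cases h : cls (V k) = cls (S (μ k))
    · obtain ⟨g, hg, hgs⟩ := hcls _ _ h.symm
      have h1 := le_arrVal hg (R k) (Γ.phi (S (μ k)))
      have h2 : ∑ j, Γ.val (V k) j * Γ.phi (V k) j ≤ ∑ j, R k j * Γ.phi (S (μ k)) (g j) := by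
        refine Finset.sum_le_sum fun j _ => ?_
        have : Γ.phi (V k) j = Γ.phi (S (μ k)) (g j) := by rw [← hgs, hc.phi _ _ hg]; rfl
        rw [← this]
        exact mul_le_mul_of_nonneg_right (hRV k j).1 (ha.phi_nonneg _ _)
      have h3 := hc.util (S (μ k)) hg
      have h4 := hc.price (S (μ k)) g hg
      rw [hgs] at h3 h4
      have h5 : Γ.util (V k) = ∑ j, Γ.val (V k) j * Γ.phi (V k) j - Γ.price (V k) := rfl
      rw [if_pos h]
      linarith
    · have h1 := le_arrVal Grp.one (sym := sym) (R k) (Γ.phi (S (μ k)))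
      have h2 : 0 ≤ ∑ j, R k j * Γ.phi (S (μ k)) ((1 : Equiv.Perm (Fin n)) j) :=
        Finset.sum_nonneg fun j _ => mul_nonneg ((ha.val_nonneg _ _).trans (hRV k j).1)
          (ha.phi_nonneg _ _)
      have h3 : ∑ j, Γ.val (S (μ k)) j * Γ.phi (S (μ k)) j ≤ Γ.items (S (μ k)) :=
        Finset.sum_le_sum fun j _ => mul_le_of_le_one_left (ha.phi_nonneg _ _) (ha.val_le_one _ _)
      have h4 := ha.items_le (S (μ k))
      have h5 : Γ.util (S (μ k)) = ∑ j, Γ.val (S (μ k)) j * Γ.phi (S (μ k)) j - Γ.price (S (μ k)) :=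
        rfl
      rw [if_neg h]
      linarith
  have s1 := Finset.sum_le_sum fun k (_ : k ∈ Finset.univ) => hup k
  have s2 := Finset.sum_le_sum fun k (_ : k ∈ Finset.univ) => hlow k
  have s3 := sum_le_solve A μ
  -- Both matchings are perfect, so items, utilities and prices can be summed over all surrogates
  -- irrespective of who is matched to whom.
  simp only [Finset.sum_add_distrib, Finset.sum_sub_distrib, ← Finset.mul_sum] at s1 s2
  rw [Equiv.sum_comp μ fun k => Γ.util (S k), Equiv.sum_comp μ fun k => Γ.price (S k)] at s2
  rw [Equiv.sum_comp (solve A) fun k => Γ.items (S k)] at s1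
  have s4 : T * (∑ k, if cls (V k) = cls (S (μ k)) then (0 : ℝ) else 1) ≤
      T * ((∑ c, |cnt (fun k => cls (V k)) c - cnt (fun k => cls (S k)) c|) / 2) := by
    rcases hT with h | h
    · subst h
      simp [cnt]
    · exact mul_le_mul_of_nonneg_left hμ h
  linarith

end Surrogates


open scoped ENNReal

/-! ### The random choice of a surrogate -/

section Pick

variable {n r : ℕ} {G : Type}

/-- The randomness of one bidder: the other replicas, the surrogates, the position of the bidder
among the replicas, and a permutation of the items. -/
abbrev Rand (r n : ℕ) (G : Type) :=
  (Fin r → Typ n) × ((Fin r → G) × (Fin r × Equiv.Perm (Fin n)))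

variable (sym : Bool) (β : ℝ) (Γ : Surrogates n G)

/-- The matching of the replicas and the surrogates. -/
def Surrogates.col (R : Fin r → Typ n) (S : Fin r → G) : Equiv.Perm (Fin r) :=
  solve (bidMat sym β R (fun k => Γ.phi (S k)) (fun k => Γ.price (S k)))

/-- Whether a replica buys. -/
def Surrogates.Sold (R : Fin r → Typ n) (S : Fin r → G) (τ : Fin r) : Prop :=
  Buys sym β R (fun k => Γ.phi (S k)) (fun k => Γ.price (S k)) τ

/-- The surrogate type that replica `τ` receives, before the random relabelling `g` is undone. -/
def Surrogates.give (g : Equiv.Perm (Fin n)) (R : Fin r → Typ n) (S : Fin r → G) (τ : Fin r) : G :=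
  -- The arrangement is computed for the relabelled type and transported back. It is optimal for `R
  -- τ` whatever `g` is, while a random `g` washes out the dependence on tie-breaking.
  Γ.act (S (Γ.col sym β R S τ)) (arr sym (R τ ∘ g) (Γ.phi (S (Γ.col sym β R S τ))) * g⁻¹)

open Classical in
/-- The surrogate type of a bidder of type `v`, and whether she buys its outcome. -/
def Surrogates.pick (v : Typ n) (x : Rand r n G) : G × Bool :=
  (Γ.give sym β x.2.2.2 (Function.update x.1 x.2.2.1 v) x.2.1 x.2.2.1,
    decide (Γ.Sold sym β (Function.update x.1 x.2.2.1 v) x.2.1 x.2.2.1))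

/-- The price charged to a bidder of type `v`. -/
def Surrogates.pay (v : Typ n) (x : Rand r n G) : ℝ :=
  charge sym β (Function.update x.1 x.2.2.1 v) (fun k => Γ.phi (x.2.1 k))
    (fun k => Γ.price (x.2.1 k)) x.2.2.1

/-! #### Measurability -/

variable {Ω : Type*} [MeasurableSpace Ω] [Fintype G] [MeasurableSpace G] [DiscreteMeasurableSpace G]
variable {sym β Γ}

theorem measurable_arr {v : Ω → Typ n} (hv : Measurable v) (p : Typ n) :
    Measurable fun ω => arr sym (v ω) p := by
  cases sym
  · exact measurable_const
  · exact measurable_solve fun k c => ((measurable_pi_apply k).comp hv).mul_const _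

theorem measurable_arrVal {v : Ω → Typ n} (hv : Measurable v) (p : Typ n) :
    Measurable fun ω => arrVal sym (v ω) p :=
  Finset.measurable_sum _ fun j _ => ((measurable_pi_apply j).comp hv).mul
    (measurable_of_discrete_left (measurable_arr hv p) fun σ => p (σ j))

theorem measurable_wt {v : Ω → Typ n} {s : Ω → G} (hv : Measurable v) (hs : Measurable s) :
    Measurable fun ω => wt sym β (v ω) (Γ.phi (s ω)) (Γ.price (s ω)) :=
  measurable_apply_of_countable (f := fun ω s => wt sym β (v ω) (Γ.phi s) (Γ.price s))
    (fun _ => (measurable_arrVal hv _).sub_const _) hs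

variable {R : Ω → Fin r → Typ n} {S : Ω → Fin r → G} {τ : Ω → Fin r}

theorem measurable_bidMat (hR : Measurable R) (hS : Measurable S) (k l : Fin r) :
    Measurable fun ω => bidMat sym β (R ω) (fun k => Γ.phi (S ω k)) (fun k => Γ.price (S ω k)) k l :=
  measurable_const.max (measurable_wt ((measurable_pi_apply k).comp hR)
    ((measurable_pi_apply l).comp hS))

theorem measurable_col (hR : Measurable R) (hS : Measurable S) :
    Measurable fun ω => Γ.col sym β (R ω) (S ω) :=
  measurable_solve fun k l => measurable_bidMat hR hS k l

theorem measurable_col_apply (hR : Measurable R) (hS : Measurable S) (hτ : Measurable τ) :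
    Measurable fun ω => Γ.col sym β (R ω) (S ω) (τ ω) :=
  measurable_of_discrete_left ((measurable_col (Γ := Γ) (sym := sym) (β := β) hR hS).prodMk hτ)
    fun p : Equiv.Perm (Fin r) × Fin r => p.1 p.2

theorem measurable_surr (hR : Measurable R) (hS : Measurable S) (hτ : Measurable τ) :
    Measurable fun ω => S ω (Γ.col sym β (R ω) (S ω) (τ ω)) :=
  measurable_apply_of_countable (fun k => (measurable_pi_apply k).comp hS)
    (measurable_col_apply hR hS hτ)

theorem measurable_row (hR : Measurable R) (hτ : Measurable τ) : Measurable fun ω => R ω (τ ω) :=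
  measurable_apply_of_countable (fun k => (measurable_pi_apply k).comp hR) hτ

theorem measurableSet_sold (hR : Measurable R) (hS : Measurable S) (hτ : Measurable τ) :
    MeasurableSet {ω | Γ.Sold sym β (R ω) (S ω) (τ ω)} :=
  measurableSet_lt measurable_const (measurable_wt (measurable_row hR hτ) (measurable_surr hR hS hτ))

theorem measurable_give {g : Ω → Equiv.Perm (Fin n)} (hg : Measurable g) (hR : Measurable R)
    (hS : Measurable S) (hτ : Measurable τ) :
    Measurable fun ω => Γ.give sym β (g ω) (R ω) (S ω) (τ ω) := by
  have hs : Measurable fun ω => S ω (Γ.col sym β (R ω) (S ω) (τ ω)) := measurable_surr hR hS hτ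
  have hv : Measurable fun ω => R ω (τ ω) ∘ g ω :=
    measurable_apply_of_countable (f := fun ω (σ : Equiv.Perm (Fin n)) => R ω (τ ω) ∘ σ)
      (fun σ => measurable_pi_lambda _
      fun j => (measurable_pi_apply (σ j)).comp (measurable_row hR hτ)) hg
  have ha : Measurable fun ω => arr sym (R ω (τ ω) ∘ g ω)
      (Γ.phi (S ω (Γ.col sym β (R ω) (S ω) (τ ω)))) :=
    measurable_apply_of_countable (f := fun ω s => arr sym (R ω (τ ω) ∘ g ω) (Γ.phi s))
      (fun s => measurable_arr hv _) hs
  exact measurable_of_discrete_left ((hs.prodMk ha).prodMk hg)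
    fun p : (G × Equiv.Perm (Fin n)) × Equiv.Perm (Fin n) => Γ.act p.1.1 (p.1.2 * p.2⁻¹)

theorem measurable_act_arr {g : Ω → Equiv.Perm (Fin n)} (hg : Measurable g) (hR : Measurable R)
    (hS : Measurable S) (hτ : Measurable τ) :
    Measurable fun ω => Γ.act (S ω (Γ.col sym β (R ω) (S ω) (τ ω)))
      (arr sym (R ω (τ ω)) (Γ.phi (S ω (Γ.col sym β (R ω) (S ω) (τ ω)))) * (g ω)⁻¹) := by
  have hs : Measurable fun ω => S ω (Γ.col sym β (R ω) (S ω) (τ ω)) := measurable_surr hR hS hτ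
  have ha : Measurable fun ω => arr sym (R ω (τ ω))
      (Γ.phi (S ω (Γ.col sym β (R ω) (S ω) (τ ω)))) :=
    measurable_apply_of_countable (f := fun ω s => arr sym (R ω (τ ω)) (Γ.phi s))
      (fun s => measurable_arr (measurable_row hR hτ) _) hs
  exact measurable_of_discrete_left ((hs.prodMk ha).prodMk hg)
    fun p : (G × Equiv.Perm (Fin n)) × Equiv.Perm (Fin n) => Γ.act p.1.1 (p.1.2 * p.2⁻¹)

theorem measurable_externality {A : Ω → Fin r → Fin r → ℝ}
    (hA : ∀ k l, Measurable fun ω => A ω k l) (τ : Fin r) :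
    Measurable fun ω => externality (A ω) τ := by
  have hz : ∀ k l, Measurable fun ω => zeroRow (A ω) τ k l := fun k l => by
    by_cases h : k = τ
    · simp [zeroRow, h]
    · simpa [zeroRow, h] using hA k l
  have h : ∀ {σ : Ω → Equiv.Perm (Fin r)}, Measurable σ → Measurable fun ω =>
      ∑ k, zeroRow (A ω) τ k (σ ω k) := fun {σ} hσ => Finset.measurable_sum _ fun k _ =>
    measurable_apply_of_countable (f := fun ω σ => zeroRow (A ω) τ k (σ k)) (fun σ => hz k (σ k)) hσ
  exact (h (measurable_solve hz)).sub (h (measurable_solve hA))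

theorem measurable_charge (hR : Measurable R) (hS : Measurable S) (hτ : Measurable τ) :
    Measurable fun ω => charge sym β (R ω) (fun k => Γ.phi (S ω k)) (fun k => Γ.price (S ω k)) (τ ω) := by
  classical
  refine measurable_apply_of_countable (f := fun ω τ => charge sym β (R ω)
    (fun k => Γ.phi (S ω k)) (fun k => Γ.price (S ω k)) τ) (fun τ => ?_) hτ
  refine (measurable_externality (measurable_bidMat hR hS) τ).add (Measurable.ite
    (measurableSet_sold hR hS measurable_const) ?_ measurable_const)
  exact (measurable_of_discrete_left (measurable_surr (Γ := Γ) (sym := sym) (β := β) hR hS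
    (measurable_const (a := τ))) Γ.price).const_mul β

theorem measurable_update {v : Ω → Typ n} (hv : Measurable v) (hR : Measurable R)
    (hτ : Measurable τ) : Measurable fun ω => Function.update (R ω) (τ ω) (v ω) := by
  classical
  refine measurable_pi_lambda _ fun k => ?_
  refine measurable_apply_of_countable (f := fun ω τ => Function.update (R ω) τ (v ω) k)
    (fun τ => ?_) hτ
  by_cases h : k = τ
  · subst h; simpa using hv
  · simp only [Function.update_of_ne h]
    exact (measurable_pi_apply k).comp hR

theorem measurable_pick {v : Ω → Typ n} {x : Ω → Rand r n G} (hv : Measurable v)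
    (hx : Measurable x) : Measurable fun ω => Γ.pick sym β (v ω) (x ω) := by
  classical
  have hR := measurable_update hv hx.fst hx.snd.snd.fst
  refine (measurable_give hx.snd.snd.snd hR hx.snd.fst hx.snd.snd.fst).prodMk ?_
  have h := measurableSet_sold (Γ := Γ) (sym := sym) (β := β) hR hx.snd.fst hx.snd.snd.fst
  have hd : ∀ P : Prop, ∀ _ : Decidable P, decide P = if P then true else false := fun P _ => by
    by_cases hP : P <;> simp [hP]
  simp only [hd]
  exact Measurable.ite h measurable_const measurable_const

theorem measurable_pay {v : Ω → Typ n} {x : Ω → Rand r n G} (hv : Measurable v)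
    (hx : Measurable x) : Measurable fun ω => Γ.pay sym β (v ω) (x ω) :=
  measurable_charge (measurable_update hv hx.fst hx.snd.snd.fst) hx.snd.fst hx.snd.snd.fst

end Pick

/-! #### The law of the surrogate of a truthful bidder -/

section Law

variable {n r : ℕ} {G : Type}

/-- The law of the randomness of one bidder. -/
def randLaw [MeasurableSpace G] (r : ℕ) (D : Measure (Typ n)) (ν : Measure G)
    (lpos : Measure (Fin r)) (lperm : Measure (Equiv.Perm (Fin n))) : Measure (Rand r n G) :=
  (Measure.pi fun _ => D).prod ((Measure.pi fun _ => ν).prod (lpos.prod lperm))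

instance [MeasurableSpace G] {D : Measure (Typ n)} {ν : Measure G}
    {lpos : Measure (Fin r)} {lperm : Measure (Equiv.Perm (Fin n))} [IsProbabilityMeasure D]
    [IsProbabilityMeasure ν] [IsProbabilityMeasure lpos] [IsProbabilityMeasure lperm] :
    IsProbabilityMeasure (randLaw r D ν lpos lperm) := by unfold randLaw; infer_instance

/-- Overwriting one of independent samples by a fresh one changes nothing in law: a truthful bidder
looks like any other replica. -/
theorem measurePreserving_update (D : Measure (Typ n)) [IsProbabilityMeasure D] (τ : Fin r) :
    MeasurePreserving (fun p : Typ n × (Fin r → Typ n) => Function.update p.2 τ p.1)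
      (D.prod (Measure.pi fun _ => D)) (Measure.pi fun _ => D) := by
  classical
  have hm : Measurable fun p : Typ n × (Fin r → Typ n) => Function.update p.2 τ p.1 :=
    measurable_update measurable_fst measurable_snd measurable_const
  refine ⟨hm, (Measure.pi_eq fun s hs => ?_).symm⟩
  rw [Measure.map_apply hm (.univ_pi hs)]
  have : (fun p : Typ n × (Fin r → Typ n) => Function.update p.2 τ p.1) ⁻¹' Set.univ.pi s =
      s τ ×ˢ Set.univ.pi (Function.update s τ Set.univ) := by
    ext p
    simp only [Set.mem_preimage, Set.mem_pi, Set.mem_univ, true_imp_iff, Set.mem_prod]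
    constructor
    · intro h
      refine ⟨by simpa using h τ, fun k => ?_⟩
      by_cases hk : k = τ
      · subst hk; simp
      · simpa [hk] using h k
    · rintro ⟨h1, h2⟩ k
      by_cases hk : k = τ
      · subst hk; simpa using h1
      · simpa [hk] using h2 k
  rw [this, Measure.prod_prod, Measure.pi_pi, ← Finset.mul_prod_erase _ _ (Finset.mem_univ τ),
    ← Finset.mul_prod_erase (a := τ) (f := fun i => D (s i)) _ (Finset.mem_univ τ)]
  simp only [Function.update_self, measure_univ, one_mul]
  congr 1
  refine Finset.prod_congr rfl fun k hk => ?_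
  rw [Function.update_of_ne (Finset.ne_of_mem_erase hk)]

/-- The overwritten position may be read from the independent randomness `Y`, which keeps its law
and stays independent of the profile. -/
theorem measurePreserving_update_prod (D : Measure (Typ n)) [IsProbabilityMeasure D] {Y : Type*}
    [MeasurableSpace Y] (Λ : Measure Y) [IsProbabilityMeasure Λ] {t : Y → Fin r}
    (ht : Measurable t) :
    MeasurePreserving (fun p : Typ n × ((Fin r → Typ n) × Y) =>
      (Function.update p.2.1 (t p.2.2) p.1, p.2.2))
      (D.prod ((Measure.pi fun _ => D).prod Λ)) ((Measure.pi fun _ => D).prod Λ) := by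
  have e1 : MeasurePreserving (fun p : Typ n × ((Fin r → Typ n) × Y) => (p.2.2, (p.1, p.2.1)))
      (D.prod ((Measure.pi fun _ => D).prod Λ)) (Λ.prod (D.prod (Measure.pi fun _ => D))) :=
    Measure.measurePreserving_swap.comp (measurePreserving_prodAssoc D _ Λ).symm
  have e2 : MeasurePreserving (fun p : Y × (Typ n × (Fin r → Typ n)) =>
      (p.1, Function.update p.2.2 (t p.1) p.2.1)) (Λ.prod (D.prod (Measure.pi fun _ => D)))
      (Λ.prod (Measure.pi fun _ => D)) :=
    MeasurePreserving.skew_product (MeasurePreserving.id Λ)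
      (measurable_update (measurable_fst.comp measurable_snd) (measurable_snd.comp measurable_snd)
        (ht.comp measurable_fst))
      (Filter.Eventually.of_forall fun y => (measurePreserving_update D (t y)).map_eq)
  exact Measure.measurePreserving_swap.comp (e2.comp e1)

/-- For each value of the relabelling the type keeps its law, so the relabelled type is independent
of the relabelling that was used. -/
theorem measurePreserving_relabel {D : Measure (Typ n)} [IsProbabilityMeasure D] {Y : Type*}
    [MeasurableSpace Y] {Λ : Measure Y} [IsProbabilityMeasure Λ] {g : Y → Equiv.Perm (Fin n)}
    (hg : Measurable g) (hD : ∀ᵐ y ∂Λ, D.map (fun v => v ∘ g y) = D) :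
    MeasurePreserving (fun p : Typ n × Y => (p.1 ∘ g p.2, p.2)) (D.prod Λ) (D.prod Λ) := by
  have e2 : MeasurePreserving (fun p : Y × Typ n => (p.1, p.2 ∘ g p.1)) (Λ.prod D) (Λ.prod D) :=
    MeasurePreserving.skew_product (MeasurePreserving.id Λ)
      (measurable_pi_lambda _ fun j => measurable_apply_of_countable
        (f := fun (p : Y × Typ n) j => p.2 j) (fun k => (measurable_pi_apply k).comp measurable_snd)
        (measurable_of_discrete_left (hg.comp measurable_fst) fun σ => σ j)) hD
  exact Measure.measurePreserving_swap.comp (e2.comp Measure.measurePreserving_swap)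

set_option linter.unusedSectionVars false

variable [Fintype G] [MeasurableSpace G] [DiscreteMeasurableSpace G]
  {sym : Bool} {β : ℝ} {Γ : Surrogates n G} {D : Measure (Typ n)} {ν : Measure G}
  {lpos : Measure (Fin r)} {lperm : Measure (Equiv.Perm (Fin n))} [IsProbabilityMeasure D]
  [IsProbabilityMeasure ν] [IsProbabilityMeasure lpos] [IsProbabilityMeasure lperm]

/-- The symmetry that is required of the distributions. -/
structure Symmetric (sym : Bool) (Γ : Surrogates n G) (D : Measure (Typ n)) (ν : Measure G)
    (lpos : Measure (Fin r)) (lperm : Measure (Equiv.Perm (Fin n))) : Prop where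
  types : ∀ g, Grp sym g → D.map (fun v => v ∘ g) = D
  surrogates : ∀ g, Grp sym g → ν.map (fun s => Γ.act s g) = ν
  pos : ∀ σ : Equiv.Perm (Fin r), lpos.map σ = lpos
  perm : ∀ σ, Grp sym σ → lperm.map (fun g => σ * g⁻¹) = lperm
  grp : ∀ᵐ g ∂lperm, Grp sym g

/-- The surrogate type that a bidder receives, as a function of the profile of relabelled replicas. -/
def Surrogates.draft (sym : Bool) (β : ℝ) (Γ : Surrogates n G) (p : Rand r n G) : G :=
  Γ.act (p.2.1 (Γ.col sym β p.1 p.2.1 p.2.2.1))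
    (arr sym (p.1 p.2.2.1) (Γ.phi (p.2.1 (Γ.col sym β p.1 p.2.1 p.2.2.1))) * p.2.2.2⁻¹)

theorem measurable_draft : Measurable (Γ.draft sym β (r := r)) :=
  measurable_act_arr (R := fun p : Rand r n G => p.1) (S := fun p => p.2.1) (τ := fun p => p.2.2.1)
    (g := fun p => p.2.2.2) measurable_snd.snd.snd measurable_fst measurable_snd.fst
    measurable_snd.snd.fst

/-- The matching weights are invariant under relabelling, so inserting `v ∘ g` instead of `v` leaves
the matching unchanged. In the new form `g` occurs only in the factor `g⁻¹`. -/
theorem pick_eq_draft {v : Typ n} {x : Rand r n G} (hx : Grp sym x.2.2.2) :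
    (Γ.pick sym β v x).1 =
      Γ.draft sym β (Function.update x.1 x.2.2.1 (v ∘ x.2.2.2), x.2) := by
  have hcol : Γ.col sym β (Function.update x.1 x.2.2.1 (v ∘ x.2.2.2)) x.2.1 =
      Γ.col sym β (Function.update x.1 x.2.2.1 v) x.2.1 := by
    simp only [Surrogates.col]
    rw [bidMat_comp]
    intro k
    by_cases hk : k = x.2.2.1
    · subst hk; exact ⟨_, hx, by simp⟩
    · exact ⟨1, .one, by simp [hk]⟩
  simp only [Surrogates.pick, Surrogates.give, Surrogates.draft, hcol, Function.update_self]

theorem ae_grp (h : Symmetric sym Γ D ν lpos lperm) :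
    ∀ᵐ x ∂(randLaw r D ν lpos lperm), Grp sym x.2.2.2 :=
  Measure.quasiMeasurePreserving_snd.ae (Measure.quasiMeasurePreserving_snd.ae
    (Measure.quasiMeasurePreserving_snd.ae h.grp))

/-- The relabelled type of a truthful bidder, placed among the replicas, yields a profile with the
law of pure replicas, independent of the position and of the relabelling. -/
theorem lintegral_pick_eq (h : Symmetric sym Γ D ν lpos lperm) (f : G → ℝ≥0∞) :
    ∫⁻ v, ∫⁻ x, f (Γ.pick sym β v x).1 ∂(randLaw r D ν lpos lperm) ∂D =
      ∫⁻ p, f (Γ.draft sym β p) ∂(randLaw r D ν lpos lperm) := by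
  have hf : Measurable f := Measurable.of_discrete
  have m1 := measurePreserving_relabel (D := D) (Λ := randLaw r D ν lpos lperm)
    (g := fun x => x.2.2.2) measurable_snd.snd.snd ((ae_grp h).mono fun x hx => h.types _ hx)
  have m2 := measurePreserving_update_prod (r := r) D
    ((Measure.pi fun _ : Fin r => ν).prod (lpos.prod lperm)) (t := fun y => y.2.1)
    measurable_snd.fst
  have m3 : MeasurePreserving (fun p : Typ n × Rand r n G =>
      ((Function.update p.2.1 p.2.2.2.1 (p.1 ∘ p.2.2.2.2), p.2.2) : Rand r n G))
      (D.prod (randLaw r D ν lpos lperm)) (randLaw r D ν lpos lperm) := m2.comp m1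
  have hmp : Measurable fun p : Typ n × Rand r n G => f (Γ.pick sym β p.1 p.2).1 :=
    hf.comp (measurable_pick measurable_fst measurable_snd).fst
  rw [← lintegral_prod (fun p : Typ n × Rand r n G => f (Γ.pick sym β p.1 p.2).1)
    hmp.aemeasurable, ← m3.lintegral_comp (f := fun p => f (Γ.draft sym β p)) (hf.comp measurable_draft)]
  exact lintegral_congr_ae ((Measure.quasiMeasurePreserving_snd.ae (ae_grp h)).mono
    fun p hp => congrArg f (pick_eq_draft hp))

theorem lintegral_act (h : Symmetric sym Γ D ν lpos lperm) (f : G → ℝ≥0∞) :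
    ∫⁻ s, ∫⁻ g, f (Γ.act s g) ∂lperm ∂ν = ∫⁻ s, f s ∂ν := by
  rw [lintegral_lintegral_swap Measurable.of_discrete.aemeasurable]
  have : ∀ᵐ g ∂lperm, ∫⁻ s, f (Γ.act s g) ∂ν = ∫⁻ s, f s ∂ν := h.grp.mono fun g hg => by
    conv_rhs => rw [← h.surrogates g hg]
    rw [lintegral_map Measurable.of_discrete Measurable.of_discrete]
  rw [lintegral_congr_ae this]
  simp

/-- For fixed replicas and surrogates the arrangement is a fixed left factor and the matching a
fixed permutation of the positions. The invariance of `lperm` absorbs the former and that of `lpos`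
the latter. -/
theorem lintegral_draft_perm (h : Symmetric sym Γ D ν lpos lperm) (f : G → ℝ≥0∞)
    (R : Fin r → Typ n) (S : Fin r → G) :
    ∫⁻ z, f (Γ.draft sym β (R, (S, z))) ∂(lpos.prod lperm) =
      ∫⁻ τ, ∫⁻ g, f (Γ.act (S τ) g) ∂lperm ∂lpos := by
  rw [lintegral_prod (fun z => f (Γ.draft sym β (R, (S, z))))
    ((Measurable.of_discrete (f := f)).comp (measurable_draft.comp
    (measurable_prodMk_left.comp measurable_prodMk_left))).aemeasurable]
  have s2 : ∀ s : G, ∀ σ, Grp sym σ → ∫⁻ g, f (Γ.act s (σ * g⁻¹)) ∂lperm =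
      ∫⁻ g, f (Γ.act s g) ∂lperm := by
    intro s σ hσ
    conv_rhs => rw [← h.perm σ hσ]
    rw [lintegral_map Measurable.of_discrete Measurable.of_discrete]
  simp only [Surrogates.draft]
  simp only [s2 _ _ (grp_arr _ _)]
  conv_rhs => rw [← h.pos (Γ.col sym β R S)]
  rw [lintegral_map Measurable.of_discrete Measurable.of_discrete]

/-- What is left is a surrogate at an independent position, moved by an independent group element,
and `ν` is invariant under the action. -/
theorem lintegral_draft (h : Symmetric sym Γ D ν lpos lperm) (f : G → ℝ≥0∞) :
    ∫⁻ p, f (Γ.draft sym β p) ∂(randLaw r D ν lpos lperm) = ∫⁻ s, f s ∂ν := by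
  have hf : Measurable f := Measurable.of_discrete
  have hR : ∀ R : Fin r → Typ n, Measurable fun y => f (Γ.draft sym β (R, y)) := fun R =>
    hf.comp (measurable_draft.comp measurable_prodMk_left)
  rw [randLaw, lintegral_prod (fun p => f (Γ.draft sym β p)) (hf.comp measurable_draft).aemeasurable]
  have s4 : ∀ R : Fin r → Typ n, ∫⁻ y, f (Γ.draft sym β (R, y))
      ∂((Measure.pi fun _ : Fin r => ν).prod (lpos.prod lperm)) = ∫⁻ s, f s ∂ν := by
    intro R
    rw [lintegral_prod _ (hR R).aemeasurable]
    simp only [lintegral_draft_perm h]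
    rw [lintegral_lintegral_swap Measurable.of_discrete.aemeasurable]
    have : ∀ τ : Fin r, ∫⁻ S, ∫⁻ g, f (Γ.act (S τ) g) ∂lperm ∂(Measure.pi fun _ : Fin r => ν) =
        ∫⁻ s, f s ∂ν := by
      intro τ
      rw [← lintegral_act h, ← (measurePreserving_eval (fun _ : Fin r => ν) τ).lintegral_comp
        Measurable.of_discrete]
    simp [this]
  simp [s4]

/-- The surrogate of a truthful bidder is distributed as the surrogate types. -/
theorem lintegral_pick (h : Symmetric sym Γ D ν lpos lperm) (f : G → ℝ≥0∞) :
    ∫⁻ v, ∫⁻ x, f (Γ.pick sym β v x).1 ∂(randLaw r D ν lpos lperm) ∂D = ∫⁻ s, f s ∂ν :=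
  (lintegral_pick_eq h f).trans (lintegral_draft h f)

end Law


/-! ### The interim outcome of one bidder -/

section Interim

open scoped ENNReal

set_option linter.unusedSectionVars false

variable {n r : ℕ} {G : Type} [Fintype G] [MeasurableSpace G] [DiscreteMeasurableSpace G]
  {sym : Bool} {β : ℝ} {Γ : Surrogates n G} {D : Measure (Typ n)} {ν : Measure G}
  {lpos : Measure (Fin r)} {lperm : Measure (Equiv.Perm (Fin n))} [IsProbabilityMeasure D]
  [IsProbabilityMeasure ν] [IsProbabilityMeasure lpos] [IsProbabilityMeasure lperm]

/-! #### Bounds -/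

/-- A bound for the bids of types in the cube. -/
def Surrogates.bidBound (β : ℝ) (Γ : Surrogates n G) : ℝ :=
  ∑ s, (∑ j, |Γ.phi s j| + |β * Γ.price s|)

theorem Surrogates.le_bidBound (s : G) :
    ∑ j, |Γ.phi s j| + |β * Γ.price s| ≤ Γ.bidBound β :=
  Finset.single_le_sum (f := fun s => ∑ j, |Γ.phi s j| + |β * Γ.price s|)
    (fun s _ => by positivity) (Finset.mem_univ s)

theorem Surrogates.bidBound_nonneg : 0 ≤ Γ.bidBound β := by
  unfold Surrogates.bidBound; positivity

theorem sum_mul_le_of_cube {v : Typ n} (hv : v ∈ cube n) (p : Typ n) (g : Equiv.Perm (Fin n)) :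
    ∑ j, v j * p (g j) ≤ ∑ j, |p j| := by
  rw [← Equiv.sum_comp g fun j => |p j|]
  refine Finset.sum_le_sum fun j _ => ?_
  calc v j * p (g j) ≤ v j * |p (g j)| := mul_le_mul_of_nonneg_left (le_abs_self _) (hv j).1
    _ ≤ |p (g j)| := mul_le_of_le_one_left (abs_nonneg _) (hv j).2

theorem bidMat_le {R : Fin r → Typ n} (hR : ∀ k, R k ∈ cube n) (S : Fin r → G) (k l : Fin r) :
    bidMat sym β R (fun k => Γ.phi (S k)) (fun k => Γ.price (S k)) k l ≤ Γ.bidBound β := by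
  refine max_le Γ.bidBound_nonneg ?_
  have h1 := sum_mul_le_of_cube (hR k) (Γ.phi (S l)) (arr sym (R k) (Γ.phi (S l)))
  have h2 := Γ.le_bidBound (β := β) (S l)
  have h3 := neg_abs_le (β * Γ.price (S l))
  simp only [wt, arrVal]
  linarith

/-- There are finitely many surrogate types, so prices and bids are bounded uniformly; this supplies
integrability throughout. -/
theorem abs_charge_le {R : Fin r → Typ n} (hR : ∀ k, R k ∈ cube n) (S : Fin r → G) (τ : Fin r) :
    |charge sym β R (fun k => Γ.phi (S k)) (fun k => Γ.price (S k)) τ| ≤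
      (r + 1) * Γ.bidBound β := by
  set A := bidMat sym β R (fun k => Γ.phi (S k)) (fun k => Γ.price (S k)) with hA
  have hz : ∀ k l, 0 ≤ zeroRow A τ k l ∧ zeroRow A τ k l ≤ Γ.bidBound β := fun k l => by
    unfold zeroRow
    split
    · exact ⟨le_rfl, Γ.bidBound_nonneg⟩
    · exact ⟨le_max_left _ _, bidMat_le hR S k l⟩
  have h1 : ∀ σ : Equiv.Perm (Fin r), 0 ≤ ∑ k, zeroRow A τ k (σ k) ∧
      ∑ k, zeroRow A τ k (σ k) ≤ r * Γ.bidBound β := fun σ =>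
    ⟨Finset.sum_nonneg fun k _ => (hz _ _).1, by
      simpa using Finset.sum_le_sum fun k (_ : k ∈ Finset.univ) => (hz k (σ k)).2⟩
  have h2 : |externality A τ| ≤ r * Γ.bidBound β := by
    rw [abs_of_nonneg (externality_nonneg _ _)]
    have := (h1 (solve (zeroRow A τ))).2
    have := (h1 (solve A)).1
    simp only [externality]
    linarith
  rw [charge, add_mul, one_mul]
  refine (abs_add_le _ _).trans (add_le_add h2 ?_)
  split
  · refine le_trans ?_ (Γ.le_bidBound (β := β) (S (solve A τ)))
    have : 0 ≤ ∑ j, |Γ.phi (S (solve A τ)) j| := by positivity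
    linarith
  · simpa using Γ.bidBound_nonneg

theorem ae_forall_pi {X : Type*} [MeasurableSpace X] {μ : Measure X} [IsProbabilityMeasure μ]
    {p : X → Prop} (h : ∀ᵐ x ∂μ, p x) (r : ℕ) :
    ∀ᵐ R ∂(Measure.pi fun _ : Fin r => μ), ∀ k, p (R k) :=
  ae_all_iff.2 fun k => (Measure.quasiMeasurePreserving_eval (fun _ => μ) k).ae h

theorem ae_types_mem_cube (hD : ∀ᵐ v ∂D, v ∈ cube n) :
    ∀ᵐ x ∂(randLaw r D ν lpos lperm), ∀ k, x.1 k ∈ cube n :=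
  Measure.quasiMeasurePreserving_fst.ae (ae_forall_pi hD r)

theorem update_mem_cube {R : Fin r → Typ n} (hR : ∀ k, R k ∈ cube n) {v : Typ n} (hv : v ∈ cube n)
    (τ k : Fin r) : Function.update R τ v k ∈ cube n := by
  by_cases hk : k = τ
  · subst hk; simpa using hv
  · simpa [hk] using hR k

theorem ae_abs_pay_le (hD : ∀ᵐ v ∂D, v ∈ cube n) {v : Typ n} (hv : v ∈ cube n) :
    ∀ᵐ x ∂(randLaw r D ν lpos lperm), |Γ.pay sym β v x| ≤ (r + 1) * Γ.bidBound β :=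
  (ae_types_mem_cube hD).mono fun _ hx => abs_charge_le (update_mem_cube hx hv _) _ _

theorem integrable_pay (hD : ∀ᵐ v ∂D, v ∈ cube n) {v : Typ n} (hv : v ∈ cube n) :
    Integrable (Γ.pay sym β v) (randLaw r D ν lpos lperm) :=
  .of_bound (measurable_pay measurable_const measurable_id).aestronglyMeasurable _
    (ae_abs_pay_le hD hv)

/-! #### The interim outcome -/

variable (sym β Γ D ν lpos lperm)

/-- The expected price of a bidder of type `v`. -/
def Surrogates.expPay (v : Typ n) : ℝ := ∫ x, Γ.pay sym β v x ∂(randLaw r D ν lpos lperm)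

/-- The expectation of `h`, over the surrogate outcomes that a bidder of type `v` buys. -/
def Surrogates.expBuy (h : G → ℝ) (v : Typ n) : ℝ :=
  ∫ x, (if (Γ.pick sym β v x).2 then h (Γ.pick sym β v x).1 else 0) ∂(randLaw r D ν lpos lperm)

variable {sym β Γ D ν lpos lperm}

theorem integrable_buy (h : G → ℝ) (v : Typ n) :
    Integrable (fun x => if (Γ.pick sym β v x).2 then h (Γ.pick sym β v x).1 else 0)
      (randLaw r D ν lpos lperm) := by
  refine .of_bound (Measurable.aestronglyMeasurable ?_) (∑ s, |h s|)
    (Filter.Eventually.of_forall fun x => ?_)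
  · exact measurable_of_discrete_left (measurable_pick measurable_const measurable_id)
      fun p : G × Bool => if p.2 then h p.1 else 0
  · split
    · exact Finset.single_le_sum (f := fun s => |h s|) (fun s _ => abs_nonneg _)
        (Finset.mem_univ _)
    · simp only [norm_zero]; positivity

open Classical in
theorem ite_pick (v : Typ n) (x : Rand r n G) (a b : ℝ) :
    (if (Γ.pick sym β v x).2 then a else b) = if Buys sym β (Function.update x.1 x.2.2.1 v)
      (fun k => Γ.phi (x.2.1 k)) (fun k => Γ.price (x.2.1 k)) x.2.2.1 then a else b := by
  by_cases h : Γ.Sold sym β (Function.update x.1 x.2.2.1 v) x.2.1 x.2.2.1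
  · rw [if_pos (by simpa [Surrogates.pick] using h)]
    exact (if_pos h).symm
  · rw [if_neg (by simpa [Surrogates.pick] using h)]
    exact (if_neg h).symm

theorem pick_value_eq (hc : Γ.Compatible sym) (u v : Typ n) {x : Rand r n G}
    (hx : Grp sym x.2.2.2) :
    ∑ j, u j * Γ.phi (Γ.pick sym β v x).1 j =
      ∑ j, u j * Γ.phi (x.2.1 (Γ.col sym β (Function.update x.1 x.2.2.1 v) x.2.1 x.2.2.1))
        ((arr sym (v ∘ x.2.2.2)
          (Γ.phi (x.2.1 (Γ.col sym β (Function.update x.1 x.2.2.1 v) x.2.1 x.2.2.1))) *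
            x.2.2.2⁻¹) j) := by
  simp only [Surrogates.pick, Surrogates.give, Function.update_self]
  rw [hc.phi _ _ ((grp_arr _ _).mul hx.inv)]
  rfl

theorem pick_value_self (hc : Γ.Compatible sym) (v : Typ n) {x : Rand r n G}
    (hx : Grp sym x.2.2.2) :
    ∑ j, v j * Γ.phi (Γ.pick sym β v x).1 j =
      arrVal sym v (Γ.phi (x.2.1 (Γ.col sym β (Function.update x.1 x.2.2.1 v) x.2.1 x.2.2.1))) := by
  rw [pick_value_eq hc v v hx, ← sum_comp_left, ← arrVal_comp_left hx]
  rfl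

/-- The arrangement chosen for the false report is merely one element of the group, and `truthful`
allows any of them. -/
theorem pick_truthful (hc : Γ.Compatible sym) (v w : Typ n) {x : Rand r n G}
    (hx : Grp sym x.2.2.2) :
    (if (Γ.pick sym β w x).2 then ∑ j, v j * Γ.phi (Γ.pick sym β w x).1 j else 0) -
      Γ.pay sym β w x ≤
    (if (Γ.pick sym β v x).2 then ∑ j, v j * Γ.phi (Γ.pick sym β v x).1 j else 0) -
      Γ.pay sym β v x := by
  rw [pick_value_eq hc v w hx, pick_value_self hc v hx]
  have := truthful sym β (R := Function.update x.1 x.2.2.1 v)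
    (R' := Function.update x.1 x.2.2.1 w) (p := fun k => Γ.phi (x.2.1 k))
    (q := fun k => Γ.price (x.2.1 k)) (τ := x.2.2.1) (fun k hk => by simp [hk])
    (g := arr sym (w ∘ x.2.2.2)
          (Γ.phi (x.2.1 (Γ.col sym β (Function.update x.1 x.2.2.1 w) x.2.1 x.2.2.1))) *
            x.2.2.2⁻¹) ((grp_arr _ _).mul hx.inv)
  simp only [Function.update_self] at this
  rw [ite_pick, ite_pick]
  exact this

theorem pay_le (hc : Γ.Compatible sym) (v : Typ n) {x : Rand r n G} (hx : Grp sym x.2.2.2) :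
    Γ.pay sym β v x ≤
      (if (Γ.pick sym β v x).2 then ∑ j, v j * Γ.phi (Γ.pick sym β v x).1 j else 0) := by
  rw [pick_value_self hc v hx]
  have := charge_le sym β (R := Function.update x.1 x.2.2.1 v) (p := fun k => Γ.phi (x.2.1 k))
    (q := fun k => Γ.price (x.2.1 k)) (τ := x.2.2.1)
  simp only [Function.update_self] at this
  rw [ite_pick]
  exact this

theorem sum_expBuy (u v : Typ n) :
    ∑ j, u j * Γ.expBuy sym β D ν lpos lperm (fun s => Γ.phi s j) v =
      ∫ x, (if (Γ.pick sym β v x).2 then ∑ j, u j * Γ.phi (Γ.pick sym β v x).1 j else 0)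
        ∂(randLaw r D ν lpos lperm) := by
  simp only [Surrogates.expBuy, ← integral_const_mul]
  rw [← integral_finsetSum _ fun j _ => (integrable_buy (fun s => Γ.phi s j) v).const_mul (u j)]
  refine integral_congr_ae (Filter.Eventually.of_forall fun x => ?_)
  simp only
  split <;> simp

/-- Truthful reporting is optimal in expectation. -/
theorem expBuy_truthful (h : Symmetric sym Γ D ν lpos lperm) (hc : Γ.Compatible sym)
    (hD : ∀ᵐ v ∂D, v ∈ cube n) {v w : Typ n} (hv : v ∈ cube n) (hw : w ∈ cube n) :
    ∑ j, v j * Γ.expBuy sym β D ν lpos lperm (fun s => Γ.phi s j) w -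
        Γ.expPay sym β D ν lpos lperm w ≤
      ∑ j, v j * Γ.expBuy sym β D ν lpos lperm (fun s => Γ.phi s j) v -
        Γ.expPay sym β D ν lpos lperm v := by
  have hi : ∀ w, Integrable (fun x => if (Γ.pick sym β w x).2 then
      ∑ j, v j * Γ.phi (Γ.pick sym β w x).1 j else 0) (randLaw r D ν lpos lperm) := fun w =>
    integrable_buy (fun s => ∑ j, v j * Γ.phi s j) w
  rw [sum_expBuy, sum_expBuy, Surrogates.expPay, Surrogates.expPay,
    ← integral_sub (hi w) (integrable_pay hD hw), ← integral_sub (hi v) (integrable_pay hD hv)]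
  exact integral_mono_ae ((hi w).sub (integrable_pay hD hw)) ((hi v).sub (integrable_pay hD hv))
    ((ae_grp h).mono fun x hx => pick_truthful hc v w hx)

/-- Truthful bidders do not lose in expectation. -/
theorem expPay_le (h : Symmetric sym Γ D ν lpos lperm) (hc : Γ.Compatible sym)
    (hD : ∀ᵐ v ∂D, v ∈ cube n) {v : Typ n} (hv : v ∈ cube n) :
    Γ.expPay sym β D ν lpos lperm v ≤
      ∑ j, v j * Γ.expBuy sym β D ν lpos lperm (fun s => Γ.phi s j) v := by
  rw [sum_expBuy]
  exact integral_mono_ae (integrable_pay hD hv) (integrable_buy (fun s => ∑ j, v j * Γ.phi s j) v)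
    ((ae_grp h).mono fun x hx => pay_le hc v hx)

/-! #### The expected price -/

/-- The number of indices in a class is close to its expectation. -/
theorem integral_abs_cnt_sub_le {X K : Type*} [MeasurableSpace X] {μ : Measure X}
    [IsProbabilityMeasure μ] {f : X → K} {c : K} (hf : MeasurableSet (f ⁻¹' {c})) {a : ℝ}
    (ha : 0 < a) :
    Integrable (fun V : Fin r → X => |cnt (fun k => f (V k)) c - r * μ.real (f ⁻¹' {c})|)
      (Measure.pi fun _ => μ) ∧
    ∫ V : Fin r → X, |cnt (fun k => f (V k)) c - r * μ.real (f ⁻¹' {c})|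
      ∂(Measure.pi fun _ => μ) ≤ r * μ.real (f ⁻¹' {c}) / (2 * a) + a / 2 := by
  classical
  set p := μ.real (f ⁻¹' {c}) with hp
  set Y : X → ℝ := (f ⁻¹' {c}).indicator 1 with hY
  have hYm : Measurable Y := measurable_one.indicator hf
  have hYb : ∀ x, ‖Y x‖ ≤ 1 := fun x => by
    simp only [hY, Set.indicator]; split <;> simp
  have hY2 : MemLp Y 2 μ := .of_bound hYm.aestronglyMeasurable 1 (.of_forall hYb)
  have hYint : ∫ x, Y x ∂μ = p := by
    simp [hY, integral_indicator_one hf, hp]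
  set Z : (Fin r → X) → ℝ := ∑ k, fun V => Y (V k) with hZ
  have hZc : ∀ V, cnt (fun k => f (V k)) c = Z V := fun V => by
    simp [hZ, cnt, hY, Set.indicator_apply]
  have hZ2 : MemLp Z 2 (Measure.pi fun _ : Fin r => μ) :=
    memLp_finsetSum' _ fun k _ => hY2.comp_measurePreserving (measurePreserving_eval _ k)
  have hZint : ∫ V, Z V ∂(Measure.pi fun _ : Fin r => μ) = r * p := by
    simp only [hZ, Finset.sum_apply]
    have hi : ∀ k : Fin r, Integrable (fun V : Fin r → X => Y (V k)) (Measure.pi fun _ => μ) :=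
      fun k => (hY2.comp_measurePreserving
        (measurePreserving_eval (fun _ : Fin r => μ) k)).integrable (by norm_num)
    rw [integral_finsetSum _ fun k _ => hi k]
    simp [integral_comp_eval (μ := fun _ : Fin r => μ) hYm.aestronglyMeasurable, hYint]
  -- The count is a sum of `r` independent indicators, each of variance at most `p`.
  have hvar : ∫ V, (Z V - r * p) ^ 2 ∂(Measure.pi fun _ : Fin r => μ) ≤ r * p := by
    have h1 := ProbabilityTheory.variance_eq_integral (μ := Measure.pi fun _ : Fin r => μ)
      hZ2.aemeasurable
    rw [hZint] at h1
    rw [← h1, hZ, ProbabilityTheory.variance_sum_pi (μ := fun _ : Fin r => μ) (X := fun _ => Y)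
      fun _ => hY2]
    have h2 : ProbabilityTheory.variance Y μ ≤ p := by
      refine (ProbabilityTheory.variance_le_expectation_sq hYm.aestronglyMeasurable).trans ?_
      rw [← hYint]
      refine le_of_eq (integral_congr_ae (.of_forall fun x => ?_))
      simp only [hY, Set.indicator, Pi.pow_apply]
      split <;> simp
    simpa using mul_le_mul_of_nonneg_left h2 (Nat.cast_nonneg r)
  have hsub : MemLp (fun V => Z V - r * p) 2 (Measure.pi fun _ : Fin r => μ) :=
    hZ2.sub (memLp_const _)
  simp only [hZc]
  refine ⟨(hsub.integrable (by norm_num)).abs, ?_⟩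
  -- This elementary inequality replaces Cauchy–Schwarz. It is linear in `p`, so the class
  -- probabilities later sum to one, and `a` remains free for balancing.
  have hb : ∀ V, |Z V - r * p| ≤ (Z V - r * p) ^ 2 / (2 * a) + a / 2 := fun V => by
    rw [← sq_abs (Z V - r * p)]
    set y := |Z V - r * p|
    have : y ^ 2 / (2 * a) + a / 2 - y = (y - a) ^ 2 / (2 * a) := by field_simp; ring
    have : 0 ≤ (y - a) ^ 2 / (2 * a) := by positivity
    linarith
  have hsq := hsub.integrable_sq
  refine (integral_mono (hsub.integrable (by norm_num)).abs
    ((hsq.div_const _).add (integrable_const _)) hb).trans ?_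
  simp only [Pi.add_apply]
  rw [integral_add (hsq.div_const _) (integrable_const _), integral_div]
  simp only [integral_const, probReal_univ, one_smul]
  gcongr

end Interim


/-! ### The expected price of one bidder -/

section Revenue

set_option linter.unusedSectionVars false

variable {n r : ℕ} {G : Type} [Fintype G] [MeasurableSpace G] [DiscreteMeasurableSpace G]
  {sym : Bool} {β : ℝ} {Γ : Surrogates n G} {D : Measure (Typ n)} {ν : Measure G}
  {lpos : Measure (Fin r)} {lperm : Measure (Equiv.Perm (Fin n))} [IsProbabilityMeasure D]
  [IsProbabilityMeasure ν] [IsProbabilityMeasure lpos] [IsProbabilityMeasure lperm]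

theorem integral_comp_of_measurePreserving {X Y : Type*} [MeasurableSpace X] [MeasurableSpace Y]
    {μ : Measure X} {ρ : Measure Y} {g : X → Y} (hg : MeasurePreserving g μ ρ) {f : Y → ℝ}
    (hf : Measurable f) : ∫ x, f (g x) ∂μ = ∫ y, f y ∂ρ := by
  rw [← hg.map_eq, integral_map hg.measurable.aemeasurable hf.aestronglyMeasurable]

/-- The price for which replica `τ` buys, not discounted. -/
def Surrogates.sale (sym : Bool) (β : ℝ) (Γ : Surrogates n G)
    (y : Fin r × ((Fin r → Typ n) × (Fin r → G))) : ℝ :=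
  open Classical in
  if Γ.Sold sym β y.2.1 y.2.2 y.1 then Γ.price (y.2.2 (Γ.col sym β y.2.1 y.2.2 y.1)) else 0

theorem measurable_sale : Measurable (Γ.sale sym β (r := r)) := by
  classical
  refine Measurable.ite (measurableSet_sold (R := fun y : Fin r × ((Fin r → Typ n) × (Fin r → G)) =>
    y.2.1) (S := fun y => y.2.2) (τ := fun y => y.1) measurable_snd.fst measurable_snd.snd
    measurable_fst) ?_ measurable_const
  exact measurable_of_discrete_left (measurable_surr (R := fun y : Fin r × ((Fin r → Typ n) ×
    (Fin r → G)) => y.2.1) (S := fun y => y.2.2) (τ := fun y => y.1) measurable_snd.fst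
    measurable_snd.snd measurable_fst) Γ.price

theorem abs_sale_le (y : Fin r × ((Fin r → Typ n) × (Fin r → G))) :
    |Γ.sale sym β y| ≤ ∑ s, |Γ.price s| := by
  unfold Surrogates.sale
  split
  · exact Finset.single_le_sum (f := fun s => |Γ.price s|) (fun s _ => abs_nonneg _)
      (Finset.mem_univ _)
  · simp only [abs_zero]; positivity

theorem integrable_sale {X : Type*} [MeasurableSpace X] {μ : Measure X} [IsFiniteMeasure μ]
    {g : X → Fin r × ((Fin r → Typ n) × (Fin r → G))} (hg : Measurable g) :
    Integrable (fun x => Γ.sale sym β (g x)) μ :=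
  .of_bound (measurable_sale.comp hg).aestronglyMeasurable _ (.of_forall fun _ => abs_sale_le _)

/-- The price that is charged, as a function of the profile of replicas. -/
def Surrogates.bill (sym : Bool) (β : ℝ) (Γ : Surrogates n G) (x : Rand r n G) : ℝ :=
  charge sym β x.1 (fun k => Γ.phi (x.2.1 k)) (fun k => Γ.price (x.2.1 k)) x.2.2.1

theorem measurable_bill : Measurable (Γ.bill sym β (r := r)) :=
  measurable_charge (R := fun x : Rand r n G => x.1) (S := fun x => x.2.1) (τ := fun x => x.2.2.1)
    measurable_fst measurable_snd.fst measurable_snd.snd.fst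

theorem integrable_bill (hD : ∀ᵐ v ∂D, v ∈ cube n) :
    Integrable (Γ.bill sym β) (randLaw r D ν lpos lperm) :=
  .of_bound measurable_bill.aestronglyMeasurable _
    ((ae_types_mem_cube hD).mono fun _ hx => abs_charge_le hx _ _)

theorem measurePreserving_bidder (τm : Measurable fun y : (Fin r → G) × (Fin r ×
      Equiv.Perm (Fin n)) => y.2.1) :
    MeasurePreserving (fun p : Typ n × Rand r n G =>
      ((Function.update p.2.1 p.2.2.2.1 p.1, p.2.2) : Rand r n G))
      (D.prod (randLaw r D ν lpos lperm)) (randLaw r D ν lpos lperm) :=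
  measurePreserving_update_prod (r := r) D
    ((Measure.pi fun _ : Fin r => ν).prod (lpos.prod lperm)) (t := fun y => y.2.1) τm

theorem integrable_pay_prod (hD : ∀ᵐ v ∂D, v ∈ cube n) :
    Integrable (fun p : Typ n × Rand r n G => Γ.pay sym β p.1 p.2)
      (D.prod (randLaw r D ν lpos lperm)) :=
  (measurePreserving_bidder measurable_snd.fst).integrable_comp_of_integrable
    (integrable_bill (Γ := Γ) (sym := sym) (β := β) hD)

theorem integrable_expPay (hD : ∀ᵐ v ∂D, v ∈ cube n) :
    Integrable (Γ.expPay sym β D ν lpos lperm) D :=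
  (integrable_pay_prod hD).integral_prod_left

theorem integral_expPay (hD : ∀ᵐ v ∂D, v ∈ cube n) :
    ∫ v, Γ.expPay sym β D ν lpos lperm v ∂D =
      ∫ x, Γ.bill sym β x ∂(randLaw r D ν lpos lperm) := by
  rw [← integral_comp_of_measurePreserving (measurePreserving_bidder measurable_snd.fst)
    measurable_bill]
  exact (integral_prod _ (integrable_pay_prod hD)).symm

/-- Externalities are nonnegative, so a bill is at least the discounted price of a sale. -/
theorem le_bill (x : Rand r n G) :
    β * Γ.sale sym β (x.2.2.1, (x.1, x.2.1)) ≤ Γ.bill sym β x := by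
  have h := externality_nonneg (bidMat sym β x.1 (fun k => Γ.phi (x.2.1 k))
    (fun k => Γ.price (x.2.1 k))) x.2.2.1
  unfold Surrogates.bill Surrogates.sale charge Surrogates.Sold Surrogates.col
  split <;> simp_all

theorem measurePreserving_forget :
    MeasurePreserving (fun x : Rand r n G => (x.2.2.1, (x.1, x.2.1)))
      (randLaw r D ν lpos lperm)
      (lpos.prod ((Measure.pi fun _ => D).prod (Measure.pi fun _ => ν))) := by
  have e1 := (measurePreserving_prodAssoc (Measure.pi fun _ : Fin r => D)
    (Measure.pi fun _ : Fin r => ν) (lpos.prod lperm)).symm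
  have e2 := Measure.measurePreserving_swap (μ := (Measure.pi fun _ : Fin r => D).prod
    (Measure.pi fun _ : Fin r => ν)) (ν := lpos.prod lperm)
  have e3 := (measurePreserving_fst (μ := lpos) (ν := lperm)).prod (MeasurePreserving.id
    ((Measure.pi fun _ : Fin r => D).prod (Measure.pi fun _ : Fin r => ν)))
  exact e3.comp (e2.comp e1)

/-- Invariance under transpositions already forces the position to be uniform. -/
theorem real_pos_eq (h : Symmetric sym Γ D ν lpos lperm) (τ : Fin r) :
    lpos.real {τ} = (r : ℝ)⁻¹ := by
  have h1 : ∀ k, lpos.real {k} = lpos.real {τ} := fun k => by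
    have := congrArg (fun μ => μ.real {k}) (h.pos (Equiv.swap τ k))
    simp only [measureReal_def] at this ⊢
    rw [← this, Measure.map_apply Measurable.of_discrete (measurableSet_singleton _)]
    congr 2
    ext x
    simp [Equiv.swap_apply_eq_iff]
  have h2 : ∑ k, lpos.real {k} = 1 := by
    rw [sum_measureReal_singleton]; simp
  have hr : (r : ℝ) ≠ 0 := by
    have := τ.pos
    positivity
  simp only [h1, Finset.sum_const, Finset.card_univ, Fintype.card_fin, nsmul_eq_mul] at h2
  field_simp
  linarith

/-- The uniform position turns the sale to one bidder into the average over all replicas, to which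
the bound for a whole matching applies. -/
theorem integral_sale (h : Symmetric sym Γ D ν lpos lperm) :
    ∫ x : Rand r n G, Γ.sale sym β (x.2.2.1, (x.1, x.2.1)) ∂(randLaw r D ν lpos lperm) =
      (r : ℝ)⁻¹ * ∫ y, ∑ τ, Γ.sale sym β (τ, y)
        ∂((Measure.pi fun _ : Fin r => D).prod (Measure.pi fun _ : Fin r => ν)) := by
  rw [integral_comp_of_measurePreserving measurePreserving_forget measurable_sale,
    integral_prod (Γ.sale sym β) (integrable_sale measurable_id), integral_fintype .of_finite,
    integral_finsetSum _ fun τ _ => integrable_sale (g := fun y => (τ, y)) measurable_prodMk_left]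
  simp only [real_pos_eq h, smul_eq_mul, Finset.mul_sum]

theorem integral_sum_eval (f : G → ℝ) :
    ∫ S : Fin r → G, ∑ k, f (S k) ∂(Measure.pi fun _ => ν) = r * ∫ s, f s ∂ν := by
  rw [integral_finsetSum _ fun k _ => .of_finite]
  simp [integral_comp_eval (μ := fun _ : Fin r => ν) (f := f)
    Measurable.of_discrete.aestronglyMeasurable]

-- Here `m c` stands for the expected size of a class. Passing through it separates the surrogates
-- `S` from the discretised replicas `V`, and each side can be integrated under its own law.
open Classical in
theorem sum_sale_le {ε δ T : ℝ} {K : Type*} [Fintype K] (hc : Γ.Compatible sym)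
    (ha : Γ.Admissible ε T) (hT : 0 ≤ T) (hε : 0 ≤ ε) (hδ : 0 ≤ δ) (cls : G → K)
    (hcls : ∀ s t, cls s = cls t → ∃ g, Grp sym g ∧ Γ.act s g = t)
    (R : Fin r → Typ n) (V S : Fin r → G)
    (hRV : ∀ k j, Γ.val (V k) j ≤ R k j ∧ R k j ≤ Γ.val (V k) j + δ) (m : K → ℝ) :
    (∑ k, (Γ.util (S k) + (1 - β) * Γ.price (S k) - (ε + δ) * Γ.items (S k)) -
        T / 2 * ∑ c, |cnt (fun k => cls (S k)) c - m c|) -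
      (∑ k, Γ.util (V k) + T / 2 * ∑ c, |cnt (fun k => cls (V k)) c - m c|) ≤
      (1 - β) * ∑ τ, Γ.sale sym β (τ, (R, S)) := by
  have h1 := Surrogates.sum_price_le (β := β) hc ha hε hδ cls hcls R V S hRV
  have h2 : ∑ c, |cnt (fun k => cls (V k)) c - cnt (fun k => cls (S k)) c| ≤
      ∑ c, |cnt (fun k => cls (V k)) c - m c| + ∑ c, |cnt (fun k => cls (S k)) c - m c| := by
    rw [← Finset.sum_add_distrib]
    refine Finset.sum_le_sum fun c _ => ?_
    rw [abs_sub_comm (cnt (fun k => cls (S k)) c)]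
    exact abs_sub_le _ _ _
  have h3 := mul_le_mul_of_nonneg_left h2 (half_pos (zero_lt_one' ℝ)).le
  have h4 := mul_le_mul_of_nonneg_left h3 hT
  simp only [Finset.sum_add_distrib, Finset.sum_sub_distrib, ← Finset.mul_sum]
  have h5 : ∑ τ, Γ.sale sym β (τ, (R, S)) = ∑ k,
        if Buys sym β R (fun k => Γ.phi (S k)) (fun k => Γ.price (S k)) k then
          Γ.price (S (solve (bidMat sym β R (fun k => Γ.phi (S k)) (fun k => Γ.price (S k))) k))
        else 0 := rfl
  rw [h5]
  linarith

/-- The pairs of replica and discretised replica are drawn from the coupling, independently of the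
surrogates. As `V` and `S` have equal laws, their expected utilities cancel. -/
theorem integral_sum_sale_ge {ε δ T a : ℝ} {K : Type*} [Fintype K] (hc : Γ.Compatible sym)
    (ha : Γ.Admissible ε T) (hT : 0 ≤ T) (hε : 0 ≤ ε) (hδ : 0 ≤ δ) (cls : G → K)
    (hcls : ∀ s t, cls s = cls t → ∃ g, Grp sym g ∧ Γ.act s g = t)
    {γ : Measure (Typ n × G)} [IsProbabilityMeasure γ] (hγD : γ.map Prod.fst = D)
    (hγν : γ.map Prod.snd = ν)
    (hγ : ∀ᵐ p ∂γ, ∀ j, Γ.val p.2 j ≤ p.1 j ∧ p.1 j ≤ Γ.val p.2 j + δ)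
    (ha0 : 0 < a) (hra : Fintype.card K * a ^ 2 ≤ r) :
    r * ((1 - β) * ∫ s, Γ.price s ∂ν - (ε + δ) * ∫ s, Γ.items s ∂ν - T / a) ≤
      (1 - β) * ∫ y, ∑ τ, Γ.sale sym β (τ, y)
        ∂((Measure.pi fun _ : Fin r => D).prod (Measure.pi fun _ : Fin r => ν)) := by
  set νr : Measure (Fin r → G) := Measure.pi fun _ => ν with hνr
  set m : K → ℝ := fun c => r * ν.real (cls ⁻¹' {c}) with hm
  let X : (Fin r → G) → ℝ := fun S => ∑ c, |cnt (fun k => cls (S k)) c - m c|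
  have hXi : Integrable X νr := .of_finite
  -- Summing over classes gives `r / (2a)` from the probabilities and `card K * a / 2` from the
  -- constants; the latter is at most `r / (2a)` by the choice of `r`.
  have hX : ∫ S, X S ∂νr ≤ r / a := by
    rw [integral_finsetSum _ fun c _ => .of_finite]
    have h1 := Finset.sum_le_sum fun c (_ : c ∈ Finset.univ) =>
      (integral_abs_cnt_sub_le (r := r) (μ := ν) (f := cls) (c := c) (.of_discrete) ha0).2
    refine h1.trans ?_
    have h2 : ∑ c, ν.real (cls ⁻¹' {c}) = 1 := by
      have := sum_measureReal_preimage_singleton (μ := ν) (f := cls) Finset.univ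
        (fun _ _ => .of_discrete)
      simpa using this
    rw [Finset.sum_add_distrib, ← Finset.sum_div, ← Finset.mul_sum, h2]
    simp only [Finset.sum_const, Finset.card_univ, nsmul_eq_mul, mul_one]
    have h3 : (Fintype.card K : ℝ) * (a / 2) ≤ r / (2 * a) := by
      rw [le_div_iff₀ (by positivity)]
      nlinarith
    have h4 : (r : ℝ) / a = r / (2 * a) + r / (2 * a) := by field_simp; ring
    linarith
  let f1 : G → ℝ := fun s => Γ.util s + (1 - β) * Γ.price s - (ε + δ) * Γ.items s
  let h1 : (Fin r → G) → ℝ := fun S => ∑ k, f1 (S k) - T / 2 * X S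
  let h2 : (Fin r → G) → ℝ := fun V => ∑ k, Γ.util (V k) + T / 2 * X V
  have i1 : ∫ S, h1 S ∂νr = r * ∫ s, f1 s ∂ν - T / 2 * ∫ S, X S ∂νr := by
    rw [integral_sub .of_finite (hXi.const_mul _), integral_sum_eval, integral_const_mul]
  have i2 : ∫ S, h2 S ∂νr = r * ∫ s, Γ.util s ∂ν + T / 2 * ∫ S, X S ∂νr := by
    rw [integral_add .of_finite (hXi.const_mul _), integral_sum_eval, integral_const_mul]
  have i3 : ∫ s, f1 s ∂ν = ∫ s, Γ.util s ∂ν + (1 - β) * ∫ s, Γ.price s ∂ν -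
      (ε + δ) * ∫ s, Γ.items s ∂ν := by
    rw [integral_sub .of_finite .of_finite, integral_add .of_finite .of_finite,
      integral_const_mul, integral_const_mul]
  have p1 : MeasurePreserving (fun (z : Fin r → Typ n × G) k => (z k).1)
      (Measure.pi fun _ => γ) (Measure.pi fun _ => D) :=
    measurePreserving_pi _ _ fun _ => ⟨measurable_fst, hγD⟩
  have p2 : MeasurePreserving (fun (z : Fin r → Typ n × G) k => (z k).2)
      (Measure.pi fun _ => γ) νr :=
    measurePreserving_pi _ _ fun _ => ⟨measurable_snd, hγν⟩
  have hsum : Measurable fun y : (Fin r → Typ n) × (Fin r → G) => ∑ τ, Γ.sale sym β (τ, y) :=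
    Finset.measurable_sum _ fun τ _ => measurable_sale.comp measurable_prodMk_left
  rw [← integral_comp_of_measurePreserving (p1.prod (.id νr)) hsum]
  have hle : ∀ᵐ z ∂((Measure.pi fun _ : Fin r => γ).prod νr),
      h1 z.2 - h2 (fun k => (z.1 k).2) ≤ (1 - β) *
        ∑ τ, Γ.sale sym β (τ, Prod.map (fun (z : Fin r → Typ n × G) k => (z k).1) id z) := by
    refine (Measure.quasiMeasurePreserving_fst.ae (ae_forall_pi hγ r)).mono fun z hz => ?_
    exact sum_sale_le hc ha hT hε hδ cls hcls _ _ _ hz m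
  have j1 : Integrable (fun z : (Fin r → Typ n × G) × (Fin r → G) => h1 z.2)
      ((Measure.pi fun _ => γ).prod νr) :=
    measurePreserving_snd.integrable_comp_of_integrable (g := h1) .of_finite
  have p3 : MeasurePreserving (fun (z : (Fin r → Typ n × G) × (Fin r → G)) k => (z.1 k).2)
      ((Measure.pi fun _ => γ).prod νr) νr := p2.comp measurePreserving_fst
  have j2 : Integrable (fun z : (Fin r → Typ n × G) × (Fin r → G) => h2 fun k => (z.1 k).2)
      ((Measure.pi fun _ => γ).prod νr) :=
    p3.integrable_comp_of_integrable (g := h2) .of_finite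
  refine le_trans ?_ ((integral_mono_ae (j1.sub j2) ((integrable_finsetSum _ fun τ _ =>
    integrable_sale (g := fun z => (τ, Prod.map (fun (z : Fin r → Typ n × G) k => (z k).1) id z))
      (measurable_prodMk_left.comp (p1.prod (.id νr)).measurable)).const_mul _) hle).trans_eq (integral_const_mul _ _))
  simp only [Pi.sub_apply]
  rw [integral_sub j1 j2,
    integral_comp_of_measurePreserving measurePreserving_snd (Measurable.of_discrete (f := h1)),
    integral_comp_of_measurePreserving p3 (Measurable.of_discrete (f := h2)), i1, i2, i3]
  have := mul_le_mul_of_nonneg_left hX hT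
  have e : T * (r / a) = r * (T / a) := by ring
  rw [e] at this
  linarith

/-- The expected price of a truthful bidder. -/
theorem le_integral_expPay {ε δ T a : ℝ} {K : Type*} [Fintype K]
    (h : Symmetric sym Γ D ν lpos lperm) (hc : Γ.Compatible sym)
    (ha : Γ.Admissible ε T) (hT : 0 ≤ T) (hε : 0 ≤ ε) (hδ : 0 ≤ δ) (hD : ∀ᵐ v ∂D, v ∈ cube n)
    (cls : G → K) (hcls : ∀ s t, cls s = cls t → ∃ g, Grp sym g ∧ Γ.act s g = t)
    {γ : Measure (Typ n × G)} [IsProbabilityMeasure γ] (hγD : γ.map Prod.fst = D)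
    (hγν : γ.map Prod.snd = ν)
    (hγ : ∀ᵐ p ∂γ, ∀ j, Γ.val p.2 j ≤ p.1 j ∧ p.1 j ≤ Γ.val p.2 j + δ)
    (ha0 : 0 < a) (hr : 0 < r) (hra : Fintype.card K * a ^ 2 ≤ r) (hβ0 : 0 ≤ β) (hβ1 : β < 1) :
    β * (∫ s, Γ.price s ∂ν - ((ε + δ) * ∫ s, Γ.items s ∂ν + T / a) / (1 - β)) ≤
      ∫ v, Γ.expPay sym β D ν lpos lperm v ∂D := by
  have h1 := integral_sum_sale_ge (β := β) hc ha hT hε hδ cls hcls hγD hγν hγ ha0 hra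
  rw [integral_expPay hD]
  have h2 := integral_mono ((integrable_sale (Γ := Γ) (sym := sym) (β := β)
      (μ := randLaw r D ν lpos lperm) (g := fun x : Rand r n G => (x.2.2.1, (x.1, x.2.1)))
      (measurable_snd.snd.fst.prodMk (measurable_fst.prodMk measurable_snd.fst))).const_mul β)
    (integrable_bill (Γ := Γ) (sym := sym) (β := β) hD) le_bill
  refine le_trans ?_ h2
  rw [integral_const_mul, integral_sale h]
  refine mul_le_mul_of_nonneg_left ?_ hβ0
  have hr' : (0 : ℝ) < r := by positivity
  have hb : 0 < 1 - β := by linarith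
  rw [inv_mul_eq_div, le_div_iff₀ hr', ← mul_le_mul_iff_right₀ hb]
  refine le_trans (le_of_eq ?_) h1
  field_simp
  ring

/-- Without the discounted price only the externality is charged. -/
theorem integral_expPay_nonneg (hD : ∀ᵐ v ∂D, v ∈ cube n) :
    0 ≤ ∫ v, Γ.expPay sym 0 D ν lpos lperm v ∂D := by
  rw [integral_expPay hD]
  refine integral_nonneg fun x => ?_
  simpa using le_bill (Γ := Γ) (sym := sym) (β := 0) x

end Revenue


/-! ### The transformed mechanism -/

/-! ### Expectations under finite distributions. -/

section PMF

/-- The expectation of `f` under a distribution on a finite type. -/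
def pmfExp {α : Type*} [Fintype α] (q : PMF α) (f : α → ℝ) : ℝ := ∑ a, (q a).toReal * f a

theorem pmfExp_bind {α γ : Type*} [Fintype α] [Fintype γ] (p : PMF γ) (q : γ → PMF α) (f : α → ℝ) :
    pmfExp (p.bind q) f = pmfExp p fun z => pmfExp (q z) f := by
  simp only [pmfExp, PMF.bind_apply, tsum_fintype, Finset.mul_sum]
  rw [Finset.sum_comm]
  refine Finset.sum_congr rfl fun a _ => ?_
  rw [ENNReal.toReal_sum fun z _ => ENNReal.mul_ne_top (p.apply_ne_top z) ((q z).apply_ne_top a),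
    Finset.sum_mul]
  exact Finset.sum_congr rfl fun z _ => by rw [ENNReal.toReal_mul, mul_assoc]

theorem pmfExp_pure {α : Type*} [Fintype α] (a : α) (f : α → ℝ) : pmfExp (PMF.pure a) f = f a := by
  classical
  simp only [pmfExp, PMF.pure_apply]
  rw [Finset.sum_eq_single a] <;> simp +contextual

theorem pmfExp_map {α γ : Type*} [Fintype α] [Fintype γ] (q : PMF γ) (h : γ → α) (f : α → ℝ) :
    pmfExp (q.map h) f = pmfExp q (f ∘ h) := by
  rw [PMF.map, pmfExp_bind]
  simp only [Function.comp, pmfExp_pure]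
  rfl

theorem pmfExp_toPMF {α : Type*} [Fintype α] [MeasurableSpace α] [MeasurableSingletonClass α]
    (μ : Measure α) [IsProbabilityMeasure μ] (f : α → ℝ) : pmfExp μ.toPMF f = ∫ a, f a ∂μ := by
  rw [integral_fintype .of_finite]
  rfl

theorem Mechanism.phi_eq {m n : ℕ} {C : Fin m → ℕ} (M : Mechanism C n) (v : Profile m n)
    (i : Fin m) (j : Fin n) :
    M.phi v i j = pmfExp (M.outcome v) fun a => if a.1 j = some i then 1 else 0 := by
  simp [Mechanism.phi, pmfExp]

theorem pmfExp_le {α : Type*} [Fintype α] (q : PMF α) {f : α → ℝ} {c : ℝ} (h : ∀ a, f a ≤ c) :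
    pmfExp q f ≤ c := by
  have h1 : ∑ a, (q a).toReal = 1 := by
    rw [← ENNReal.toReal_sum fun a _ => q.apply_ne_top a, ← tsum_fintype (L := .unconditional α),
      q.tsum_coe, ENNReal.toReal_one]
  calc pmfExp q f ≤ ∑ a, (q a).toReal * c :=
        Finset.sum_le_sum fun a _ => mul_le_mul_of_nonneg_left (h a) ENNReal.toReal_nonneg
    _ = c := by rw [← Finset.sum_mul, h1, one_mul]

theorem Mechanism.phi_nonneg {m n : ℕ} {C : Fin m → ℕ} (M : Mechanism C n) (v : Profile m n)
    (i : Fin m) (j : Fin n) : 0 ≤ M.phi v i j :=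
  Finset.sum_nonneg fun a _ => by split <;> simp

theorem sum_pmfExp {α ι : Type*} [Fintype α] (s : Finset ι) (q : PMF α) (f : ι → α → ℝ) :
    ∑ i ∈ s, pmfExp q (f i) = pmfExp q fun a => ∑ i ∈ s, f i a := by
  simp only [pmfExp, Finset.mul_sum]
  exact Finset.sum_comm

theorem Mechanism.sum_phi_le {m n : ℕ} {C : Fin m → ℕ} (M : Mechanism C n) (v : Profile m n) :
    ∑ i, ∑ j, M.phi v i j ≤ maxAwarded C n := by
  simp only [M.phi_eq, sum_pmfExp]
  refine pmfExp_le _ fun a => ?_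
  rw [Finset.sum_comm]
  have h : ∀ j, ∑ i, (if a.1 j = some i then (1 : ℝ) else 0) = if a.1 j ≠ none then 1 else 0 := by
    intro j
    cases h : a.1 j <;> simp
  simp only [h, Finset.sum_boole]
  exact_mod_cast Finset.le_sup (f := fun a : Alloc C n =>
    (Finset.univ.filter fun j => a.1 j ≠ none).card) (Finset.mem_univ a)

theorem Mechanism.sum_phi_bidder_le {m n : ℕ} {C : Fin m → ℕ} (M : Mechanism C n)
    (v : Profile m n) (i : Fin m) : ∑ j, M.phi v i j ≤ maxAwarded C n :=
  (Finset.single_le_sum (f := fun i => ∑ j, M.phi v i j)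
    (fun i _ => Finset.sum_nonneg fun j _ => M.phi_nonneg v i j) (Finset.mem_univ i)).trans
    (M.sum_phi_le v)

end PMF

/-! ### Resampling one coordinate of a product law. -/

section PiUpdate

variable {ι : Type*} [Fintype ι] [DecidableEq ι] {X : ι → Type*} [∀ i, MeasurableSpace (X i)]

/-- Resampling one coordinate of a product. -/
theorem measurePreserving_update_pi (μ ρ : ∀ i, Measure (X i)) [∀ i, IsProbabilityMeasure (μ i)]
    [∀ i, IsProbabilityMeasure (ρ i)] (i : ι) (h : ∀ k, k ≠ i → ρ k = μ k) :
    MeasurePreserving (fun p : X i × (∀ k, X k) => Function.update p.2 i p.1)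
      ((ρ i).prod (Measure.pi μ)) (Measure.pi ρ) := by
  have hm : Measurable fun p : X i × (∀ k, X k) => Function.update p.2 i p.1 := by
    refine measurable_pi_lambda _ fun k => ?_
    by_cases hk : k = i
    · subst hk; simpa using measurable_fst
    · simp only [Function.update_of_ne hk]
      exact (measurable_pi_apply k).comp measurable_snd
  refine ⟨hm, (Measure.pi_eq fun s hs => ?_).symm⟩
  rw [Measure.map_apply hm (.univ_pi hs)]
  have : (fun p : X i × (∀ k, X k) => Function.update p.2 i p.1) ⁻¹' Set.univ.pi s =
      s i ×ˢ Set.univ.pi (Function.update s i Set.univ) := by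
    ext p
    simp only [Set.mem_preimage, Set.mem_pi, Set.mem_univ, true_imp_iff, Set.mem_prod]
    constructor
    · intro h
      refine ⟨by simpa using h i, fun k => ?_⟩
      by_cases hk : k = i
      · subst hk; simp
      · simpa [hk] using h k
    · rintro ⟨h1, h2⟩ k
      by_cases hk : k = i
      · subst hk; simpa using h1
      · simpa [hk] using h2 k
  rw [this, Measure.prod_prod, Measure.pi_pi, ← Finset.mul_prod_erase _ _ (Finset.mem_univ i),
    ← Finset.mul_prod_erase (a := i) (f := fun i => ρ i (s i)) _ (Finset.mem_univ i)]
  simp only [Function.update_self, measure_univ, one_mul]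
  congr 1
  refine Finset.prod_congr rfl fun k hk => ?_
  rw [Function.update_of_ne (Finset.ne_of_mem_erase hk), h k (Finset.ne_of_mem_erase hk)]

theorem integral_update_pi [∀ i, Fintype (X i)] [∀ i, DiscreteMeasurableSpace (X i)]
    (μ ρ : ∀ i, Measure (X i)) [∀ i, IsProbabilityMeasure (μ i)]
    [∀ i, IsProbabilityMeasure (ρ i)] (i : ι) (h : ∀ k, k ≠ i → ρ k = μ k)
    (f : (∀ k, X k) → ℝ) :
    ∫ z, f z ∂(Measure.pi ρ) = ∫ g, ∫ z, f (Function.update z i g) ∂(Measure.pi μ) ∂(ρ i) := by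
  rw [← integral_comp_of_measurePreserving (measurePreserving_update_pi μ ρ i h)
    (Measurable.of_discrete (f := f)), integral_prod _ .of_finite]

end PiUpdate

/-- Keep the items of the bidders in `b` only. -/
def keep {m n : ℕ} {C : Fin m → ℕ} (b : Fin m → Bool) (a : Alloc C n) : Alloc C n :=
  ⟨fun j => (a.1 j).bind fun i => if b i then some i else none, fun i => by
    refine le_trans (Finset.card_le_card fun j hj => ?_) (a.2 i)
    simp only [Finset.mem_filter, Finset.mem_univ, true_and, Option.bind_eq_some_iff] at hj ⊢
    obtain ⟨k, hk, h⟩ := hj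
    split at h
    · simp_all
    · simp at h⟩

theorem keep_eq_some {m n : ℕ} {C : Fin m → ℕ} (b : Fin m → Bool) (a : Alloc C n) (i : Fin m)
    (j : Fin n) : (keep b a).1 j = some i ↔ b i = true ∧ a.1 j = some i := by
  simp only [keep, Option.bind_eq_some_iff]
  constructor
  · rintro ⟨k, hk, h⟩
    split at h
    · simp_all
    · simp at h
  · rintro ⟨h1, h2⟩
    exact ⟨i, h2, by simp [h1]⟩

/-! ### Incentives and interim outcomes of the transformed mechanism. -/

section Transformed

set_option linter.unusedSectionVars false

variable {m n r : ℕ} {C : Fin m → ℕ} {G : Fin m → Type} [∀ i, Fintype (G i)]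
  [∀ i, MeasurableSpace (G i)] [∀ i, DiscreteMeasurableSpace (G i)]
  (M₁ : Mechanism C n) (sym : Bool) (β : ℝ) (Γ : ∀ i, Surrogates n (G i))
  (D : Fin m → Measure (Typ n)) (ν : ∀ i, Measure (G i)) (lpos : Measure (Fin r))
  (lperm : Measure (Equiv.Perm (Fin n))) [∀ i, IsProbabilityMeasure (D i)]
  [∀ i, IsProbabilityMeasure (ν i)] [IsProbabilityMeasure lpos] [IsProbabilityMeasure lperm]

/-- The law of the surrogate type of bidder `i` of type `v`, and of whether she buys. -/
def pickLaw (i : Fin m) (v : Typ n) : Measure (G i × Bool) :=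
  (randLaw r (D i) (ν i) lpos lperm).map ((Γ i).pick sym β v)

instance (i : Fin m) (v : Typ n) : IsProbabilityMeasure (pickLaw sym β Γ D ν lpos lperm i v) :=
  Measure.isProbabilityMeasure_map
    (measurable_pick measurable_const measurable_id).aemeasurable

/-- The transformed mechanism. -/
def transformed : Mechanism C n where
  -- Every surrogate plays `M₁`, also on behalf of a bidder who does not buy. Her items are
  -- discarded only afterwards, so the other bidders still face the law that their interim outcomes
  -- presuppose.
  outcome v := (Measure.pi fun i => pickLaw sym β Γ D ν lpos lperm i (v i)).toPMF.bind fun z =>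
    (M₁.outcome fun i => (Γ i).val (z i).1).map (keep fun i => (z i).2)
  price v i := (Γ i).expPay sym β (D i) (ν i) lpos lperm (v i)

/-- The interim outcomes of `M₁` are those of the surrogates. -/
structure Interim : Prop where
  phi : ∀ i s j, (Γ i).phi s j = ∫ y, M₁.phi (Function.update (fun k => (Γ k).val (y k)) i
    ((Γ i).val s)) i j ∂(Measure.pi ν)
  price : ∀ i s, (Γ i).price s = ∫ y, M₁.price (Function.update (fun k => (Γ k).val (y k)) i
    ((Γ i).val s)) i ∂(Measure.pi ν)

variable {M₁ sym β Γ D ν lpos lperm}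

theorem transformed_phi (v : Profile m n) (i : Fin m) (j : Fin n) :
    (transformed M₁ sym β Γ D ν lpos lperm).phi v i j =
      ∫ z, (if (z i).2 then M₁.phi (fun k => (Γ k).val (z k).1) i j else 0)
        ∂(Measure.pi fun k => pickLaw sym β Γ D ν lpos lperm k (v k)) := by
  rw [Mechanism.phi_eq, transformed, pmfExp_bind, pmfExp_toPMF]
  refine integral_congr_ae (.of_forall fun z => ?_)
  simp only [pmfExp_map, Mechanism.phi_eq]
  split <;> rename_i h
  · exact congrArg _ (funext fun a => by simp [keep_eq_some, h])
  · simp [pmfExp, keep_eq_some, h]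

theorem transformed_phi_update (v : Profile m n) (i : Fin m) (w : Typ n) (j : Fin n) :
    (transformed M₁ sym β Γ D ν lpos lperm).phi (Function.update v i w) i j =
      ∫ g, (if g.2 then ∫ z, M₁.phi (Function.update (fun k => (Γ k).val (z k).1) i
          ((Γ i).val g.1)) i j ∂(Measure.pi fun k => pickLaw sym β Γ D ν lpos lperm k (v k)) else 0)
        ∂(pickLaw sym β Γ D ν lpos lperm i w) := by
  rw [transformed_phi, integral_update_pi (fun k => pickLaw sym β Γ D ν lpos lperm k (v k)) _ i
    fun k hk => by rw [Function.update_of_ne hk], Function.update_self]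
  refine integral_congr_ae (.of_forall fun g => ?_)
  simp only [Function.update_self]
  split
  · refine integral_congr_ae (.of_forall fun z => ?_)
    simp only
    congr 1
    ext k
    by_cases hk : k = i
    · subst hk; simp
    · simp [hk]
  · simp

variable (sym β Γ D ν lpos lperm) in
/-- The law of the surrogate type of bidder `i` of type `v`. -/
def typeLaw (i : Fin m) (v : Typ n) : Measure (G i) :=
  (pickLaw sym β Γ D ν lpos lperm i v).map Prod.fst

instance (i : Fin m) (v : Typ n) : IsProbabilityMeasure (typeLaw sym β Γ D ν lpos lperm i v) :=
  Measure.isProbabilityMeasure_map measurable_fst.aemeasurable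

theorem typeLaw_singleton (i : Fin m) (v : Typ n) (s : G i) :
    typeLaw sym β Γ D ν lpos lperm i v {s} = ∫⁻ x, ({s} : Set (G i)).indicator 1
      ((Γ i).pick sym β v x).1 ∂(randLaw r (D i) (ν i) lpos lperm) := by
  have h : Measurable ((Γ i).pick sym β v (r := r)) :=
    measurable_pick measurable_const measurable_id
  rw [typeLaw, pickLaw, Measure.map_map measurable_fst h,
    ← lintegral_indicator_one (measurableSet_singleton s),
    lintegral_map (measurable_one.indicator (measurableSet_singleton s)) (measurable_fst.comp h)]
  rfl

theorem measurable_typeLaw (i : Fin m) (s : G i) :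
    Measurable fun v => typeLaw sym β Γ D ν lpos lperm i v {s} := by
  simp only [typeLaw_singleton]
  refine Measurable.lintegral_prod_right' (f := fun p : Typ n × Rand r n (G i) =>
    ({s} : Set (G i)).indicator 1 ((Γ i).pick sym β p.1 p.2).1) ?_
  exact (measurable_one.indicator (measurableSet_singleton s)).comp
    (measurable_pick measurable_fst measurable_snd).fst

theorem integral_typeLaw {i : Fin m} (h : Symmetric sym (Γ i) (D i) (ν i) lpos lperm) (s : G i) :
    ∫ v, (typeLaw sym β Γ D ν lpos lperm i v).real {s} ∂(D i) = (ν i).real {s} := by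
  simp only [measureReal_def]
  rw [integral_toReal (measurable_typeLaw i s).aemeasurable (.of_forall fun v => by simp)]
  simp only [typeLaw_singleton]
  rw [lintegral_pick h, lintegral_indicator_one (measurableSet_singleton s)]

/-- A finite sum of products with one factor per bidder: this shows measurability in the reports and
lets the expectation over truthful reports factorise. -/
theorem integral_typeLaw_pi (v : Profile m n) (H : (∀ i, G i) → ℝ) :
    ∫ z, H (fun k => (z k).1) ∂(Measure.pi fun k => pickLaw sym β Γ D ν lpos lperm k (v k)) =
      ∑ y, (∏ k, (typeLaw sym β Γ D ν lpos lperm k (v k)).real {y k}) * H y := by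
  have h : MeasurePreserving (fun (z : ∀ k, G k × Bool) k => (z k).1)
      (Measure.pi fun k => pickLaw sym β Γ D ν lpos lperm k (v k))
      (Measure.pi fun k => typeLaw sym β Γ D ν lpos lperm k (v k)) :=
    measurePreserving_pi _ _ fun k => ⟨measurable_fst, rfl⟩
  rw [integral_comp_of_measurePreserving h (Measurable.of_discrete (f := H)),
    integral_fintype .of_finite]
  simp [measureReal_def, Measure.pi_singleton, ENNReal.toReal_prod]

theorem integrable_prod_typeLaw (y : ∀ i, G i) :
    Integrable (fun v : Profile m n => ∏ k, (typeLaw sym β Γ D ν lpos lperm k (v k)).real {y k})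
      (Measure.pi D) := by
  refine .of_bound (Measurable.aestronglyMeasurable ?_) 1 (.of_forall fun v => ?_)
  · exact Finset.measurable_prod _ fun k _ => (measurable_typeLaw k (y k)).ennreal_toReal.comp
      (measurable_pi_apply k)
  · rw [Real.norm_of_nonneg (Finset.prod_nonneg fun k _ => measureReal_nonneg)]
    exact Finset.prod_le_one (fun k _ => measureReal_nonneg) fun k _ => measureReal_le_one

theorem integrable_typeLaw_pi (H : (∀ i, G i) → ℝ) :
    Integrable (fun v : Profile m n => ∫ z, H (fun k => (z k).1)
      ∂(Measure.pi fun k => pickLaw sym β Γ D ν lpos lperm k (v k))) (Measure.pi D) := by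
  simp only [integral_typeLaw_pi]
  exact integrable_finsetSum _ fun y _ => (integrable_prod_typeLaw y).mul_const _

/-- The surrogate types of truthful bidders are distributed as the surrogates. -/
theorem integral_integral_types (h : ∀ i, Symmetric sym (Γ i) (D i) (ν i) lpos lperm)
    (H : (∀ i, G i) → ℝ) :
    ∫ v : Profile m n, ∫ z, H (fun k => (z k).1)
      ∂(Measure.pi fun k => pickLaw sym β Γ D ν lpos lperm k (v k)) ∂(Measure.pi D) =
      ∫ y, H y ∂(Measure.pi ν) := by
  simp only [integral_typeLaw_pi]
  rw [integral_finsetSum _ fun y _ => (integrable_prod_typeLaw y).mul_const _,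
    integral_fintype .of_finite]
  refine Finset.sum_congr rfl fun y _ => ?_
  rw [integral_mul_const, integral_fintype_prod_eq_prod
    (f := fun k v => (typeLaw sym β Γ D ν lpos lperm k v).real {y k})]
  simp only [integral_typeLaw (h _)]
  simp [measureReal_def, Measure.pi_singleton, ENNReal.toReal_prod]

theorem expBuy_eq (i : Fin m) (h : G i → ℝ) (w : Typ n) :
    (Γ i).expBuy sym β (D i) (ν i) lpos lperm h w =
      ∫ g, (if g.2 then h g.1 else 0) ∂(pickLaw sym β Γ D ν lpos lperm i w) := by
  have hp : Measurable ((Γ i).pick sym β w (r := r)) :=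
    measurable_pick measurable_const measurable_id
  rw [pickLaw, integral_map hp.aemeasurable Measurable.of_discrete.aestronglyMeasurable]
  rfl

/-- Given the bidder's own surrogate, the surrogates of the truthful others are distributed as `ν`
on average, so `M₁` delivers in expectation exactly the outcome that was bought in the matching. -/
theorem transformed_interim (hM : Interim M₁ Γ ν)
    (h : ∀ i, Symmetric sym (Γ i) (D i) (ν i) lpos lperm) (i : Fin m) (w : Typ n) (j : Fin n) :
    Integrable (fun v => (transformed M₁ sym β Γ D ν lpos lperm).phi (Function.update v i w) i j)
      (Measure.pi D) ∧
    (transformed M₁ sym β Γ D ν lpos lperm).interimPhi D i w j =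
      (Γ i).expBuy sym β (D i) (ν i) lpos lperm (fun s => (Γ i).phi s j) w := by
  have hi : ∀ g : G i × Bool, Integrable (fun v : Profile m n => if g.2 then
      ∫ z, M₁.phi (Function.update (fun k => (Γ k).val (z k).1) i ((Γ i).val g.1)) i j
        ∂(Measure.pi fun k => pickLaw sym β Γ D ν lpos lperm k (v k)) else 0) (Measure.pi D) := by
    intro g
    split
    · exact integrable_typeLaw_pi fun y =>
        M₁.phi (Function.update (fun k => (Γ k).val (y k)) i ((Γ i).val g.1)) i j
    · exact integrable_zero _ _ _
  rw [Mechanism.interimPhi, expBuy_eq]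
  simp only [transformed_phi_update]
  simp only [integral_fintype Integrable.of_finite (μ := pickLaw sym β Γ D ν lpos lperm i w),
    smul_eq_mul]
  refine ⟨integrable_finsetSum _ fun g _ => (hi g).const_mul _, ?_⟩
  rw [integral_finsetSum _ fun g _ => (hi g).const_mul _]
  refine Finset.sum_congr rfl fun g _ => ?_
  rw [integral_const_mul]
  congr 1
  split
  · rw [hM.phi, integral_integral_types h fun y =>
      M₁.phi (Function.update (fun k => (Γ k).val (y k)) i ((Γ i).val g.1)) i j]
  · simp

theorem transformed_interimPrice (i : Fin m) (w : Typ n) :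
    (transformed M₁ sym β Γ D ν lpos lperm).interimPrice D i w =
      (Γ i).expPay sym β (D i) (ν i) lpos lperm w := by
  simp [Mechanism.interimPrice, transformed]

theorem transformed_isBIC (hM : Interim M₁ Γ ν)
    (h : ∀ i, Symmetric sym (Γ i) (D i) (ν i) lpos lperm) (hc : ∀ i, (Γ i).Compatible sym)
    (hD : ∀ i, ∀ᵐ v ∂(D i), v ∈ cube n) :
    IsBIC D (fun _ => cube n) (transformed M₁ sym β Γ D ν lpos lperm) := by
  intro i w hw
  refine ⟨fun j => (transformed_interim hM h i w j).1, by simp [transformed], fun v hv => ?_⟩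
  simp only [Mechanism.interimUtility, (transformed_interim hM h i _ _).2,
    transformed_interimPrice, zero_mul, sub_zero]
  exact expBuy_truthful (h i) (hc i) (hD i) hv hw

theorem transformed_isIR (hM : Interim M₁ Γ ν)
    (h : ∀ i, Symmetric sym (Γ i) (D i) (ν i) lpos lperm) (hc : ∀ i, (Γ i).Compatible sym)
    (hD : ∀ i, ∀ᵐ v ∂(D i), v ∈ cube n) :
    IsIR D (fun _ => cube n) (transformed M₁ sym β Γ D ν lpos lperm) := by
  intro i v hv
  simp only [Mechanism.interimUtility, (transformed_interim hM h i _ _).2,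
    transformed_interimPrice]
  exact sub_nonneg.2 (expPay_le (h i) (hc i) (hD i) hv)

theorem integrable_transformed_price (hD : ∀ i, ∀ᵐ v ∂(D i), v ∈ cube n) (i : Fin m) :
    Integrable (fun v => (transformed M₁ sym β Γ D ν lpos lperm).price v i) (Measure.pi D) :=
  (measurePreserving_eval D i).integrable_comp_of_integrable (integrable_expPay (hD i))

theorem transformed_revenue (hD : ∀ i, ∀ᵐ v ∂(D i), v ∈ cube n) :
    (transformed M₁ sym β Γ D ν lpos lperm).revenue D =
      ∑ i, ∫ v, (Γ i).expPay sym β (D i) (ν i) lpos lperm v ∂(D i) := by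
  rw [Mechanism.revenue, integral_finsetSum _ fun i _ => integrable_transformed_price hD i]
  exact Finset.sum_congr rfl fun i _ =>
    integral_comp_eval (μ := D) (integrable_expPay (hD i)).aestronglyMeasurable

/-- Drawing coordinate `i` from its own law restores the product law, so the interim prices add up
to the revenue of `M₁`. -/
theorem sum_integral_price (hM : Interim M₁ Γ ν) :
    ∑ i, ∫ s, (Γ i).price s ∂(ν i) =
      ∫ y, ∑ i, M₁.price (fun k => (Γ k).val (y k)) i ∂(Measure.pi ν) := by
  rw [integral_finsetSum _ fun i _ => .of_finite]
  refine Finset.sum_congr rfl fun i _ => ?_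
  rw [integral_update_pi ν ν i fun _ _ => rfl]
  refine integral_congr_ae (.of_forall fun s => ?_)
  simp only [hM.price]
  refine integral_congr_ae (.of_forall fun y => ?_)
  simp only
  congr 1
  ext k
  by_cases hk : k = i
  · subst hk; simp
  · simp [hk]

/-- The bidders are summed before bounding: the error per item then costs one `T` in total instead
of one per bidder. -/
theorem sum_integral_items_le (hM : Interim M₁ Γ ν) :
    ∑ i, ∫ s, (Γ i).items s ∂(ν i) ≤ maxAwarded C n := by
  have h : ∀ i, ∫ s, (Γ i).items s ∂(ν i) =
      ∫ y, ∑ j, M₁.phi (fun k => (Γ k).val (y k)) i j ∂(Measure.pi ν) := by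
    intro i
    rw [integral_update_pi ν ν i fun _ _ => rfl]
    refine integral_congr_ae (.of_forall fun s => ?_)
    simp only [Surrogates.items, hM.phi]
    rw [integral_finsetSum _ fun j _ => .of_finite]
    refine Finset.sum_congr rfl fun j _ => integral_congr_ae (.of_forall fun y => ?_)
    simp only
    congr 1
    ext k
    by_cases hk : k = i
    · subst hk; simp
    · simp [hk]
  simp only [h]
  rw [← integral_finsetSum _ fun i _ => .of_finite]
  refine (integral_mono .of_finite (integrable_const _) fun y => M₁.sum_phi_le _).trans ?_
  simp

end Transformed


/-! ### The revenue guarantee. -/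

section TransformedRevenue

variable {m n r : ℕ} {C : Fin m → ℕ} {G : Fin m → Type} [∀ i, Fintype (G i)]
  [∀ i, MeasurableSpace (G i)] [∀ i, DiscreteMeasurableSpace (G i)]
  {M₁ : Mechanism C n} {sym : Bool} {Γ : ∀ i, Surrogates n (G i)}
  {D D' : Fin m → Measure (Typ n)} {ν : ∀ i, Measure (G i)} {lpos : Measure (Fin r)}
  {lperm : Measure (Equiv.Perm (Fin n))} [∀ i, IsProbabilityMeasure (D i)]
  [∀ i, IsProbabilityMeasure (ν i)] [IsProbabilityMeasure lpos] [IsProbabilityMeasure lperm]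

/-- For `η < 1` the parameter is `a = m / δ`: class fluctuations cost `Tδ/m` per bidder, hence at
most `δT` in all, the second `δ` of the bound. For `η ≥ 1` the right side is at most zero and the
collected externalities suffice. -/
theorem transformed_isBICTransform {K : Type} [Fintype K] {δ η ε : ℝ} (hδ : 0 < δ) (hη : 0 < η)
    (hε : 0 < ε) (hM : Interim M₁ Γ ν)
    (h : ∀ i, Symmetric sym (Γ i) (D i) (ν i) lpos lperm) (hc : ∀ i, (Γ i).Compatible sym)
    (ha : ∀ i, (Γ i).Admissible ε (maxAwarded C n)) (hD : ∀ i, ∀ᵐ v ∂(D i), v ∈ cube n)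
    (cls : ∀ i, G i → K)
    (hcls : ∀ i s t, cls i s = cls i t → ∃ g, Grp sym g ∧ (Γ i).act s g = t)
    (γ : ∀ i, Measure (Typ n × G i)) (hγD : ∀ i, (γ i).map Prod.fst = D i)
    (hγν : ∀ i, (γ i).map Prod.snd = ν i)
    (hγ : ∀ i, ∀ᵐ p ∂(γ i), ∀ j, (Γ i).val p.2 j ≤ p.1 j ∧ p.1 j ≤ (Γ i).val p.2 j + δ)
    (hr : 0 < r) (hra : Fintype.card K * (m / δ) ^ 2 ≤ r)
    (hrev : M₁.revenue D' = ∫ y, ∑ i, M₁.price (fun k => (Γ k).val (y k)) i ∂(Measure.pi ν))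
    (hη1 : 1 < η → 0 ≤ M₁.revenue D') :
    IsBICTransform D D' δ η ε M₁ (transformed M₁ sym (max (1 - η) 0) Γ D ν lpos lperm) := by
  have hT : (0 : ℝ) ≤ maxAwarded C n := Nat.cast_nonneg _
  refine ⟨transformed_isBIC hM h hc hD, transformed_isIR hM h hc hD,
    integrable_finsetSum _ fun i _ => integrable_transformed_price hD i, ?_⟩
  rw [transformed_revenue hD, ge_iff_le]
  rcases lt_or_ge η 1 with h1 | h1
  · rw [max_eq_left (by linarith)]
    have hi : ∀ i, (1 - η) * (∫ s, (Γ i).price s ∂(ν i) - ((ε + δ) * ∫ s, (Γ i).items s ∂(ν i) +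
        maxAwarded C n / (m / δ)) / η) ≤
        ∫ v, (Γ i).expPay sym (1 - η) (D i) (ν i) lpos lperm v ∂(D i) := by
      intro i
      have hm : (0 : ℝ) < m := by exact_mod_cast i.pos
      have : IsProbabilityMeasure (γ i) := by
        refine ⟨?_⟩
        rw [← Set.preimage_univ (f := (Prod.fst : Typ n × G i → Typ n)),
          ← Measure.map_apply measurable_fst .univ, hγD, measure_univ]
      have := le_integral_expPay (β := 1 - η) (h i) (hc i) (ha i) hT hε.le hδ.le (hD i) (cls i)
        (hcls i) (hγD i) (hγν i) (hγ i) (a := m / δ) (by positivity) hr hra (by linarith)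
        (by linarith)
      rwa [sub_sub_cancel] at this
    refine le_trans ?_ (Finset.sum_le_sum fun i _ => hi i)
    rw [← Finset.mul_sum, Finset.sum_sub_distrib, sum_integral_price hM, ← hrev,
      ← Finset.sum_div, Finset.sum_add_distrib, ← Finset.mul_sum]
    have hs := sum_integral_items_le hM
    have hq : ∑ _i : Fin m, (maxAwarded C n : ℝ) / (m / δ) ≤ δ * maxAwarded C n := by
      simp only [Finset.sum_const, Finset.card_univ, Fintype.card_fin, nsmul_eq_mul]
      rcases Nat.eq_zero_or_pos m with h0 | h0
      · subst h0; simp only [Nat.cast_zero, zero_mul]; positivity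
      · have hm : (0 : ℝ) < m := by exact_mod_cast h0
        refine le_of_eq ?_
        field_simp
    set I := ∑ i, ∫ s, (Γ i).items s ∂(ν i)
    set Q := ∑ _i : Fin m, (maxAwarded C n : ℝ) / (m / δ)
    have h2 : (ε + δ) * I + Q ≤ (ε + 2 * δ) * maxAwarded C n := by nlinarith
    have h3 : ((ε + δ) * I + Q) / η ≤ (ε + 2 * δ) / η * maxAwarded C n := by
      rw [div_mul_eq_mul_div]; gcongr
    -- The loss is nonnegative, so its factor `1 - η` may be dropped.
    have h4 : (0 : ℝ) ≤ (ε + 2 * δ) / η * maxAwarded C n := by positivity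
    nlinarith
  · rw [max_eq_right (by linarith)]
    have h2 : 0 ≤ ∑ i, ∫ v, (Γ i).expPay sym 0 (D i) (ν i) lpos lperm v ∂(D i) :=
      Finset.sum_nonneg fun i _ => integral_expPay_nonneg (hD i)
    have h4 : (0 : ℝ) ≤ (ε + 2 * δ) / η * maxAwarded C n := by positivity
    have h5 : (1 - η) * M₁.revenue D' ≤ 0 := by
      rcases h1.eq_or_lt with h1 | h1
      · simp [← h1]
      · exact mul_nonpos_of_nonpos_of_nonneg (by linarith) (hη1 h1)
    linarith

end TransformedRevenue

/-! ### Distributions on a grid -/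

section Grid

variable {n : ℕ}

/-- The points of the cube whose coordinates are multiples of `δ`. -/
def IsGrid (δ : ℝ) (x : Typ n) : Prop := x ∈ cube n ∧ ∀ j, ∃ z : ℤ, x j = z * δ

/-- The number of multiples of `δ` in `[0,1]`. -/
def levels (δ : ℝ) : ℕ := ⌊1 / δ⌋₊ + 1

/-- The level of a multiple of `δ`. -/
def level (δ x : ℝ) : Fin (levels δ) := Fin.ofNat (⌊1 / δ⌋₊ + 1) ⌊x / δ⌋₊

theorem IsGrid.eq_level {δ : ℝ} (hδ : 0 < δ) {x : Typ n} (hx : IsGrid δ x) (j : Fin n) :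
    x j = ((level δ (x j) : ℕ) : ℝ) * δ := by
  obtain ⟨z, hz⟩ := hx.2 j
  have h0 : 0 ≤ z := by
    by_contra hneg
    have : (z : ℝ) < 0 := by exact_mod_cast not_le.1 hneg
    have := (hx.1 j).1
    nlinarith
  obtain ⟨t, rfl⟩ := Int.eq_ofNat_of_zero_le h0
  have hd : x j / δ = t := by rw [hz]; field_simp; simp
  have hlt : t < ⌊1 / δ⌋₊ + 1 := by
    refine Nat.lt_succ_of_le (Nat.le_floor ?_)
    rw [← hd]
    exact div_le_div_of_nonneg_right (hx.1 j).2 hδ.le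
  rw [level, hd, Nat.floor_natCast]
  simp only [Fin.ofNat, Nat.mod_eq_of_lt hlt]
  simpa using hz

theorem finite_isGrid {δ : ℝ} (hδ : 0 < δ) : {x : Typ n | IsGrid δ x}.Finite := by
  refine Set.Finite.of_finite_image (f := fun x j => level δ (x j)) (Set.toFinite _) ?_
  intro x hx y hy h
  ext j
  have hj : level δ (x j) = level δ (y j) := congrFun h j
  rw [IsGrid.eq_level hδ hx, IsGrid.eq_level hδ hy, hj]

/-- The atoms of a distribution. -/
abbrev Atom (μ : Measure (Typ n)) := {x : Typ n // μ {x} ≠ 0}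

variable {δ : ℝ} {μ : Measure (Typ n)}

theorem Atom.of_ae {p : Typ n → Prop} (h : ∀ᵐ x ∂μ, p x) (s : Atom μ) : p s.1 := by
  by_contra hs
  refine s.2 (measure_mono_null ?_ (ae_iff.1 h))
  simpa using hs

theorem finite_atom (hδ : 0 < δ) (h : ∀ᵐ x ∂μ, IsGrid δ x) : Finite (Atom μ) :=
  ((finite_isGrid hδ).subset fun x hx => Atom.of_ae h ⟨x, hx⟩).to_subtype

/-- The grid is finite, so its points without mass form a null set. -/
theorem ae_atom (hδ : 0 < δ) (h : ∀ᵐ x ∂μ, IsGrid δ x) : ∀ᵐ x ∂μ, μ {x} ≠ 0 := by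
  have h1 : μ {x | IsGrid δ x ∧ μ {x} = 0} = 0 := by
    have hf : {x : Typ n | IsGrid δ x ∧ μ {x} = 0}.Countable :=
      ((finite_isGrid hδ).subset fun x hx => hx.1).countable
    rw [← Set.biUnion_of_singleton {x : Typ n | IsGrid δ x ∧ μ {x} = 0},
      measure_biUnion_null_iff hf]
    exact fun x hx => hx.2
  have h2 : ∀ᵐ x ∂μ, ¬ (IsGrid δ x ∧ μ {x} = 0) := by
    rw [ae_iff]; simpa using h1
  filter_upwards [h, h2] with x hx hx2 h0 using hx2 ⟨hx, h0⟩

theorem nonempty_atom [IsProbabilityMeasure μ] (hδ : 0 < δ) (h : ∀ᵐ x ∂μ, IsGrid δ x) :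
    Nonempty (Atom μ) :=
  let ⟨x, hx⟩ := (ae_atom hδ h).exists
  ⟨⟨x, hx⟩⟩

/-- The assumptions on `M₁` are made on supports, while the surrogates are atoms. -/
theorem Atom.mem_support (s : Atom μ) : s.1 ∈ μ.support := by
  rw [Measure.mem_support_iff_forall]
  intro U hU
  exact (pos_iff_ne_zero.2 s.2).trans_le (measure_mono (by simpa using mem_of_mem_nhds hU))

theorem isClosed_cube : IsClosed (cube n) := by
  have : cube n = ⋂ j, {v : Typ n | 0 ≤ v j} ∩ {v | v j ≤ 1} := by
    ext v; simp [cube]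
  rw [this]
  exact isClosed_iInter fun j => (isClosed_le continuous_const (continuous_apply j)).inter
    (isClosed_le (continuous_apply j) continuous_const)

theorem support_subset_cube (h : ∀ᵐ x ∂μ, x ∈ cube n) : μ.support ⊆ cube n :=
  Measure.support_subset_of_isClosed isClosed_cube h

variable [Nonempty (Atom μ)]

/-- The point itself if it is an atom. -/
def snap (μ : Measure (Typ n)) [Nonempty (Atom μ)] (x : Typ n) : Atom μ :=
  -- For laws on the grid the arbitrary value is used only on a null set.
  open Classical in if h : μ {x} ≠ 0 then ⟨x, h⟩ else Classical.arbitrary _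

theorem snap_of_ne {x : Typ n} (h : μ {x} ≠ 0) : snap μ x = ⟨x, h⟩ := dif_pos h

theorem measurable_snap [Finite (Atom μ)] : Measurable (snap μ) := by
  classical
  have hs : MeasurableSet {x : Typ n | μ {x} ≠ 0} :=
    (Set.finite_coe_iff.1 (inferInstanceAs (Finite (Atom μ)))).measurableSet
  have : snap μ = fun x => if h : x ∈ {x : Typ n | μ {x} ≠ 0} then
    (⟨x, h⟩ : Atom μ) else Classical.arbitrary _ := rfl
  rw [this]
  exact Measurable.dite (f := fun x : {x : Typ n | μ {x} ≠ 0} => (⟨x.1, x.2⟩ : Atom μ))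
    (g := fun _ => Classical.arbitrary _) measurable_id measurable_const hs

/-- The law of the atoms. -/
def atomLaw (μ : Measure (Typ n)) [Nonempty (Atom μ)] : Measure (Atom μ) := μ.map (snap μ)

instance [Finite (Atom μ)] [IsProbabilityMeasure μ] : IsProbabilityMeasure (atomLaw μ) :=
  Measure.isProbabilityMeasure_map measurable_snap.aemeasurable

end Grid

/-! ### The atoms of the discretised distributions as surrogates. -/

section InputMechanism

set_option linter.unusedSectionVars false

variable {m n : ℕ} {C : Fin m → ℕ} {D' : Fin m → Measure (Typ n)}
  [∀ i, IsProbabilityMeasure (D' i)] [∀ i, Nonempty (Atom (D' i))]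

/-- The atoms of the distributions, as surrogates with the interim outcomes of `M₁`. -/
def atomSurrogates (M₁ : Mechanism C n) (D' : Fin m → Measure (Typ n)) (i : Fin m) :
    Surrogates n (Atom (D' i)) where
  val s := s.1
  phi s := M₁.interimPhi D' i s.1
  price s := M₁.interimPrice D' i s.1
  -- The default branch never occurs for a permutation that preserves `D' i`, since then atoms go to
  -- atoms.
  act s g := open Classical in if h : D' i {s.1 ∘ g} ≠ 0 then ⟨s.1 ∘ g, h⟩ else s

variable [∀ i, Fintype (Atom (D' i))] {M₁ : Mechanism C n} {δ : ℝ}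

theorem integral_pi_atoms (hδ : 0 < δ) (h : ∀ i, ∀ᵐ x ∂(D' i), IsGrid δ x) (f : Profile m n → ℝ) :
    ∫ v, f v ∂(Measure.pi D') = ∫ y, f (fun k => (y k).1) ∂(Measure.pi fun i => atomLaw (D' i)) := by
  have hp : MeasurePreserving (fun (v : Profile m n) i => snap (D' i) (v i)) (Measure.pi D')
      (Measure.pi fun i => atomLaw (D' i)) :=
    measurePreserving_pi _ _ fun i => ⟨measurable_snap, rfl⟩
  rw [← integral_comp_of_measurePreserving hp (Measurable.of_discrete
    (f := fun y : ∀ i, Atom (D' i) => f fun k => (y k).1))]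
  have hae : ∀ᵐ v ∂(Measure.pi D'), ∀ i, D' i {v i} ≠ 0 :=
    ae_all_iff.2 fun i => (Measure.quasiMeasurePreserving_eval D' i).ae (ae_atom hδ (h i))
  refine integral_congr_ae (hae.mono fun v hv => ?_)
  simp only
  congr 1
  ext i
  rw [snap_of_ne (hv i)]

theorem interim_atomSurrogates (hδ : 0 < δ) (h : ∀ i, ∀ᵐ x ∂(D' i), IsGrid δ x) :
    Interim M₁ (atomSurrogates M₁ D') fun i => atomLaw (D' i) where
  phi i s j := integral_pi_atoms hδ h fun v => M₁.phi (Function.update v i s.1) i j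
  price i s := integral_pi_atoms hδ h fun v => M₁.price (Function.update v i s.1) i

/-- This replaces the permitted error `ε * vMax D'` per item by `ε`. -/
theorem vMax_le_one (hD : ∀ i, ∀ᵐ v ∂(D' i), v ∈ cube n) : vMax D' ≤ 1 := by
  refine Real.sSup_le ?_ zero_le_one
  rintro x ⟨i, v, hv, j, rfl⟩
  exact (support_subset_cube (hD i) hv j).2

theorem admissible_atomSurrogates {η ε : ℝ} (hε : 0 < ε)
    (h : ∀ i, ∀ᵐ x ∂(D' i), IsGrid δ x) (hM : IsInputMechanism D' η ε M₁) (i : Fin m) :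
    (atomSurrogates M₁ D' i).Admissible ε (maxAwarded C n) := by
  have hphi : ∀ (s : Atom (D' i)) j, 0 ≤ M₁.interimPhi D' i s.1 j := fun s j =>
    integral_nonneg fun v => M₁.phi_nonneg _ _ _
  refine ⟨fun s j => ((Atom.of_ae (h i) s).1 j).1, fun s j => ((Atom.of_ae (h i) s).1 j).2,
    hphi, fun s => ?_, fun s t => ?_, fun s => hM.2.1 i s.1 s.mem_support⟩
  · have hi := (hM.1 i s.1 s.mem_support).1
    change ∑ j, ∫ v, M₁.phi (Function.update v i s.1) i j ∂(Measure.pi D') ≤ _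
    rw [← integral_finsetSum _ fun j _ => hi j]
    refine (integral_mono (integrable_finsetSum _ fun j _ => hi j) (integrable_const _)
      fun v => M₁.sum_phi_bidder_le _ i).trans ?_
    simp
  · have h1 := (hM.1 i t.1 t.mem_support).2.2 s.1 s.mem_support
    have h2 : ε * vMax D' * ∑ j, M₁.interimPhi D' i t.1 j ≤ ε * ∑ j, M₁.interimPhi D' i t.1 j := by
      refine mul_le_mul_of_nonneg_right ?_ (Finset.sum_nonneg fun j _ => hphi t j)
      exact mul_le_of_le_one_right hε.le (vMax_le_one fun i => (h i).mono fun x hx => hx.1)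
    change ∑ j, s.1 j * M₁.interimPhi D' i t.1 j - M₁.interimPrice D' i t.1 -
      ε * ∑ j, M₁.interimPhi D' i t.1 j ≤ M₁.interimUtility D' i s.1 s.1
    simp only [Mechanism.interimUtility] at h1 ⊢
    linarith

theorem map_singleton {μ : Measure (Typ n)} {g : Equiv.Perm (Fin n)}
    (h : μ.map (fun v => v ∘ g) = μ) (x : Typ n) : μ {x ∘ g} = μ {x} := by
  have hg : Measurable fun v : Typ n => v ∘ g := measurable_pi_lambda _ fun j =>
    measurable_pi_apply _
  conv_lhs => rw [← h, Measure.map_apply hg (measurableSet_singleton _)]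
  congr 1
  ext v
  simp only [Set.mem_preimage, Set.mem_singleton_iff]
  exact g.surjective.injective_comp_right.eq_iff

theorem atomSurrogates_act {g : Equiv.Perm (Fin n)} {i : Fin m}
    (h : (D' i).map (fun v => v ∘ g) = D' i) (s : Atom (D' i)) :
    (atomSurrogates M₁ D' i).act s g = ⟨s.1 ∘ g, by rw [map_singleton h]; exact s.2⟩ :=
  dif_pos _

theorem map_comp_of_grp {sym : Bool} {D : Fin m → Measure (Typ n)}
    (h : sym = true → ItemSymmetric D) {g : Equiv.Perm (Fin n)} (hg : Grp sym g) (i : Fin m) :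
    (D i).map (fun v => v ∘ g) = D i := by
  rcases hg with hs | rfl
  · exact h hs i g
  · exact Measure.map_id

theorem atomLaw_map_act {g : Equiv.Perm (Fin n)} (hδ : 0 < δ) {i : Fin m}
    (hi : ∀ᵐ x ∂(D' i), IsGrid δ x) (h : (D' i).map (fun v => v ∘ g) = D' i) :
    (atomLaw (D' i)).map (fun s => (atomSurrogates M₁ D' i).act s g) = atomLaw (D' i) := by
  have hg : Measurable fun v : Typ n => v ∘ g := measurable_pi_lambda _ fun j =>
    measurable_pi_apply _
  have hae : (fun s => (atomSurrogates M₁ D' i).act s g) ∘ snap (D' i) =ᵐ[D' i]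
      snap (D' i) ∘ fun v => v ∘ g := (ae_atom hδ hi).mono fun x hx => by
    have hx' : D' i {x ∘ g} ≠ 0 := by rwa [map_singleton h]
    simp only [Function.comp_apply]
    rw [snap_of_ne hx, atomSurrogates_act h]
    exact (snap_of_ne hx').symm
  rw [atomLaw, Measure.map_map Measurable.of_discrete measurable_snap, Measure.map_congr hae,
    ← Measure.map_map measurable_snap hg, h]

/-- When one report is relabelled, the other bidders' types may be relabelled simultaneously without
changing their law; the symmetry of the integrand then applies to the whole profile. -/
theorem integral_update_comp {g : Equiv.Perm (Fin n)} (hδ : 0 < δ)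
    (hi : ∀ i, ∀ᵐ x ∂(D' i), IsGrid δ x) (h : ∀ i, (D' i).map (fun v => v ∘ g) = D' i)
    {F F' : Profile m n → ℝ}
    (hF : ∀ v : Profile m n, (∀ i, v i ∈ supports D' i) → F (fun i => v i ∘ g) = F' v)
    (i : Fin m) (s : Atom (D' i)) :
    ∫ v, F (Function.update v i (s.1 ∘ g)) ∂(Measure.pi D') =
      ∫ v, F' (Function.update v i s.1) ∂(Measure.pi D') := by
  rw [integral_pi_atoms hδ hi fun v => F (Function.update v i (s.1 ∘ g)),
    integral_pi_atoms hδ hi fun v => F' (Function.update v i s.1)]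
  have hp : MeasurePreserving (fun (y : ∀ i, Atom (D' i)) k =>
      -- The action does not depend on the mechanism, so the one that sells nothing stands in.
      (atomSurrogates (C := fun _ => 0) ⟨fun _ => PMF.pure ⟨fun _ => none, by simp⟩, 0⟩ D' k).act
        (y k) g) (Measure.pi fun i => atomLaw (D' i)) (Measure.pi fun i => atomLaw (D' i)) :=
    measurePreserving_pi _ _ fun k => ⟨.of_discrete, atomLaw_map_act hδ (hi k) (h k)⟩
  rw [← integral_comp_of_measurePreserving hp (Measurable.of_discrete
    (f := fun y : ∀ i, Atom (D' i) => F (Function.update (fun k => (y k).1) i (s.1 ∘ g))))]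
  refine integral_congr_ae (.of_forall fun y => ?_)
  simp only [atomSurrogates_act (h _)]
  rw [← hF]
  · congr 1
    ext k
    by_cases hk : k = i
    · subst hk; simp
    · simp [hk]
  · intro k
    by_cases hk : k = i
    · subst hk; simpa [supports] using s.mem_support
    · simpa [hk, supports] using (y k).mem_support

theorem compatible_atomSurrogates {sym : Bool} (hδ : 0 < δ)
    (hi : ∀ i, ∀ᵐ x ∂(D' i), IsGrid δ x) (h : sym = true → ItemSymmetric D')
    (hM : sym = true → RespectsItemSymmetry D' M₁) (i : Fin m) :
    (atomSurrogates M₁ D' i).Compatible sym := by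
  have hact : ∀ (s : Atom (D' i)) g (hg : Grp sym g), (atomSurrogates M₁ D' i).act s g =
      ⟨s.1 ∘ g, by rw [map_singleton (map_comp_of_grp h hg i)]; exact s.2⟩ :=
    fun s g hg => atomSurrogates_act (map_comp_of_grp h hg i) s
  refine ⟨fun s g hg => by rw [hact s g hg]; rfl, fun s g hg => ?_, fun s g hg => ?_⟩
  · rw [hact s g hg]
    rcases hg with hs | rfl
    · ext j
      exact integral_update_comp hδ hi (fun i => h hs i g) (F := fun v => M₁.phi v i j)
        (F' := fun v => M₁.phi v i (g j)) (fun v hv => (hM hs g v hv i).2 j) i s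
    · rfl
  · rw [hact s g hg]
    rcases hg with hs | rfl
    · exact integral_update_comp hδ hi (fun i => h hs i g) (F := fun v => M₁.price v i)
        (F' := fun v => M₁.price v i) (fun v hv => (hM hs g v hv i).1) i s
    · rfl

/-! #### Classes of types that arrangements of the items cannot distinguish -/

/-- The levels of the coordinates. -/
def levelVec (δ : ℝ) (x : Typ n) (j : Fin n) : Fin (levels δ) := level δ (x j)

/-- The number of coordinates at each level. -/
def levelCount (δ : ℝ) (x : Typ n) (l : Fin (levels δ)) : Fin (n + 1) :=
  ⟨(Finset.univ.filter fun j => level δ (x j) = l).card,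
    Nat.lt_succ_of_le ((Finset.card_le_univ _).trans (by simp))⟩

theorem IsGrid.eq_of_levelVec (hδ : 0 < δ) {x y : Typ n} (hx : IsGrid δ x) (hy : IsGrid δ y)
    (h : levelVec δ x = levelVec δ y) : x = y := by
  ext j
  have hj : level δ (x j) = level δ (y j) := congrFun h j
  rw [hx.eq_level hδ, hy.eq_level hδ, hj]

/-- With equal level counts the bound of `exists_perm_mismatch_le` is zero, and on the grid a level
determines the value. -/
theorem IsGrid.exists_perm_of_levelCount (hδ : 0 < δ) {x y : Typ n} (hx : IsGrid δ x)
    (hy : IsGrid δ y) (h : levelCount δ x = levelCount δ y) :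
    ∃ g : Equiv.Perm (Fin n), x ∘ g = y := by
  classical
  obtain ⟨μ, hμ⟩ := exists_perm_mismatch_le (levelVec δ y) (levelVec δ x)
  have hcnt : ∀ (x : Typ n) c, cnt (levelVec δ x) c = ((levelCount δ x c : ℕ) : ℝ) := fun x c => by
    simp only [cnt, levelCount, levelVec, Finset.card_filter]
    push_cast
    exact Finset.sum_congr rfl fun k _ => by
      by_cases hk : level δ (x k) = c <;> simp [hk]
  have h0 : (∑ c, |cnt (levelVec δ y) c - cnt (levelVec δ x) c|) / 2 = 0 := by
    simp [hcnt, h]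
  rw [h0] at hμ
  have h1 := (Finset.sum_eq_zero_iff_of_nonneg fun k _ => by split <;> norm_num).1
    (le_antisymm hμ (Finset.sum_nonneg fun k _ => by split <;> norm_num))
  refine ⟨μ, ?_⟩
  ext j
  have hj : level δ (y j) = level δ (x (μ j)) := by
    by_contra hne
    have := h1 j (Finset.mem_univ j)
    simp [levelVec, hne] at this
  rw [Function.comp_apply, hx.eq_level hδ, hy.eq_level hδ, hj]

/-- The number of classes of types. -/
def classCount (sym : Bool) (n : ℕ) (δ : ℝ) : ℕ :=
  -- Polynomial in `n` for fixed `δ` in the symmetric case; in the other case the exponent is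
  -- constant only for fixed `n`.
  if sym then (n + 1) ^ levels δ else levels δ ^ n

/-- The transformed mechanism of `M₁`. -/
def BICTransform (M₁ : Mechanism C n) (sym : Bool) (η : ℝ) {r : ℕ} (D D' : Fin m → Measure (Typ n))
    (lpos : Measure (Fin r)) (lperm : Measure (Equiv.Perm (Fin n)))
    [∀ i, IsProbabilityMeasure (D i)] [∀ i, IsProbabilityMeasure (D' i)]
    [∀ i, Nonempty (Atom (D' i))] [∀ i, Fintype (Atom (D' i))]
    [IsProbabilityMeasure lpos] [IsProbabilityMeasure lperm] : Mechanism C n :=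
  transformed M₁ sym (max (1 - η) 0) (atomSurrogates M₁ D') D (fun i => atomLaw (D' i)) lpos lperm

variable {sym : Bool} {r : ℕ} {D : Fin m → Measure (Typ n)} {lpos : Measure (Fin r)}
  {lperm : Measure (Equiv.Perm (Fin n))} [∀ i, IsProbabilityMeasure (D i)]
  [IsProbabilityMeasure lpos] [IsProbabilityMeasure lperm]

/-- The coupling is moved to the atoms by `snap`, which almost surely changes nothing, so the bounds
on the coordinates persist. -/
theorem isBICTransform_of_cls {K : Type} [Fintype K] {η ε : ℝ} (hδ : 0 < δ) (hη : 0 < η)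
    (hε : 0 < ε) (hdc : DiscretizedCoupled δ D D') (hM : IsInputMechanism D' η ε M₁)
    (hD : sym = true → ItemSymmetric D) (hD' : sym = true → ItemSymmetric D')
    (hsym : sym = true → RespectsItemSymmetry D' M₁)
    (hpos : ∀ σ : Equiv.Perm (Fin r), lpos.map σ = lpos)
    (hperm : ∀ σ, Grp sym σ → lperm.map (fun g => σ * g⁻¹) = lperm)
    (hgrp : ∀ᵐ g ∂lperm, Grp sym g) (hr : 0 < r) (hra : Fintype.card K * (m / δ) ^ 2 ≤ r)
    (cls : Typ n → K)
    (hcls : ∀ x y, IsGrid δ x → IsGrid δ y → cls x = cls y → ∃ g, Grp sym g ∧ x ∘ g = y) :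
    IsBICTransform D D' δ η ε M₁ (BICTransform M₁ sym η D D' lpos lperm) := by
  have hgrid : ∀ i, ∀ᵐ x ∂(D' i), IsGrid δ x := fun i =>
    (hdc.2.1 i).mp ((hdc.2.2.1 i).mono fun x h1 h2 => ⟨h2, h1⟩)
  choose γ hγ1 hγ2 hγ3 using hdc.2.2.2
  refine transformed_isBICTransform hδ hη hε (interim_atomSurrogates hδ hgrid)
    (fun i => ⟨fun g hg => map_comp_of_grp hD hg i,
      fun g hg => atomLaw_map_act hδ (hgrid i) (map_comp_of_grp hD' hg i), hpos, hperm, hgrp⟩)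
    (compatible_atomSurrogates hδ hgrid hD' hsym)
    (admissible_atomSurrogates hε hgrid hM) hdc.1 (fun i s => cls s.1) ?_
    (fun i => (γ i).map (Prod.map id (snap (D' i)))) ?_ ?_ ?_ hr hra
    (integral_pi_atoms hδ hgrid fun v => ∑ i, M₁.price v i) hM.2.2
  · intro i s t hst
    obtain ⟨g, hg, hgst⟩ := hcls _ _ (Atom.of_ae (hgrid i) s) (Atom.of_ae (hgrid i) t) hst
    refine ⟨g, hg, ?_⟩
    rw [atomSurrogates_act (map_comp_of_grp hD' hg i)]
    exact Subtype.ext hgst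
  · intro i
    rw [Measure.map_map measurable_fst (measurable_id.prodMap measurable_snap)]
    exact hγ1 i
  · intro i
    have := congrArg (Measure.map (snap (D' i))) (hγ2 i)
    rw [Measure.map_map measurable_snap measurable_snd] at this
    rw [Measure.map_map measurable_snd (measurable_id.prodMap measurable_snap)]
    exact this
  · intro i
    have hq : Measure.QuasiMeasurePreserving Prod.snd (γ i) (D' i) :=
      ⟨measurable_snd, (hγ2 i).le.absolutelyContinuous⟩
    have hval : ∀ j, Measurable fun p : Typ n × Atom (D' i) => p.2.1 j := fun j =>
      (measurable_pi_apply j).comp (measurable_subtype_coe.comp measurable_snd)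
    have hfst : ∀ j, Measurable fun p : Typ n × Atom (D' i) => p.1 j := fun j =>
      (measurable_pi_apply j).comp measurable_fst
    rw [ae_map_iff (measurable_id.prodMap measurable_snap).aemeasurable]
    · filter_upwards [hγ3 i, hq.ae (ae_atom hδ (hgrid i))] with p h1 h2 j
      simp only [Prod.map, snap_of_ne h2, id]
      exact ⟨(h1 j).1, sub_le_iff_le_add.1 (h1 j).2⟩
    · simp only [Set.ofPred_forall]
      exact .iInter fun j => (measurableSet_le (hval j) (hfst j)).inter
        (measurableSet_le (hfst j) ((hval j).add_const δ))

theorem isBICTransform {η ε : ℝ} (hδ : 0 < δ) (hη : 0 < η)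
    (hε : 0 < ε) (hdc : DiscretizedCoupled δ D D') (hM : IsInputMechanism D' η ε M₁)
    (hD : sym = true → ItemSymmetric D) (hD' : sym = true → ItemSymmetric D')
    (hsym : sym = true → RespectsItemSymmetry D' M₁)
    (hpos : ∀ σ : Equiv.Perm (Fin r), lpos.map σ = lpos)
    (hperm : ∀ σ, Grp sym σ → lperm.map (fun g => σ * g⁻¹) = lperm)
    (hgrp : ∀ᵐ g ∂lperm, Grp sym g) (hr : 0 < r) (hra : classCount sym n δ * (m / δ) ^ 2 ≤ r) :
    IsBICTransform D D' δ η ε M₁ (BICTransform M₁ sym η D D' lpos lperm) := by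
  cases sym with
  | true =>
    refine isBICTransform_of_cls (K := Fin (levels δ) → Fin (n + 1)) hδ hη hε hdc hM hD hD' hsym
      hpos hperm hgrp hr (by simpa [classCount] using hra) (levelCount δ) fun x y hx hy h => ?_
    obtain ⟨g, hg⟩ := hx.exists_perm_of_levelCount hδ hy h
    exact ⟨g, .inl rfl, hg⟩
  | false =>
    refine isBICTransform_of_cls (K := Fin n → Fin (levels δ)) hδ hη hε hdc hM hD hD' hsym
      hpos hperm hgrp hr (by simpa [classCount] using hra) (levelVec δ) fun x y hx hy h => ?_
    exact ⟨1, .one, hx.eq_of_levelVec hδ hy h⟩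

end InputMechanism


/-! ### Random permutations from coins -/

section Shuffle

variable {k : ℕ}

/-- The permutation that sorts the coins. -/
def shuffle (U : Fin k → ℝ) : Equiv.Perm (Fin k) := solve fun j l => U j * (l : ℕ)

theorem measurable_shuffle : Measurable (shuffle : (Fin k → ℝ) → Equiv.Perm (Fin k)) :=
  measurable_solve fun j _ => (measurable_pi_apply j).mul_const _

/-- Independent uniform coins. -/
def coinLaw (k : ℕ) : Measure (Fin k → ℝ) := Measure.pi fun _ => unif

instance : IsProbabilityMeasure (coinLaw k) := by unfold coinLaw; infer_instance

/-- The zeros of a nonzero linear functional form a proper subspace, which is a null set. -/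
theorem ae_sum_mul_ne_zero {a : Fin k → ℝ} (ha : a ≠ 0) :
    ∀ᵐ U ∂(coinLaw k), ∑ j, U j * a j ≠ 0 := by
  have h1 : coinLaw k = (volume : Measure (Fin k → ℝ)).restrict
      (Set.univ.pi fun _ => Set.Icc 0 1) := by
    rw [volume_pi, Measure.restrict_pi_pi]; rfl
  rw [h1]
  refine ae_restrict_of_ae ?_
  let L : (Fin k → ℝ) →ₗ[ℝ] ℝ := ∑ j, a j • LinearMap.proj j
  have hL : ∀ U, L U = ∑ j, U j * a j := fun U => by
    simp [L, LinearMap.sum_apply, mul_comm]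
  have h2 := Measure.addHaar_submodule (volume : Measure (Fin k → ℝ)) (LinearMap.ker L) ?_
  · rw [ae_iff]
    refine measure_mono_null (fun U hU => ?_) h2
    simp only [ne_eq, not_not] at hU
    simpa [hL] using hU
  · rw [Ne, LinearMap.ker_eq_top]
    intro h
    apply ha
    ext i
    have := congrArg (fun f : (Fin k → ℝ) →ₗ[ℝ] ℝ => f (Pi.single i 1)) h
    simp only [hL, LinearMap.zero_apply] at this
    rw [Finset.sum_eq_single i] at this
    · simpa using this
    · intro j _ hj; simp [hj]
    · simp

/-- Almost surely all permutations have different weights, so the optimal assignment of the coins is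
unique. -/
theorem ae_sum_ne {k : ℕ} : ∀ᵐ U ∂(coinLaw k), ∀ σ τ : Equiv.Perm (Fin k), σ ≠ τ →
    ∑ j, U j * ((σ j : ℕ) : ℝ) ≠ ∑ j, U j * ((τ j : ℕ) : ℝ) := by
  rw [ae_all_iff]
  intro σ
  rw [ae_all_iff]
  intro τ
  by_cases h : σ = τ
  · simp [h]
  have ha : (fun j => ((σ j : ℕ) : ℝ) - ((τ j : ℕ) : ℝ)) ≠ 0 := by
    intro h0
    apply h
    ext j
    have := congrFun h0 j
    simp only [Pi.zero_apply, sub_eq_zero] at this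
    exact_mod_cast this
  refine (ae_sum_mul_ne_zero ha).mono fun U hU _ he => hU ?_
  simp only [mul_sub, Finset.sum_sub_distrib, he, sub_self]

/-- Permuting the coins permutes the set of optimal assignments. Uniqueness of the optimum makes
`shuffle` equivariant, however `solve` breaks ties. -/
theorem shuffle_comp {U : Fin k → ℝ} (hU : ∀ σ τ : Equiv.Perm (Fin k), σ ≠ τ →
    ∑ j, U j * ((σ j : ℕ) : ℝ) ≠ ∑ j, U j * ((τ j : ℕ) : ℝ)) (h : Equiv.Perm (Fin k)) :
    shuffle (U ∘ h) = shuffle U * h := by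
  have e : ∀ σ : Equiv.Perm (Fin k), ∑ j, (U ∘ h) j * ((σ j : ℕ) : ℝ) =
      ∑ j, U j * (((σ * h⁻¹) j : ℕ) : ℝ) := fun σ => by
    rw [← Equiv.sum_comp h fun j => U j * (((σ * h⁻¹) j : ℕ) : ℝ)]
    simp
  have h1 := sum_le_solve (fun j (l : Fin k) => U j * ((l : ℕ) : ℝ)) (shuffle (U ∘ h) * h⁻¹)
  have h2 := sum_le_solve (fun j (l : Fin k) => (U ∘ h) j * ((l : ℕ) : ℝ)) (shuffle U * h)
  rw [e, e, mul_inv_cancel_right] at h2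
  by_contra hne
  exact hU (shuffle (U ∘ h) * h⁻¹) (shuffle U) (fun h3 => hne (by rw [← h3]; simp)) (le_antisymm h1 h2)

/-- The law of the random permutation. -/
def shuffleLaw (k : ℕ) : Measure (Equiv.Perm (Fin k)) := (coinLaw k).map shuffle

/-- The coins are exchangeable, so equivariance becomes invariance of the law; since translations
act transitively, the law is uniform. -/
theorem shuffleLaw_map_mul_right (h : Equiv.Perm (Fin k)) :
    (shuffleLaw k).map (fun σ => σ * h) = shuffleLaw k := by
  have hp : MeasurePreserving (fun U : Fin k → ℝ => U ∘ h) (coinLaw k) (coinLaw k) := by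
    have hm : Measurable fun U : Fin k → ℝ => U ∘ h :=
      measurable_pi_lambda _ fun j => measurable_pi_apply _
    refine ⟨hm, (Measure.pi_eq fun s hs => ?_).symm⟩
    rw [Measure.map_apply hm (.univ_pi hs)]
    have : (fun U : Fin k → ℝ => U ∘ h) ⁻¹' Set.univ.pi s = Set.univ.pi fun j => s (h.symm j) := by
      ext U
      simp only [Set.mem_preimage, Set.mem_pi, Set.mem_univ, true_imp_iff]
      constructor
      · intro hU j
        simpa using hU (h.symm j)
      · intro hU j
        simpa using hU (h j)
    rw [this, coinLaw, Measure.pi_pi, Equiv.prod_comp h.symm fun j => unif (s j)]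
  have hae : (fun σ => σ * h) ∘ shuffle =ᵐ[coinLaw k] shuffle ∘ fun U : Fin k → ℝ => U ∘ h :=
    ae_sum_ne.mono fun U hU => (shuffle_comp hU h).symm
  rw [shuffleLaw, Measure.map_map Measurable.of_discrete measurable_shuffle,
    Measure.map_congr hae, ← Measure.map_map measurable_shuffle hp.measurable, hp.map_eq]

theorem shuffleLaw_singleton (σ : Equiv.Perm (Fin k)) : shuffleLaw k {σ} = shuffleLaw k {1} := by
  conv_rhs => rw [← shuffleLaw_map_mul_right σ⁻¹,
    Measure.map_apply Measurable.of_discrete (measurableSet_singleton _)]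
  congr 1
  ext τ
  simp

theorem shuffleLaw_map (f : Equiv.Perm (Equiv.Perm (Fin k))) :
    (shuffleLaw k).map f = shuffleLaw k := by
  refine Measure.ext_of_singleton fun σ => ?_
  rw [Measure.map_apply Measurable.of_discrete (measurableSet_singleton _), shuffleLaw_singleton σ,
    ← Equiv.image_symm_eq_preimage, Set.image_singleton, shuffleLaw_singleton]

/-- A random permutation of the items that is used for symmetrization. -/
def relabel (sym : Bool) (U : Fin k → ℝ) : Equiv.Perm (Fin k) := if sym then shuffle U else 1

theorem measurable_relabel (sym : Bool) :
    Measurable (relabel sym : (Fin k → ℝ) → Equiv.Perm (Fin k)) := by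
  cases sym
  · exact measurable_const
  · exact measurable_shuffle

/-- The law of the relabelling of the items. -/
def relabelLaw (sym : Bool) (k : ℕ) : Measure (Equiv.Perm (Fin k)) := (coinLaw k).map (relabel sym)

instance (sym : Bool) : IsProbabilityMeasure (relabelLaw sym k) :=
  Measure.isProbabilityMeasure_map (measurable_relabel sym).aemeasurable

theorem grp_relabel (sym : Bool) (U : Fin k → ℝ) : Grp sym (relabel sym U) := by
  cases sym <;> simp [relabel, Grp]

theorem ae_grp_relabelLaw (sym : Bool) : ∀ᵐ g ∂(relabelLaw sym k), Grp sym g := by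
  rw [relabelLaw, ae_map_iff (measurable_relabel sym).aemeasurable .of_discrete]
  exact .of_forall fun U => grp_relabel sym U

theorem relabelLaw_map (sym : Bool) {σ : Equiv.Perm (Fin k)} (hσ : Grp sym σ) :
    (relabelLaw sym k).map (fun g => σ * g⁻¹) = relabelLaw sym k := by
  cases sym with
  | true => exact shuffleLaw_map ((Equiv.inv _).trans (Equiv.mulLeft σ))
  | false =>
    obtain rfl : σ = 1 := by simpa [Grp] using hσ
    rw [relabelLaw, Measure.map_map Measurable.of_discrete (measurable_relabel _)]
    congr 1

/-- A random position from coins. -/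
def position [NeZero k] (U : Fin k → ℝ) : Fin k := shuffle U 0

theorem measurable_position [NeZero k] : Measurable (position : (Fin k → ℝ) → Fin k) :=
  measurable_of_discrete_left measurable_shuffle fun σ => σ 0

/-- The law of the random position. -/
def positionLaw (k : ℕ) [NeZero k] : Measure (Fin k) := (coinLaw k).map position

instance [NeZero k] : IsProbabilityMeasure (positionLaw k) :=
  Measure.isProbabilityMeasure_map measurable_position.aemeasurable

theorem positionLaw_map [NeZero k] (σ : Equiv.Perm (Fin k)) :
    (positionLaw k).map σ = positionLaw k := by
  have h : positionLaw k = (shuffleLaw k).map fun τ => τ 0 := by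
    rw [shuffleLaw, Measure.map_map Measurable.of_discrete measurable_shuffle]
    rfl
  rw [h, Measure.map_map Measurable.of_discrete Measurable.of_discrete]
  conv_rhs => rw [← shuffleLaw_map (Equiv.mulLeft σ),
    Measure.map_map Measurable.of_discrete Measurable.of_discrete]
  rfl

end Shuffle

/-! ### The randomness of the bidders from the draws -/

section Draws

/-- Draws at distinct times are independent, so it suffices to give every purpose its own time
index. -/
theorem measurePreserving_comp_injective {J X : Type*} [Fintype J] [MeasurableSpace X]
    (μ : Measure X) [IsProbabilityMeasure μ] {e : J → ℕ} (he : Function.Injective e) :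
    MeasurePreserving (fun (ω : ℕ → X) j => ω (e j)) (Measure.infinitePi fun _ => μ)
      (Measure.pi fun _ => μ) := by
  classical
  have hm : Measurable fun (ω : ℕ → X) j => ω (e j) :=
    measurable_pi_lambda _ fun j => measurable_pi_apply _
  refine ⟨hm, (Measure.pi_eq fun s hs => ?_).symm⟩
  rcases isEmpty_or_nonempty J with hJ | hJ
  · rw [Measure.map_apply hm (.univ_pi hs)]
    have : (fun (ω : ℕ → X) j => ω (e j)) ⁻¹' Set.univ.pi s = Set.univ :=
      Set.eq_univ_of_forall fun ω j => isEmptyElim j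
    simp [this]
  rw [Measure.map_apply hm (.univ_pi hs)]
  have : (fun (ω : ℕ → X) j => ω (e j)) ⁻¹' Set.univ.pi s =
      Set.pi (Finset.univ.image e : Finset ℕ) fun t => s (Function.invFun e t) := by
    ext ω
    simp only [Set.mem_preimage, Set.mem_pi, Set.mem_univ, true_imp_iff, Finset.coe_image,
      Finset.coe_univ, Set.image_univ, Set.forall_mem_range, Function.leftInverse_invFun he _]
  rw [this, Measure.infinitePi_pi _ fun _ _ => hs _, Finset.prod_image fun _ _ _ _ h => he h]
  simp only [Function.leftInverse_invFun he _]

theorem measurePreserving_sum {J L X : Type*} [Fintype J] [Fintype L] [MeasurableSpace X]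
    (μ : Measure X) [IsProbabilityMeasure μ] :
    MeasurePreserving (fun y : J ⊕ L → X => (fun j => y (.inl j), fun l => y (.inr l)))
      (Measure.pi fun _ => μ) ((Measure.pi fun _ => μ).prod (Measure.pi fun _ => μ)) :=
  measurePreserving_sumPiEquivProdPi (X := fun _ : J ⊕ L => X) fun _ => μ

theorem measurePreserving_curry {J L X : Type*} [Fintype J] [Fintype L] [MeasurableSpace X]
    (μ : Measure X) [IsProbabilityMeasure μ] :
    MeasurePreserving (fun (y : J × L → X) j l => y (j, l))
      (Measure.pi fun _ => μ) (Measure.pi fun _ => Measure.pi fun _ => μ) := by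
  refine ⟨by fun_prop, ?_⟩
  have h := Measure.infinitePi_map_curry fun (_ : J) (_ : L) => μ
  simp only [Measure.infinitePi_eq_pi] at h
  exact h

/-- The draws of one bidder: replicas, surrogates, coins for the position, coins for the
relabelling of the items. -/
abbrev Slot (r n : ℕ) := Fin r ⊕ (Fin r ⊕ (Fin r ⊕ Fin n))

/-- The number of draws of one bidder. -/
def slots (r n : ℕ) : ℕ := 3 * r + n

/-- The time of a draw, relative to the first draw of the bidder. -/
def slotTime (r n : ℕ) : Slot r n → ℕ
  | .inl k => k
  | .inr (.inl k) => r + k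
  | .inr (.inr (.inl k)) => 2 * r + k
  | .inr (.inr (.inr j)) => 3 * r + j

theorem slotTime_lt (r n : ℕ) (t : Slot r n) : slotTime r n t < slots r n := by
  rcases t with k | k | k | k <;> simp only [slotTime, slots] <;> omega

theorem slotTime_injective (r n : ℕ) : Function.Injective (slotTime r n) := by
  rintro (k | k | k | k) (l | l | l | l) h <;> simp only [slotTime] at h <;>
    first
      | (have := Fin.ext (a := k) (b := l) (by omega); subst this; rfl)
      | omega

/-- The time of a draw; the last draw is for the inner mechanism. -/
def drawTime (m r n : ℕ) : (Fin m × Slot r n) ⊕ Unit → ℕ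
  | .inl p => p.1 * slots r n + slotTime r n p.2
  | .inr _ => m * slots r n

theorem drawTime_injective (m r n : ℕ) : Function.Injective (drawTime m r n) := by
  have hlt : ∀ p : Fin m × Slot r n, p.1 * slots r n + slotTime r n p.2 < m * slots r n := by
    intro p
    have h1 := slotTime_lt r n p.2
    have h2 : (p.1 + 1) * slots r n ≤ m * slots r n := Nat.mul_le_mul_right _ p.1.2
    rw [add_mul, one_mul] at h2
    omega
  rintro (p | p) (q | q) h <;> simp only [drawTime] at h
  · have h1 := slotTime_lt r n p.2
    have h2 := slotTime_lt r n q.2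
    have hp : 0 < slots r n := by omega
    have e1 : (p.1 : ℕ) = q.1 := by
      have := congrArg (· / slots r n) h
      simp only [mul_comm _ (slots r n), Nat.mul_add_div hp, Nat.div_eq_of_lt h1,
        Nat.div_eq_of_lt h2] at this
      simpa using this
    rw [e1] at h
    have e2 := slotTime_injective r n (Nat.add_left_cancel h)
    rw [Prod.ext (Fin.ext e1) e2]
  · have := hlt p; omega
  · have := hlt q; omega
  · rfl

variable {m n r : ℕ} [NeZero r] (sym : Bool) (D D' : Fin m → Measure (Typ n))
  [∀ i, Nonempty (Atom (D' i))]

/-- The randomness of bidder `i` from her draws. -/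
def blockRand (i : Fin m) (y : Slot r n → Draw m n) : Rand r n (Atom (D' i)) :=
  (fun k => (y (.inl k)).1.1 i, (fun k => snap (D' i) ((y (.inr (.inl k))).1.2 i),
    (position fun k => (y (.inr (.inr (.inl k)))).2.1,
      relabel sym fun j => (y (.inr (.inr (.inr j)))).2.1)))

/-- The randomness of the bidders and the coin of the inner mechanism. -/
def extract (ω : ℕ → Draw m n) : (∀ i, Rand r n (Atom (D' i))) × ℝ :=
  (fun i => blockRand sym D' i fun t => ω (drawTime m r n (.inl (i, t))),
    (ω (drawTime m r n (.inr ()))).2.2)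

variable [∀ i, IsProbabilityMeasure (D i)] [∀ i, IsProbabilityMeasure (D' i)]
  [∀ i, Finite (Atom (D' i))]

theorem measurePreserving_blockRand (i : Fin m) :
    MeasurePreserving (blockRand (r := r) sym D' i)
      (Measure.pi fun _ => ((Measure.pi D).prod (Measure.pi D')).prod (unif.prod unif))
      (randLaw r (D i) (atomLaw (D' i)) (positionLaw r) (relabelLaw sym n)) := by
  obtain ⟨μ, hμ⟩ : ∃ μ, μ = ((Measure.pi D).prod (Measure.pi D')).prod (unif.prod unif) := ⟨_, rfl⟩
  have : IsProbabilityMeasure μ := by rw [hμ]; infer_instance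
  rw [← hμ]
  have d1 : MeasurePreserving (fun d : Draw m n => d.1.1 i) μ (D i) :=
    hμ ▸ (measurePreserving_eval D i).comp (measurePreserving_fst.comp measurePreserving_fst)
  have d2 : MeasurePreserving (fun d : Draw m n => snap (D' i) (d.1.2 i)) μ (atomLaw (D' i)) :=
    hμ ▸ (⟨measurable_snap, rfl⟩ : MeasurePreserving (snap (D' i)) (D' i) (atomLaw (D' i))).comp
      ((measurePreserving_eval D' i).comp (measurePreserving_snd.comp measurePreserving_fst))
  have d3 : MeasurePreserving (fun d : Draw m n => d.2.1) μ unif :=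
    hμ ▸ measurePreserving_fst.comp measurePreserving_snd
  have p1 := measurePreserving_pi (ι := Fin r) _ _ fun _ => d1
  have p2 := measurePreserving_pi (ι := Fin r) _ _ fun _ => d2
  have p3 : MeasurePreserving (position : (Fin r → ℝ) → Fin r) (Measure.pi fun _ => unif)
    (positionLaw r) := ⟨measurable_position, rfl⟩
  have p4 : MeasurePreserving (relabel sym : (Fin n → ℝ) → Equiv.Perm (Fin n))
    (Measure.pi fun _ => unif) (relabelLaw sym n) := ⟨measurable_relabel sym, rfl⟩
  have q3 := p3.comp (measurePreserving_pi (ι := Fin r) _ _ fun _ => d3)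
  have q4 := p4.comp (measurePreserving_pi (ι := Fin n) _ _ fun _ => d3)
  exact (p1.prod ((p2.prod ((q3.prod q4).comp (measurePreserving_sum μ))).comp
    (measurePreserving_sum μ))).comp (measurePreserving_sum μ)

theorem measurePreserving_extract :
    MeasurePreserving (extract (r := r) sym D') (drawLaw D D')
      ((Measure.pi fun i => randLaw r (D i) (atomLaw (D' i)) (positionLaw r)
        (relabelLaw sym n)).prod unif) := by
  have h1 := measurePreserving_comp_injective
    (((Measure.pi D).prod (Measure.pi D')).prod (unif.prod unif)) (drawTime_injective m r n)
  have h2 := measurePreserving_sum (J := Fin m × Slot r n) (L := Unit)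
    (((Measure.pi D).prod (Measure.pi D')).prod (unif.prod unif))
  have h3 := (measurePreserving_pi _ _ fun i => measurePreserving_blockRand (r := r) sym D D' i).comp
    (measurePreserving_curry (J := Fin m) (L := Slot r n)
      (((Measure.pi D).prod (Measure.pi D')).prod (unif.prod unif)))
  have h4 : MeasurePreserving (fun y : Unit → Draw m n => (y ()).2.2)
      (Measure.pi fun _ => ((Measure.pi D).prod (Measure.pi D')).prod (unif.prod unif)) unif :=
    (measurePreserving_snd.comp measurePreserving_snd).comp (measurePreserving_eval _ ())
  exact (h3.prod h4).comp (h2.comp h1)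

end Draws


/-! ### The outcome of a run as a random variable. -/

section Output

set_option linter.unusedSectionVars false

variable {m n r : ℕ} [NeZero r] {C : Fin m → ℕ} (M₁ : Mechanism C n) (sym : Bool) (η : ℝ)
  {D D' : Fin m → Measure (Typ n)} [∀ i, Nonempty (Atom (D' i))]
  (run : Profile m n → ℝ → Alloc C n)

/-- The surrogate outcomes of the bidders, from the draws. -/
def picks (D' : Fin m → Measure (Typ n)) [∀ i, Nonempty (Atom (D' i))] (v : Profile m n)
    (ω : ℕ → Draw m n) (i : Fin m) : Atom (D' i) × Bool :=
  (atomSurrogates M₁ D' i).pick sym (max (1 - η) 0) (v i) ((extract (r := r) sym D' ω).1 i)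

/-- The allocation, from the draws. -/
def allocOf (r : ℕ) [NeZero r] (D' : Fin m → Measure (Typ n)) [∀ i, Nonempty (Atom (D' i))]
    (v : Profile m n) (ω : ℕ → Draw m n) : Alloc C n :=
  keep (fun i => (picks (r := r) M₁ sym η D' v ω i).2)
    (run (fun i => (picks (r := r) M₁ sym η D' v ω i).1.1) (ω (m * slots r n)).2.2)

/-- The prices, from the draws. -/
def payOf (r : ℕ) [NeZero r] (D' : Fin m → Measure (Typ n)) [∀ i, Nonempty (Atom (D' i))]
    (v : Profile m n) (ω : ℕ → Draw m n) (i : Fin m) : ℝ :=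
  (atomSurrogates M₁ D' i).pay sym (max (1 - η) 0) (v i) ((extract (r := r) sym D' ω).1 i)

variable [∀ i, IsProbabilityMeasure (D i)] [∀ i, IsProbabilityMeasure (D' i)]
  [∀ i, Fintype (Atom (D' i))] {M₁ sym η run}

/-- The coin of the inner mechanism is independent of the surrogates, of which there are finitely
many, so the law is a finite mixture. -/
theorem outcome_eq {G : Type} [Fintype G] [MeasurableSpace G] [DiscreteMeasurableSpace G]
    (P : Measure G) [IsProbabilityMeasure P] (s : G → Profile m n) (b : G → Fin m → Bool)
    (hrun : IsSampler M₁ run) (a : Alloc C n) :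
    MeasurableSet {p : G × ℝ | keep (b p.1) (run (s p.1) p.2) = a} ∧
    P.prod unif {p : G × ℝ | keep (b p.1) (run (s p.1) p.2) = a} =
      (P.toPMF.bind fun z => (M₁.outcome (s z)).map (keep (b z))) a := by
  classical
  have h1 : ∀ z, {u | keep (b z) (run (s z) u) = a} =
      ⋃ c ∈ (Finset.univ.filter fun c => a = keep (b z) c), {u | run (s z) u = c} := fun z => by
    ext u; simp [eq_comm]
  have h2 : ∀ z, MeasurableSet {u | keep (b z) (run (s z) u) = a} := fun z => by
    rw [h1]
    exact Finset.measurableSet_biUnion _ fun c _ => (hrun (s z) c).1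
  have h3 : ∀ z, unif {u | keep (b z) (run (s z) u) = a} = (M₁.outcome (s z)).map (keep (b z)) a := by
    intro z
    rw [h1, measure_biUnion_finset, PMF.map_apply, tsum_fintype, Finset.sum_filter]
    · exact Finset.sum_congr rfl fun c _ => by
        rw [(hrun (s z) c).2]
        by_cases hc : a = keep (b z) c <;> simp [hc]
    · intro c _ d _ hcd
      exact Set.disjoint_left.2 fun u hu hu' => hcd (hu.symm.trans hu')
    · exact fun c _ => (hrun (s z) c).1
  have h4 : MeasurableSet {p : G × ℝ | keep (b p.1) (run (s p.1) p.2) = a} := by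
    have : {p : G × ℝ | keep (b p.1) (run (s p.1) p.2) = a} =
        ⋃ z, {z} ×ˢ {u | keep (b z) (run (s z) u) = a} := by
      ext ⟨z, u⟩; simp
    rw [this]
    exact .iUnion fun z => (measurableSet_singleton z).prod (h2 z)
  refine ⟨h4, ?_⟩
  rw [Measure.prod_apply h4, lintegral_fintype, PMF.bind_apply, tsum_fintype]
  refine Finset.sum_congr rfl fun z _ => ?_
  rw [Measure.toPMF_apply, ← h3, mul_comm]
  rfl

theorem allocOf_law (hrun : IsSampler M₁ run) (v : Profile m n) (a : Alloc C n) :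
    MeasurableSet {ω | allocOf M₁ sym η run r D' v ω = a} ∧
    drawLaw D D' {ω | allocOf M₁ sym η run r D' v ω = a} =
      (BICTransform M₁ sym η D D' (positionLaw r) (relabelLaw sym n)).outcome v a := by
  have hp : MeasurePreserving (fun ω i => picks (r := r) M₁ sym η D' v ω i) (drawLaw D D')
      (Measure.pi fun i => pickLaw sym (max (1 - η) 0) (atomSurrogates M₁ D') D
        (fun i => atomLaw (D' i)) (positionLaw r) (relabelLaw sym n) i (v i)) :=
    (measurePreserving_pi _ _ fun i => ⟨measurable_pick measurable_const measurable_id, rfl⟩).comp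
      (measurePreserving_fst.comp (measurePreserving_extract sym D D'))
  have hq : MeasurePreserving (fun ω => ((fun i => picks (r := r) M₁ sym η D' v ω i),
      (ω (m * slots r n)).2.2)) (drawLaw D D')
      ((Measure.pi fun i => pickLaw sym (max (1 - η) 0) (atomSurrogates M₁ D') D
        (fun i => atomLaw (D' i)) (positionLaw r) (relabelLaw sym n) i (v i)).prod unif) :=
    (MeasurePreserving.prod (measurePreserving_pi _ _ fun i =>
      ⟨measurable_pick measurable_const measurable_id, rfl⟩) (.id unif)).comp
      (measurePreserving_extract sym D D')
  have hinst : ∀ i, IsProbabilityMeasure (pickLaw sym (max (1 - η) 0) (atomSurrogates M₁ D') D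
      (fun i => atomLaw (D' i)) (positionLaw r) (relabelLaw sym n) i (v i)) := fun i =>
    Measure.isProbabilityMeasure_map (measurable_pick measurable_const measurable_id).aemeasurable
  obtain ⟨h1, h2⟩ := outcome_eq (Measure.pi fun i => pickLaw sym (max (1 - η) 0)
    (atomSurrogates M₁ D') D (fun i => atomLaw (D' i)) (positionLaw r) (relabelLaw sym n) i (v i))
    (fun z i => (z i).1.1) (fun z i => (z i).2) hrun a
  refine ⟨hq.measurable h1, ?_⟩
  have h3 := hq.measure_preimage h1.nullMeasurableSet
  rw [h2] at h3
  exact h3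

theorem payOf_law (hD : ∀ i, ∀ᵐ v ∂(D i), v ∈ cube n) {v : Profile m n} (hv : ∀ i, v i ∈ cube n)
    (i : Fin m) :
    Integrable (fun ω => payOf M₁ sym η r D' v ω i) (drawLaw D D') ∧
    ∫ ω, payOf M₁ sym η r D' v ω i ∂(drawLaw D D') =
      (BICTransform M₁ sym η D D' (positionLaw r) (relabelLaw sym n)).price v i := by
  have hp : MeasurePreserving (fun ω => (extract (r := r) sym D' ω).1 i) (drawLaw D D')
      (randLaw r (D i) (atomLaw (D' i)) (positionLaw r) (relabelLaw sym n)) :=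
    (measurePreserving_eval _ i).comp
      (measurePreserving_fst.comp (measurePreserving_extract sym D D'))
  exact ⟨hp.integrable_comp_of_integrable (integrable_pay (hD i) (hv i)),
    integral_comp_of_measurePreserving hp (measurable_pay measurable_const measurable_id)⟩

theorem measurePreserving_draw (t : ℕ) :
    MeasurePreserving (fun ω : ℕ → Draw m n => ω t) (drawLaw D D')
      (((Measure.pi D).prod (Measure.pi D')).prod (unif.prod unif)) :=
  measurePreserving_eval_infinitePi _ t

/-- Almost surely all sampled surrogates are atoms. The program can use the sampled vectors as they
are, and `snap` need not be computed. -/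
theorem ae_draw_atom {δ : ℝ} (hδ : 0 < δ) (h : ∀ i, ∀ᵐ x ∂(D' i), IsGrid δ x) :
    ∀ᵐ ω ∂(drawLaw D D'), ∀ t i, D' i {(ω t).1.2 i} ≠ 0 := by
  rw [ae_all_iff]
  intro t
  rw [ae_all_iff]
  intro i
  have hp : MeasurePreserving (fun ω : ℕ → Draw m n => (ω t).1.2 i) (drawLaw D D') (D' i) :=
    (measurePreserving_eval D' i).comp (measurePreserving_snd.comp (measurePreserving_fst.comp
      (measurePreserving_draw t)))
  exact hp.quasiMeasurePreserving.ae (ae_atom hδ (h i))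

end Output


/-! ### The computation of the matching, the surrogate and the price -/

namespace Comp

variable {X : Type*} {O : X → Val → Val → Prop} {F : X → Val} {r n : X → ℕ}

theorem vecComp {v : ∀ x, Typ (n x)} {g : ∀ x, Equiv.Perm (Fin (n x))}
    (hv : Comp O F fun x => .vec (v x)) (hg : Comp O F fun x => .perm (g x)) :
    Comp O F fun x => .vec (v x ∘ g x) :=
  vecLam (v := fun x => v x ∘ g x) (rng_of_family hv)
    (vecApp (r := fun y : (x : X) × Fin (n x) => n y.1) (v := fun y => v y.1)
      (c := fun y => g y.1 y.2) (hv.wk Sigma.fst)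
      (permApp (r := fun y : (x : X) × Fin (n x) => n y.1) (hg.wk Sigma.fst) idx))

theorem matUpdate {R : ∀ x, Fin (r x) → Typ (n x)} {τ : ∀ x, Fin (r x)} {v : ∀ x, Typ (n x)}
    (hR : Comp O F fun x => .mat (R x)) (hτ : Comp O F fun x => .nat (τ x))
    (hv : Comp O F fun x => .vec (v x)) :
    Comp O F fun x => .mat (Function.update (R x) (τ x) (v x)) := by
  classical
  refine matLam (rng_of_family hR) ?_
  refine (ite (finEq (r := fun y : (x : X) × Fin (r x) => r y.1) idx (hτ.wk Sigma.fst))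
    (hv.wk Sigma.fst) (matApp (r := fun y : (x : X) × Fin (r x) => r y.1) (A := fun y => R y.1)
      (hR.wk Sigma.fst) idx)).congr fun y => ?_
  rw [Function.update_apply]
  split <;> rfl

variable {sym : Bool} {β : X → ℝ}

theorem arr {v p : ∀ x, Typ (n x)} (hn : Comp O F fun x => .rng (n x))
    (hv : Comp O F fun x => .vec (v x)) (hp : Comp O F fun x => .vec (p x)) :
    Comp O F fun x => .perm (arr sym (v x) (p x)) := by
  cases sym with
  | false => exact permOne hn
  | true =>
    refine solve (A := fun x j l => v x j * p x l) (matLam hn (vecLam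
      (r := fun y : (x : X) × Fin (n x) => n y.1) (v := fun y l => v y.1 y.2 * p y.1 l)
      (hn.wk Sigma.fst) (mul ?_ ?_)))
    · have h := vecApp (r := fun y : (x : X) × Fin (n x) => n y.1) (v := fun y => v y.1)
        (hv.wk Sigma.fst) idx
      exact h.wk Sigma.fst
    · have h := hp.wk (Sigma.fst : ((x : X) × Fin (n x)) → X) (H := fun y => .nat y.2)
      exact vecApp (r := fun z : (y : (x : X) × Fin (n x)) × Fin (n y.1) => n z.1.1)
        (v := fun z => p z.1.1) (h.wk Sigma.fst) (refl _ _).snd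

theorem wt {v p : ∀ x, Typ (n x)} {q : X → ℝ} (hβ : Comp O F fun x => .num (β x))
    (hn : Comp O F fun x => .rng (n x)) (hv : Comp O F fun x => .vec (v x))
    (hp : Comp O F fun x => .vec (p x)) (hq : Comp O F fun x => .num (q x)) :
    Comp O F fun x => .num (wt sym (β x) (v x) (p x) (q x)) :=
  sub (sum hn (mul (vecApp (r := fun y : (x : X) × Fin (n x) => n y.1) (v := fun y => v y.1)
    (hv.wk Sigma.fst) idx) (vecApp (r := fun y : (x : X) × Fin (n x) => n y.1)
      (v := fun y => p y.1) (c := fun y => BICMech.arr sym (v y.1) (p y.1) y.2) (hp.wk Sigma.fst)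
      (permApp (r := fun y : (x : X) × Fin (n x) => n y.1) ((arr hn hv hp).wk Sigma.fst) idx))))
    (mul hβ hq)

theorem bidMat {R p : ∀ x, Fin (r x) → Typ (n x)} {q : ∀ x, Fin (r x) → ℝ}
    (hβ : Comp O F fun x => .num (β x)) (hn : Comp O F fun x => .rng (n x))
    (hR : Comp O F fun x => .mat (R x)) (hp : Comp O F fun x => .mat (p x))
    (hq : Comp O F fun x => .vec (q x)) :
    Comp O F fun x => .mat (bidMat sym (β x) (R x) (p x) (q x)) := by
  refine matLam (rng_of_family hR) (vecLam (r := fun y : (x : X) × Fin (r x) => r y.1)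
    (v := fun y => BICMech.bidMat sym (β y.1) (R y.1) (p y.1) (q y.1) y.2)
    ((rng_of_family hR).wk Sigma.fst) (max zero ?_))
  have h1 := matApp (r := fun y : (x : X) × Fin (r x) => r y.1) (A := fun y => R y.1)
    (hR.wk Sigma.fst) idx
  have h2 := hp.wk (Sigma.fst : ((x : X) × Fin (r x)) → X) (H := fun y => .nat y.2)
  have h3 := hq.wk (Sigma.fst : ((x : X) × Fin (r x)) → X) (H := fun y => .nat y.2)
  have h4 := hβ.wk (Sigma.fst : ((x : X) × Fin (r x)) → X) (H := fun y => .nat y.2)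
  have h5 := hn.wk (Sigma.fst : ((x : X) × Fin (r x)) → X) (H := fun y => .nat y.2)
  exact wt (n := fun z : (y : (x : X) × Fin (r x)) × Fin (r y.1) => n z.1.1)
    (β := fun z => β z.1.1) (v := fun z => R z.1.1 z.1.2) (p := fun z => p z.1.1 z.2)
    (q := fun z => q z.1.1 z.2) (h4.wk Sigma.fst) (h5.wk Sigma.fst) (h1.wk Sigma.fst)
    (matApp (r := fun z : (y : (x : X) × Fin (r x)) × Fin (r y.1) => r z.1.1)
      (A := fun z => p z.1.1) (h2.wk Sigma.fst) (refl _ _).snd)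
    (vecApp (r := fun z : (y : (x : X) × Fin (r x)) × Fin (r y.1) => r z.1.1)
      (v := fun z => q z.1.1) (h3.wk Sigma.fst) (refl _ _).snd)

theorem sumMat {A : ∀ x, Fin (r x) → Fin (r x) → ℝ} {σ : ∀ x, Equiv.Perm (Fin (r x))}
    (hA : Comp O F fun x => .mat (A x)) (hσ : Comp O F fun x => .perm (σ x)) :
    Comp O F fun x => .num (∑ k, A x k (σ x k)) :=
  sum (rng_of_family hA) (vecApp (r := fun y : (x : X) × Fin (r x) => r y.1)
    (v := fun y => A y.1 y.2) (c := fun y => σ y.1 y.2)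
    (matApp (r := fun y : (x : X) × Fin (r x) => r y.1) (hA.wk Sigma.fst) idx)
    (permApp (r := fun y : (x : X) × Fin (r x) => r y.1) (hσ.wk Sigma.fst) idx))

theorem externality {A : ∀ x, Fin (r x) → Fin (r x) → ℝ} {τ : ∀ x, Fin (r x)}
    (hA : Comp O F fun x => .mat (A x)) (hτ : Comp O F fun x => .nat (τ x)) :
    Comp O F fun x => .num (externality (A x) (τ x)) := by
  classical
  have hr : Comp O F fun x => .rng (r x) := rng_of_family hA
  have hZ : Comp O F fun x => .mat (zeroRow (A x) (τ x)) :=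
    (matUpdate (v := fun _ _ => 0) hA hτ (vecLam hr zero)).congr fun x => by
      congr 1
      ext k l
      rw [Function.update_apply, zeroRow]
      split <;> rfl
  exact sub (sumMat hZ (solve hZ)) (sumMat hZ (solve hA))

section Bidder

variable {R p : ∀ x, Fin (r x) → Typ (n x)} {q : ∀ x, Fin (r x) → ℝ} {τ : ∀ x, Fin (r x)}

theorem matched (hβ : Comp O F fun x => .num (β x)) (hn : Comp O F fun x => .rng (n x))
    (hR : Comp O F fun x => .mat (R x)) (hp : Comp O F fun x => .mat (p x))
    (hq : Comp O F fun x => .vec (q x)) (hτ : Comp O F fun x => .nat (τ x)) :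
    Comp O F fun x => .nat (BICMech.solve (BICMech.bidMat sym (β x) (R x) (p x) (q x)) (τ x)) :=
  permApp (solve (bidMat hβ hn hR hp hq)) hτ

theorem buys (hβ : Comp O F fun x => .num (β x)) (hn : Comp O F fun x => .rng (n x))
    (hR : Comp O F fun x => .mat (R x)) (hp : Comp O F fun x => .mat (p x))
    (hq : Comp O F fun x => .vec (q x)) (hτ : Comp O F fun x => .nat (τ x)) :
    Comp O F fun x => .ofProp (Buys sym (β x) (R x) (p x) (q x) (τ x)) := by
  have hl := matched (sym := sym) hβ hn hR hp hq hτ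
  exact lt zero (wt hβ hn (matApp hR hτ) (matApp hp hl) (vecApp hq hl))

theorem charge (hβ : Comp O F fun x => .num (β x)) (hn : Comp O F fun x => .rng (n x))
    (hR : Comp O F fun x => .mat (R x)) (hp : Comp O F fun x => .mat (p x))
    (hq : Comp O F fun x => .vec (q x)) (hτ : Comp O F fun x => .nat (τ x)) :
    Comp O F fun x => .num (charge sym (β x) (R x) (p x) (q x) (τ x)) := by
  classical
  have hb : Comp O F fun x => .ofProp (Buys sym (β x) (R x) (p x) (q x) (τ x)) :=
    buys hβ hn hR hp hq hτ
  have hm := mul hβ (vecApp hq (matched (sym := sym) hβ hn hR hp hq hτ))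
  have hi : Comp O F fun x => .num (if Buys sym (β x) (R x) (p x) (q x) (τ x) then
      β x * q x (BICMech.solve (BICMech.bidMat sym (β x) (R x) (p x) (q x)) (τ x)) else 0) :=
    (ite hb hm zero).congr fun x => by split <;> rfl
  exact add (externality (bidMat hβ hn hR hp hq) hτ) hi

end Bidder

theorem shuffle {U : ∀ x, Fin (r x) → ℝ} (hU : Comp O F fun x => .vec (U x)) :
    Comp O F fun x => .perm (shuffle (U x)) := by
  have hr : Comp O F fun x => .rng (r x) := rng_of_family hU
  refine solve (A := fun x j l => U x j * (l : ℕ)) (matLam hr (vecLam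
    (r := fun y : (x : X) × Fin (r x) => r y.1) (v := fun y l => U y.1 y.2 * (l : ℕ))
    (hr.wk Sigma.fst) (mul ?_ ?_)))
  · have h := vecApp (r := fun y : (x : X) × Fin (r x) => r y.1) (v := fun y => U y.1)
      (hU.wk Sigma.fst) idx
    exact h.wk Sigma.fst
  · exact (refl _ _).snd

theorem relabel {U : ∀ x, Fin (r x) → ℝ} (hU : Comp O F fun x => .vec (U x)) :
    Comp O F fun x => .perm (relabel sym (U x)) := by
  cases sym with
  | false => exact permOne (rng_of_family hU)
  | true => exact shuffle hU

theorem position [∀ x, NeZero (r x)] {U : ∀ x, Fin (r x) → ℝ}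
    (hU : Comp O F fun x => .vec (U x)) : Comp O F fun x => .nat (position (U x)) :=
  permApp (c := fun _ => 0) (shuffle hU) (by simpa [Val.nat] using zero)

end Comp


/-! ### The computation of the outcome -/

/-- The data of a run of the program. -/
structure Setup (sym : Bool) where
  m : ℕ
  n : ℕ
  r : ℕ
  C : Fin m → ℕ
  δ : ℝ
  η : ℝ
  D' : Fin m → Measure (Typ n)
  M₁ : Mechanism C n
  run : Profile m n → ℝ → Alloc C n
  ω : ℕ → Draw m n
  v : Profile m n
  prob : ∀ i, IsProbabilityMeasure (D' i)
  fin : ∀ i, Fintype (Atom (D' i))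
  pos : NeZero r
  atom : ∀ t i, D' i {(ω t).1.2 i} ≠ 0
  inv : sym = true → ItemSymmetric D'

namespace Setup

variable {sym : Bool} (x : Setup sym)

instance : NeZero x.r := x.pos

instance (i : Fin x.m) : IsProbabilityMeasure (x.D' i) := x.prob i

instance (i : Fin x.m) : Fintype (Atom (x.D' i)) := x.fin i

instance (i : Fin x.m) : Nonempty (Atom (x.D' i)) := ⟨⟨_, x.atom 0 i⟩⟩

/-- The answers to the queries. -/
def oracle : Val → Val → Prop := Answers x.D' x.M₁ x.run x.ω

/-- The input of the main part of the program. -/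
def env : Val := .node (.node (inputVal x.C x.δ x.η x.v) (.rng x.n)) (.rng x.r)

/-- The time of the draw in slot `t` of bidder `i`. -/
def time (i : Fin x.m) (t : ℕ) : ℕ := i * slots x.r x.n + t

/-- The replicas of bidder `i`. -/
def rep (i : Fin x.m) (k : Fin x.r) : Typ x.n := (x.ω (x.time i k)).1.1 i

/-- The surrogates of bidder `i`. -/
def sur (i : Fin x.m) (k : Fin x.r) : Typ x.n := (x.ω (x.time i (x.r + k))).1.2 i

/-- The position of bidder `i` among her replicas. -/
def place (i : Fin x.m) : Fin x.r := position fun k => (x.ω (x.time i (2 * x.r + k))).2.1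

/-- The relabelling of the items for bidder `i`. -/
def rho (i : Fin x.m) : Equiv.Perm (Fin x.n) :=
  relabel sym fun j => (x.ω (x.time i (3 * x.r + j))).2.1

/-- The replicas, with bidder `i` among them. -/
def rows (i : Fin x.m) : Fin x.r → Typ x.n := Function.update (x.rep i) (x.place i) (x.v i)

/-- The expected allocations of the surrogates. -/
def surPhi (i : Fin x.m) (k : Fin x.r) : Typ x.n := x.M₁.interimPhi x.D' i (x.sur i k)

/-- The expected prices of the surrogates. -/
def surPrice (i : Fin x.m) (k : Fin x.r) : ℝ := x.M₁.interimPrice x.D' i (x.sur i k)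

/-- The discount of the prices. -/
def beta : ℝ := max (1 - x.η) 0

/-- The surrogate to which bidder `i` is matched. -/
def choice (i : Fin x.m) : Fin x.r :=
  solve (bidMat sym x.beta (x.rows i) (x.surPhi i) (x.surPrice i)) (x.place i)

/-- The type that plays for bidder `i`. -/
def proxy (i : Fin x.m) : Typ x.n :=
  x.sur i (x.choice i) ∘
    (arr sym (x.v i ∘ x.rho i) (x.surPhi i (x.choice i)) * (x.rho i)⁻¹ : Equiv.Perm (Fin x.n))

/-- Whether bidder `i` buys the outcome. -/
def Sold (i : Fin x.m) : Prop :=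
  Buys sym x.beta (x.rows i) (x.surPhi i) (x.surPrice i) (x.place i)

theorem extract_eq (i : Fin x.m) : (extract (r := x.r) sym x.D' x.ω).1 i =
    (x.rep i, (fun k => ⟨x.sur i k, x.atom _ i⟩, (x.place i, x.rho i))) := by
  have h : ∀ k : Fin x.r, snap (x.D' i) (x.sur i k) = ⟨x.sur i k, x.atom _ i⟩ :=
    fun k => snap_of_ne _
  rw [← funext h]
  rfl

/-- A rearranged atom is again an atom by the invariance of `D'`, so the abstract action is the
composition that the program performs. -/
theorem picks_eq (i : Fin x.m) :
    (picks (r := x.r) x.M₁ sym x.η x.D' x.v x.ω i).1.1 = x.proxy i ∧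
    ((picks (r := x.r) x.M₁ sym x.η x.D' x.v x.ω i).2 = true ↔ x.Sold i) := by
  rw [picks, extract_eq]
  refine ⟨?_, by simp only [Surrogates.pick, decide_eq_true_eq]; rfl⟩
  simp only [Surrogates.pick, Surrogates.give, Function.update_self]
  have hg : Grp sym (x.rho i) := grp_relabel sym _
  exact congrArg Subtype.val (atomSurrogates_act
    (map_comp_of_grp x.inv ((grp_arr _ _).mul hg.inv) i) _)

theorem payOf_eq (i : Fin x.m) : payOf x.M₁ sym x.η x.r x.D' x.v x.ω i =
    charge sym x.beta (x.rows i) (x.surPhi i) (x.surPrice i) (x.place i) := by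
  rw [payOf, extract_eq]
  rfl

end Setup

/-! ### Oracle queries and the withholding of items. -/

namespace Comp

section Queries

variable {sym : Bool} {X : Type*} {c : X → Setup sym} {F : X → Val} {i : ∀ x, Fin (c x).m}
  {t : X → ℕ}

theorem polyBd_vec {n : X → ℕ} {O : X → Val → Val → Prop} (hn : Comp O F fun x => .rng (n x)) :
    ∃ U, PolyBd U ∧ ∀ x (v : Typ (n x)), (Val.vec v).size ≤ U (F x).size := by
  obtain ⟨U, hU, h⟩ := polyBd_of_rng hn
  refine ⟨fun s => U s * 2 + 1, (hU.mul (.const 2)).add (.const 1), fun x v => ?_⟩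
  have h1 := Val.size_vec_le v
  have h2 := h x
  beta_reduce
  omega

theorem sample (hn : Comp (fun x => (c x).oracle) F fun x => .rng (c x).n)
    (hi : Comp (fun x => (c x).oracle) F fun x => .nat (i x))
    (ht : Comp (fun x => (c x).oracle) F fun x => .nat (t x)) :
    Comp (fun x => (c x).oracle) F fun x => .vec (((c x).ω (t x)).1.1 (i x)) := by
  obtain ⟨U, hU, h⟩ := polyBd_vec hn
  exact query (pair (natConst 0) (pair hi (pair ht nil))) (fun x => .sample (i x) (t x))
    ⟨U, hU, fun x => h x _⟩

theorem sample' (hn : Comp (fun x => (c x).oracle) F fun x => .rng (c x).n)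
    (hi : Comp (fun x => (c x).oracle) F fun x => .nat (i x))
    (ht : Comp (fun x => (c x).oracle) F fun x => .nat (t x)) :
    Comp (fun x => (c x).oracle) F fun x => .vec (((c x).ω (t x)).1.2 (i x)) := by
  obtain ⟨U, hU, h⟩ := polyBd_vec hn
  exact query (pair (natConst 1) (pair hi (pair ht nil))) (fun x => .sample' (i x) (t x))
    ⟨U, hU, fun x => h x _⟩

theorem coin (ht : Comp (fun x => (c x).oracle) F fun x => .nat (t x)) :
    Comp (fun x => (c x).oracle) F fun x => .num ((c x).ω (t x)).2.1 :=
  query (pair (natConst 2) (pair ht nil)) (fun x => .coin (t x))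
    ⟨fun _ => 1, .const 1, fun _ => le_rfl⟩

theorem interim {s : ∀ x, Typ (c x).n} (hi : Comp (fun x => (c x).oracle) F fun x => .nat (i x))
    (hs : Comp (fun x => (c x).oracle) F fun x => .vec (s x)) :
    Comp (fun x => (c x).oracle) F fun x => .node
      (.vec ((c x).M₁.interimPhi (c x).D' (i x) (s x)))
      (.num ((c x).M₁.interimPrice (c x).D' (i x) (s x))) := by
  obtain ⟨U, hU, h⟩ := polyBd_vec (n := fun x => (c x).n) (rng_of_family hs)
  refine query (pair (natConst 4) (pair hi (pair hs nil))) (fun x => .interim (i x) (s x))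
    ⟨fun s => U s + 2, hU.add (.const 2), fun x => ?_⟩
  have := h x ((c x).M₁.interimPhi (c x).D' (i x) (s x))
  simp only [Val.size]
  omega

theorem _root_.BICMech.Val.alloc_eq {m n : ℕ} {C : Fin m → ℕ} (a : Alloc C n) :
    Val.alloc a = .family fun j => (a.1 j).elim .nil fun i => .nat i := by
  rw [Val.alloc]
  congr 1
  ext j
  cases a.1 j <;> rfl

theorem play {s : ∀ x, Profile (c x).m (c x).n}
    (hn : Comp (fun x => (c x).oracle) F fun x => .rng (c x).n)
    (ht : Comp (fun x => (c x).oracle) F fun x => .nat (t x))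
    (hs : Comp (fun x => (c x).oracle) F fun x => .profile (s x)) :
    Comp (fun x => (c x).oracle) F fun x => .alloc ((c x).run (s x) ((c x).ω (t x)).2.2) := by
  obtain ⟨U, hU, h⟩ := polyBd_of_rng hn
  obtain ⟨V, hV, h'⟩ := polyBd_of_rng (r := fun x => (c x).m) (rng_of_family hs)
  refine fst (query (pair (natConst 5) (pair ht (pair hs nil))) (fun x => .play (t x) (s x))
    ⟨fun s => U s * 2 + 1 + (V s * 2 + 1) + 1, (((hU.mul (.const 2)).add (.const 1)).add
      ((hV.mul (.const 2)).add (.const 1))).add (.const 1), fun x => ?_⟩)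
  have h1 := Val.size_vec_le ((c x).M₁.price (s x))
  have h2 : (Val.alloc ((c x).run (s x) ((c x).ω (t x)).2.2)).size ≤ (c x).n * 2 + 1 := by
    rw [Val.alloc_eq]
    refine Val.size_family_le fun j => ?_
    cases ((c x).run (s x) ((c x).ω (t x)).2.2).1 j <;> simp [Val.size, Val.nat]
  have h3 := h x
  have h4 := h' x
  simp only [Val.size]
  omega

/-- The buying flag is looked up only for sold items; the branch is a computation on the subtype
where a receiver exists. -/
theorem keepAlloc {O : X → Val → Val → Prop} {m n : X → ℕ} {C : ∀ x, Fin (m x) → ℕ}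
    {a : ∀ x, Alloc (C x) (n x)} {b : ∀ x, Fin (m x) → Bool}
    (ha : Comp O F fun x => .alloc (a x))
    (hb : Comp O F fun x => .family fun i => .ofProp (b x i = true)) :
    Comp O F fun x => .alloc (keep (b x) (a x)) := by
  classical
  simp only [Val.alloc_eq] at ha ⊢
  refine lam (rng_of_family ha) ?_
  have ha' := app (r := fun y : (x : X) × Fin (n x) => n y.1)
    (g := fun y j => ((a y.1).1 j).elim Val.nil fun i => Val.nat i) (ha.wk Sigma.fst) idx
  have hb' := hb.wk (Sigma.fst : ((x : X) × Fin (n x)) → X) (H := fun y => .nat y.2)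
  have hP : Comp (fun y : (x : X) × Fin (n x) => O y.1) (fun y => .node (F y.1) (.nat y.2))
      (fun y => .ofProp (((a y.1).1 y.2).isSome = true)) :=
    ha'.trans (of_prim .isNum (fun y => by
      cases (a y.1).1 y.2 <;> simp [Prim.eval, Val.ofProp, Val.nat]) fun y => by
        rw [Val.size_ofProp]; exact Val.one_le_size _)
  have hval : Comp (fun y : {y : (x : X) × Fin (n x) // ((a y.1).1 y.2).isSome = true} => O y.1.1)
      (fun y => .node (F y.1.1) (.nat y.1.2))
      (fun y => .nat (((a y.1.1).1 y.1.2).get y.2)) :=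
    (ha'.comap Subtype.val).congr fun y => by
      obtain ⟨y, hy⟩ := y
      obtain ⟨i, hi⟩ := Option.isSome_iff_exists.1 hy
      simp [hi]
  have hflag := app (r := fun y : {y : (x : X) × Fin (n x) // ((a y.1).1 y.2).isSome = true} =>
    m y.1.1) (g := fun y i => Val.ofProp (b y.1.1 i = true))
    (c := fun y => ((a y.1.1).1 y.1.2).get y.2) (hb'.comap Subtype.val) hval
  refine (cond (G := fun y => ((a y.1).1 y.2).elim .nil fun i => if b y.1 i then .nat i else .nil)
    (H := fun _ => .nil) hP ((ite hflag hval nil).congr fun y => ?_) nil).congr fun y => ?_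
  · obtain ⟨y, hy⟩ := y
    obtain ⟨i, hi⟩ := Option.isSome_iff_exists.1 hy
    simp [hi]
  · simp only [keep]
    cases (a y.1).1 y.2 with
    | none => simp
    | some i => by_cases h : b y.1 i = true <;> simp [h]

end Queries

end Comp


namespace Comp

theorem nat_of_rng {X : Type*} {O : X → Val → Val → Prop} {F : X → Val} {r : X → ℕ}
    (hr : Comp O F fun x => .rng (r x)) : Comp O F fun x => .nat (r x) :=
  (sum (g := fun _ _ => 1) hr one).congr fun x => by simp [Val.nat]

theorem natAdd {X : Type*} {O : X → Val → Val → Prop} {F : X → Val} {a b : X → ℕ}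
    (ha : Comp O F fun x => .nat (a x)) (hb : Comp O F fun x => .nat (b x)) :
    Comp O F fun x => .nat (a x + b x) := by
  simpa [Val.nat] using add ha hb

theorem natMul {X : Type*} {O : X → Val → Val → Prop} {F : X → Val} {a b : X → ℕ}
    (ha : Comp O F fun x => .nat (a x)) (hb : Comp O F fun x => .nat (b x)) :
    Comp O F fun x => .nat (a x * b x) := by
  simpa [Val.nat] using mul ha hb

end Comp

/-! ### The outcome computed from the queries, bidder by bidder. -/

namespace Setup

open BICMech.Comp

variable {sym : Bool}

theorem comp_input : Comp (oracle (sym := sym)) env fun x => inputVal x.C x.δ x.η x.v :=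
  fst (fst (refl _ _))

theorem comp_n : Comp (oracle (sym := sym)) env fun x => .rng x.n :=
  snd (G := fun x => inputVal x.C x.δ x.η x.v) (fst (refl _ _))

theorem comp_r : Comp (oracle (sym := sym)) env fun x => .rng x.r :=
  snd (G := fun x => .node (inputVal x.C x.δ x.η x.v) (.rng x.n)) (refl _ _)

theorem comp_v : Comp (oracle (sym := sym)) env fun x => .profile x.v := by
  have h : Comp (oracle (sym := sym)) env fun x => .node (.num x.δ) (.node (.num x.η)
      (.node (.nat x.m) (.node (.nat x.n) (.node (.family fun i => .nat (x.C i))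
        (.node (.profile x.v) .nil))))) := comp_input
  exact h.snd.snd.snd.snd.snd.fst

theorem comp_m : Comp (oracle (sym := sym)) env fun x => .rng x.m := rng_of_family comp_v

theorem comp_beta : Comp (oracle (sym := sym)) env fun x => .num x.beta := by
  have h : Comp (oracle (sym := sym)) env fun x => .node (.num x.δ) (.node (.num x.η)
      (.node (.nat x.m) (.node (.nat x.n) (.node (.family fun i => .nat (x.C i))
        (.node (.profile x.v) .nil))))) := comp_input
  exact max (sub one h.snd.fst) zero

theorem comp_slots : Comp (oracle (sym := sym)) env fun x => .nat (slots x.r x.n) :=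
  natAdd (natMul (natConst 3) (nat_of_rng comp_r)) (nat_of_rng comp_n)

/-- A bidder in a run. -/
abbrev Bidder (sym : Bool) := (x : Setup sym) × Fin x.m

/-- The answers to the queries. -/
abbrev Bidder.oracle (y : Bidder sym) : Val → Val → Prop := y.1.oracle

/-- The data of a bidder. -/
abbrev Bidder.env (y : Bidder sym) : Val := .node y.1.env (.nat y.2)

/-- A quantity of the run, with a further index at hand. -/
theorem Bidder.lift {G : Setup sym → Val} (h : Comp Setup.oracle Setup.env G) {r : Bidder sym → ℕ} :
    Comp (fun z : (y : Bidder sym) × Fin (r y) => z.1.oracle)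
      (fun z => .node z.1.env (.nat z.2)) (fun z => G z.1.1) :=
  (h.wk (Sigma.fst : Bidder sym → Setup sym) (H := fun y => .nat y.2)).wk Sigma.fst

theorem Bidder.comp_time {r base : Bidder sym → ℕ}
    (hb : Comp (fun z : (y : Bidder sym) × Fin (r y) => z.1.oracle)
      (fun z => .node z.1.env (.nat z.2)) (fun z => .nat (base z.1))) :
    Comp (fun z : (y : Bidder sym) × Fin (r y) => z.1.oracle)
      (fun z => .node z.1.env (.nat z.2)) (fun z => .nat (z.1.1.time z.1.2 (base z.1 + z.2))) :=
  natAdd (natMul (refl _ _).fst.snd (Bidder.lift comp_slots)) (natAdd hb (refl _ _).snd)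

variable (sym) in
theorem comp_rep : Comp (Bidder.oracle (sym := sym)) Bidder.env fun y => .mat (y.1.rep y.2) := by
  refine matLam (A := fun y : Bidder sym => y.1.rep y.2) (comp_r.wk Sigma.fst) ?_
  refine sample (c := fun z : (y : Bidder sym) × Fin y.1.r => z.1.1) (i := fun z => z.1.2)
    (Bidder.lift comp_n) (refl _ _).fst.snd ?_
  have h := Bidder.comp_time (sym := sym) (r := fun y => y.1.r) (base := fun _ => 0) (natConst 0)
  simpa using h

variable (sym) in
theorem comp_sur : Comp (Bidder.oracle (sym := sym)) Bidder.env fun y => .mat (y.1.sur y.2) := by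
  refine matLam (A := fun y : Bidder sym => y.1.sur y.2) (comp_r.wk Sigma.fst) ?_
  exact sample' (c := fun z : (y : Bidder sym) × Fin y.1.r => z.1.1) (i := fun z => z.1.2)
    (Bidder.lift comp_n) (refl _ _).fst.snd
    (Bidder.comp_time (base := fun y => y.1.r) (Bidder.lift (nat_of_rng comp_r)))

variable (sym) in
theorem comp_place : Comp (Bidder.oracle (sym := sym)) Bidder.env fun y => .nat (y.1.place y.2) := by
  refine Comp.position (r := fun y : Bidder sym => y.1.r)
    (U := fun y k => (y.1.ω (y.1.time y.2 (2 * y.1.r + k))).2.1)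
    (vecLam (comp_r.wk Sigma.fst) ?_)
  exact coin (c := fun z : (y : Bidder sym) × Fin y.1.r => z.1.1)
    (Bidder.comp_time (base := fun y => 2 * y.1.r)
      (natMul (natConst 2) (Bidder.lift (nat_of_rng comp_r))))

variable (sym) in
theorem comp_rho : Comp (Bidder.oracle (sym := sym)) Bidder.env fun y => .perm (y.1.rho y.2) := by
  refine Comp.relabel (r := fun y : Bidder sym => y.1.n)
    (U := fun y k => (y.1.ω (y.1.time y.2 (3 * y.1.r + k))).2.1)
    (vecLam (comp_n.wk Sigma.fst) ?_)
  exact coin (c := fun z : (y : Bidder sym) × Fin y.1.n => z.1.1)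
    (Bidder.comp_time (base := fun y => 3 * y.1.r)
      (natMul (natConst 3) (Bidder.lift (nat_of_rng comp_r))))

variable (sym) in
theorem comp_report : Comp (Bidder.oracle (sym := sym)) Bidder.env fun y => .vec (y.1.v y.2) :=
  app (r := fun y : Bidder sym => y.1.m) (g := fun y i => .vec (y.1.v i)) (c := fun y => y.2)
    (comp_v.wk Sigma.fst) (refl _ _).snd

variable (sym) in
theorem comp_rows : Comp (Bidder.oracle (sym := sym)) Bidder.env fun y => .mat (y.1.rows y.2) :=
  matUpdate (comp_rep sym) (comp_place sym) (comp_report sym)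

variable (sym) in
theorem comp_interim : Comp (fun z : (y : Bidder sym) × Fin y.1.r => z.1.oracle)
    (fun z => .node z.1.env (.nat z.2))
    (fun z => .node (.vec (z.1.1.surPhi z.1.2 z.2)) (.num (z.1.1.surPrice z.1.2 z.2))) :=
  interim (c := fun z : (y : Bidder sym) × Fin y.1.r => z.1.1) (i := fun z => z.1.2)
    (s := fun z => z.1.1.sur z.1.2 z.2) (refl _ _).fst.snd
    (matApp (r := fun z : (y : Bidder sym) × Fin y.1.r => z.1.1.r) (A := fun z => z.1.1.sur z.1.2)
      ((comp_sur sym).wk Sigma.fst) (refl _ _).snd)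

variable (sym) in
theorem comp_surPhi : Comp (Bidder.oracle (sym := sym)) Bidder.env fun y => .mat (y.1.surPhi y.2) :=
  matLam (A := fun y : Bidder sym => y.1.surPhi y.2) (comp_r.wk Sigma.fst) (comp_interim sym).fst

variable (sym) in
theorem comp_surPrice :
    Comp (Bidder.oracle (sym := sym)) Bidder.env fun y => .vec (y.1.surPrice y.2) :=
  vecLam (v := fun y : Bidder sym => y.1.surPrice y.2) (comp_r.wk Sigma.fst) (comp_interim sym).snd

variable (sym) in
theorem comp_charge : Comp (Bidder.oracle (sym := sym)) Bidder.env fun y => .num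
    (BICMech.charge sym y.1.beta (y.1.rows y.2) (y.1.surPhi y.2) (y.1.surPrice y.2)
      (y.1.place y.2)) :=
  Comp.charge (comp_beta.wk Sigma.fst) (comp_n.wk Sigma.fst) (comp_rows sym) (comp_surPhi sym)
    (comp_surPrice sym) (comp_place sym)

variable (sym) in
theorem comp_sold : Comp (Bidder.oracle (sym := sym)) Bidder.env fun y => .ofProp (y.1.Sold y.2) :=
  buys (comp_beta.wk Sigma.fst) (comp_n.wk Sigma.fst) (comp_rows sym) (comp_surPhi sym)
    (comp_surPrice sym) (comp_place sym)

variable (sym) in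
theorem comp_choice :
    Comp (Bidder.oracle (sym := sym)) Bidder.env fun y => .nat (y.1.choice y.2) :=
  matched (comp_beta.wk Sigma.fst) (comp_n.wk Sigma.fst) (comp_rows sym) (comp_surPhi sym)
    (comp_surPrice sym) (comp_place sym)

variable (sym) in
theorem comp_proxy : Comp (Bidder.oracle (sym := sym)) Bidder.env fun y => .vec (y.1.proxy y.2) :=
  vecComp (matApp (A := fun y => y.1.sur y.2) (comp_sur sym) (comp_choice sym))
    (permMul (Comp.arr (comp_n.wk Sigma.fst) (vecComp (comp_report sym) (comp_rho sym))
      (matApp (A := fun y => y.1.surPhi y.2) (comp_surPhi sym) (comp_choice sym)))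
      (permInv (comp_rho sym)))

variable (sym) in
/-- The main part of the program. -/
theorem comp_output : Comp (oracle (sym := sym)) env fun x =>
    .node (.alloc (allocOf x.M₁ sym x.η x.run x.r x.D' x.v x.ω))
      (.vec (payOf x.M₁ sym x.η x.r x.D' x.v x.ω)) := by
  refine pair ?_ ((vecLam (v := fun (x : Setup sym) i => BICMech.charge sym x.beta (x.rows i) (x.surPhi i)
    (x.surPrice i) (x.place i)) comp_m (comp_charge sym)).congr fun x => ?_)
  · have hp : Comp (oracle (sym := sym)) env fun x => .profile x.proxy :=
      lam (g := fun x i => .vec (x.proxy i)) comp_m (comp_proxy sym)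
    have ha := play (c := fun x : Setup sym => x) (s := fun x => x.proxy) comp_n
      (natMul (nat_of_rng comp_m) comp_slots) hp
    have hb : Comp (oracle (sym := sym)) env fun x => .family fun i => .ofProp (x.Sold i) :=
      lam (g := fun x i => .ofProp (x.Sold i)) comp_m (comp_sold sym)
    refine (keepAlloc (b := fun x i => (picks (r := x.r) x.M₁ sym x.η x.D' x.v x.ω i).2) ha
      (hb.congr fun x => ?_)).congr fun x => ?_
    · congr 1
      ext i
      rw [(x.picks_eq i).2]
    · rw [allocOf, funext fun i => (x.picks_eq i).1]
  · rw [← funext fun i => x.payOf_eq i]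

end Setup


/-! ### The number of replicas -/

/-- A computation whose time and size are polynomial in the size of the input and in `N`. -/
def CompWithin {X : Type*} (N : X → ℕ) (O : X → Val → Val → Prop) (F G : X → Val) : Prop :=
  ∃ (p : Program) (T : ℕ → ℕ), PolyBd T ∧
    ∀ x, Ev (O x) p (F x) (G x) (T ((F x).size + N x)) ∧ (G x).size ≤ T ((F x).size + N x)

/-- Whether a number is nonpositive. -/
def countTest : Program :=
  .comp (.prim .le) (.pair (.prim .fst) (.comp (.prim .sub) (.pair (.prim .one) (.prim .one))))

/-- One step of the count down from a real number. -/
def countBody : Program :=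
  .cond countTest
    (.pair (.prim .nil) (.prim .id))
    (.pair (.prim .one) (.pair (.comp (.prim .sub) (.pair (.prim .fst) (.prim .one)))
      (.pair (.prim .nil) (.prim .snd))))

/-- There is no rounding operation: one is subtracted until the number is nonpositive, and each
subtraction adds a list entry. The time is proportional to the number itself, which is why
`CompWithin` carries the budget `N`. -/
theorem Ev.countLoop {O : Val → Val → Prop} (k : ℕ) : ∀ (y : ℝ) (l : List Val), ⌈y⌉₊ = k →
    Ev O (.loop countBody) (.node (.num y) (.list l))
      (.node (.num (y - k)) (.list (List.replicate k .nil ++ l))) (25 * (k + 1)) := by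
  have htest : ∀ (y : ℝ) (l : List Val), Ev O countTest (.node (.num y) (.list l))
      (.ofProp (y ≤ 0)) 9 := fun y l => by
    have h := ((Ev.prim (O := O) .fst (.node (.num y) (.list l))).pair
      (((Ev.prim .one (.node (.num y) (.list l))).pair (Ev.prim .one _)).comp
        (Ev.prim .sub _))).comp (Ev.prim .le _)
    simpa [Prim.eval, countTest] using h.mono (t := 9) (by omega)
  induction k with
  | zero =>
    intro y l hy
    have h0 : y ≤ 0 := Nat.ceil_eq_zero.1 hy
    have ht : Ev O countTest (.node (.num y) (.list l)) (.num 1) 9 := by simpa [Val.ofProp, h0] using htest y l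
    have hb : Ev O countBody (.node (.num y) (.list l)) (.node .nil (.node (.num y) (.list l))) 13 :=
      ht.condTrue (by simp) ((Ev.prim .nil _).pair (Ev.prim .id _))
    simpa using (hb.loopStop).mono (t := 25) (by omega)
  | succ k ih =>
    intro y l hy
    have h0 : ¬ y ≤ 0 := fun h => by rw [Nat.ceil_eq_zero.2 h] at hy; omega
    have ht : Ev O countTest (.node (.num y) (.list l)) .nil 9 := by simpa [Val.ofProp, h0] using htest y l
    have hb : Ev O countBody (.node (.num y) (.list l))
        (.node (.num 1) (.node (.num (y - 1)) (.list (.nil :: l)))) 21 := by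
      have := ht.condFalse (p := .pair (.prim .nil) (.prim .id)) ((Ev.prim .one _).pair
        (((((Ev.prim .fst (.node (.num y) (.list l))).pair (Ev.prim .one _)).comp
          (Ev.prim .sub _))).pair ((Ev.prim .nil _).pair (Ev.prim .snd _))))
      simpa [Prim.eval, Val.list, countBody] using this.mono (t := 21) (by omega)
    have h := hb.loopStep (by simp) (ih (y - 1) (.nil :: l) (by rw [Nat.ceil_sub_one, hy]; rfl))
    have e1 : y - 1 - (k : ℝ) = y - ((k + 1 : ℕ) : ℝ) := by push_cast; ring
    have e2 : List.replicate k Val.nil ++ .nil :: l = List.replicate (k + 1) .nil ++ l := by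
      rw [List.replicate_succ', List.append_assoc]; rfl
    rw [e1, e2] at h
    exact h.mono (by omega)

namespace CompWithin

variable {X : Type*} {N : X → ℕ} {O : X → Val → Val → Prop} {F G H : X → Val}

theorem of_comp (h : Comp O F G) : CompWithin N O F G := by
  obtain ⟨p, T, hT, hp⟩ := h
  exact ⟨p, T, hT, fun x => ⟨(hp x).1.mono (hT.1 (by omega)), (hp x).2.trans (hT.1 (by omega))⟩⟩

theorem trans (h1 : CompWithin N O F G) (h2 : CompWithin N O G H) : CompWithin N O F H := by
  obtain ⟨p, T, hT, hp⟩ := h1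
  obtain ⟨q, U, hU, hq⟩ := h2
  refine ⟨.comp q p, fun s => T s + U (T s + s) + 1,
    (hT.add (hU.comp (hT.add .id))).add (.const 1), fun x => ?_⟩
  have h3 : U ((G x).size + N x) ≤ U (T ((F x).size + N x) + ((F x).size + N x)) :=
    hU.1 (by have := (hp x).2; omega)
  beta_reduce
  exact ⟨((hp x).1.comp (hq x).1).mono (by omega), by have := (hq x).2; omega⟩

theorem pair (h1 : CompWithin N O F G) (h2 : CompWithin N O F H) :
    CompWithin N O F fun x => .node (G x) (H x) := by
  obtain ⟨p, T, hT, hp⟩ := h1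
  obtain ⟨q, U, hU, hq⟩ := h2
  refine ⟨.pair p q, fun s => T s + U s + 1, (hT.add hU).add (.const 1), fun x => ?_⟩
  exact ⟨(hp x).1.pair (hq x).1, by have := (hq x).2; have := (hp x).2; simp [Val.size]; omega⟩

/-- Rounding up a real number; the result is in unary. -/
theorem range {a : X → ℝ} (ha : Comp O F fun x => .num (a x)) (hN : ∀ x, ⌈a x⌉₊ ≤ N x) :
    CompWithin N O F fun x => .node (F x) (.rng ⌈a x⌉₊) := by
  refine pair (of_comp (.refl _ _)) ((of_comp (ha.pair .nil)).trans
    (trans (G := fun x => .list (List.replicate ⌈a x⌉₊ .nil)) ?_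
      (of_comp ((Comp.rng_length (.refl _ _)).congr fun x => by rw [List.length_replicate]))))
  refine ⟨.comp (.prim .snd) (.loop countBody), fun s => 25 * (s + 1) + 2,
    ((PolyBd.const 25).mul (PolyBd.id.add (.const 1))).add (.const 2), fun x => ?_⟩
  have h := (Ev.countLoop (O := O x) _ (a x) [] rfl).comp (Ev.prim .snd _)
  have h2 := Val.size_list_le (l := List.replicate ⌈a x⌉₊ Val.nil) (B := 1)
    fun v hv => by rw [List.eq_of_mem_replicate hv]; rfl
  have := hN x
  rw [List.length_replicate] at h2
  refine ⟨?_, ?_⟩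
  · simpa [Prim.eval, Val.list, Val.size] using h.mono (t := 25 * ((2 + 1 + N x) + 1) + 2) (by omega)
  · beta_reduce
    omega

end CompWithin

/-- The exponent in the number of replicas. -/
def exponent (sym : Bool) (n : ℕ) (δ : ℝ) : ℕ := ⌈if sym then 1 / δ + 5 else (n : ℝ) + 4⌉₊

/-- The number of replicas. -/
def replicas (sym : Bool) (m n : ℕ) (δ : ℝ) : ℕ := ⌈((m : ℝ) + n + 2 + 1 / δ) ^ exponent sym n δ⌉₊

section Replicas

variable {sym : Bool} {m n : ℕ} {δ : ℝ}

theorem replicas_pos (hδ : 0 < δ) : 0 < replicas sym m n δ := by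
  unfold replicas
  positivity

/-- Put `x = m + n + 2 + 1/δ`. Then `m/δ ≤ x ^ 2` accounts for four in the exponent. The number of
classes is a power whose base is at most `x` and whose exponent is `levels δ ≤ 1/δ + 1` or `n`. -/
theorem classCount_mul_le (hδ : 0 < δ) :
    classCount sym n δ * (m / δ) ^ 2 ≤ replicas sym m n δ := by
  refine le_trans ?_ (Nat.le_ceil _)
  have hd : 0 < 1 / δ := by positivity
  obtain ⟨x, hx⟩ : ∃ x, x = (m : ℝ) + n + 2 + 1 / δ := ⟨_, rfl⟩
  have hm : (0 : ℝ) ≤ m := Nat.cast_nonneg m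
  have hn : (0 : ℝ) ≤ n := Nat.cast_nonneg n
  have h1 : (m / δ) ^ 2 ≤ x ^ 4 := by
    have : m / δ ≤ x ^ 2 := by
      rw [div_eq_mul_one_div, sq]
      exact mul_le_mul (by linarith) (by linarith) hd.le (by linarith)
    calc (m / δ) ^ 2 ≤ (x ^ 2) ^ 2 := pow_le_pow_left₀ (by positivity) this 2
      _ = x ^ 4 := by ring
  have hl : (⌊1 / δ⌋₊ : ℝ) ≤ 1 / δ := Nat.floor_le hd.le
  have hx1 : 1 ≤ x := by linarith
  rw [← hx]
  suffices h : ∃ e, (classCount sym n δ : ℝ) ≤ x ^ e ∧ e + 4 ≤ exponent sym n δ by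
    obtain ⟨e, he, he'⟩ := h
    calc classCount sym n δ * (m / δ) ^ 2 ≤ x ^ e * x ^ 4 :=
          mul_le_mul he h1 (by positivity) (by positivity)
      _ = x ^ (e + 4) := (pow_add _ _ _).symm
      _ ≤ x ^ exponent sym n δ := pow_le_pow_right₀ hx1 he'
  cases sym with
  | true =>
    refine ⟨levels δ, ?_, ?_⟩
    · simp only [classCount, if_true, Nat.cast_pow, Nat.cast_add, Nat.cast_one]
      exact pow_le_pow_left₀ (by positivity) (by linarith) _
    · have h : ((levels δ + 4 : ℕ) : ℝ) ≤ 1 / δ + 5 := by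
        simp only [levels]; push_cast; linarith
      simpa [exponent] using Nat.cast_le (α := ℝ).1 (h.trans (Nat.le_ceil _))
  | false =>
    refine ⟨n, ?_, ?_⟩
    · simp only [classCount, Bool.false_eq_true, if_false, Nat.cast_pow, levels]
      exact pow_le_pow_left₀ (by positivity) (by push_cast; linarith) _
    · have h : (((n + 4 : ℕ) : ℝ)) ≤ (n : ℝ) + 4 := by push_cast; exact le_rfl
      simpa [exponent] using Nat.cast_le (α := ℝ).1 (h.trans (Nat.le_ceil _))

theorem replicas_le (hδ : 0 < δ) :
    replicas sym m n δ ≤ (m + n + 2 + ⌈1 / δ⌉₊) ^ exponent sym n δ := by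
  refine Nat.ceil_le.2 ?_
  push_cast
  have := Nat.le_ceil (1 / δ)
  exact pow_le_pow_left₀ (by positivity) (by linarith) _

end Replicas

/-! ### The program -/

theorem size_inputVal_le {m n : ℕ} (C : Fin m → ℕ) (δ η : ℝ) (v : Profile m n) :
    (inputVal C δ η v).size ≤ m * (2 * n + 4) + 13 := by
  have h1 : (Val.family fun i => .nat (C i)).size ≤ m * 2 + 1 := Val.size_family_le fun _ => le_rfl
  have h2 : (Val.profile v).size ≤ m * (n * 2 + 1 + 1) + 1 :=
    Val.size_family_le fun i => Val.size_vec_le (v i)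
  simp only [Val.nat] at h1
  simp only [inputVal, Val.list, Val.size, Val.nat]
  have : m * (2 * n + 4) = m * 2 + m * (n * 2 + 1 + 1) := by ring
  omega

/-- The item count, the exponent and the number of replicas are turned into ranges in this order,
the power being formed by repeated real multiplication. The range of the items comes from the number
`n`, since an empty list of reports would not reveal it. -/
theorem CompWithin.replicas (sym : Bool) {X : Type*} {O : X → Val → Val → Prop} {F : X → Val}
    {m n r : X → ℕ} {δ : X → ℝ} (hm : Comp O F fun x => .nat (m x))
    (hn : Comp O F fun x => .nat (n x)) (hδ : Comp O F fun x => .num (δ x))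
    (hr : ∀ x, r x = replicas sym (m x) (n x) (δ x)) :
    CompWithin (fun x => n x + exponent sym (n x) (δ x) + r x) O F
      fun x => .node (.node (F x) (.rng (n x))) (.rng (r x)) := by
  obtain ⟨N, hN⟩ : ∃ N, N = fun x => n x + exponent sym (n x) (δ x) + r x := ⟨_, rfl⟩
  have hN' : ∀ x, N x = n x + exponent sym (n x) (δ x) + r x := fun x => by rw [hN]
  rw [← hN]
  have s1 : CompWithin N O F fun x => .node (F x) (.rng (n x)) := by
    have h := range (N := N) (a := fun x => (n x : ℝ)) hn fun x => by
      rw [Nat.ceil_natCast, hN']; omega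
    simpa only [Nat.ceil_natCast] using h
  have he : Comp O (fun x => .node (F x) (.rng (n x))) fun x =>
      .num (if sym then 1 / δ x + 5 else (n x : ℝ) + 4) := by
    have h1 : Comp O (fun x => .node (F x) (.rng (n x))) fun x => .num (δ x) :=
      (Comp.refl _ _).fst.trans hδ
    have h2 : Comp O (fun x => .node (F x) (.rng (n x))) fun x => .num (n x : ℝ) :=
      (Comp.refl _ _).fst.trans hn
    cases sym with
    | true => exact Comp.add (Comp.div .one h1) (.natConst 5)
    | false => exact Comp.add h2 (.natConst 4)
  have s2 : CompWithin N O (fun x => .node (F x) (.rng (n x))) fun x =>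
      .node (.node (F x) (.rng (n x))) (.rng (exponent sym (n x) (δ x))) :=
    range he fun x => by
      change exponent sym (n x) (δ x) ≤ _
      rw [hN']; omega
  have hb : Comp O F fun x => .num ((m x : ℝ) + n x + 2 + 1 / δ x) :=
    Comp.add (Comp.add (Comp.add hm hn) (.natConst 2)) (Comp.div .one hδ)
  have hb' : Comp O (fun x => .node (.node (F x) (.rng (n x))) (.rng (exponent sym (n x) (δ x))))
      fun x => .num ((m x : ℝ) + n x + 2 + 1 / δ x) := (Comp.refl _ _).fst.fst.trans hb
  have hp : Comp O (fun x => .node (.node (F x) (.rng (n x))) (.rng (exponent sym (n x) (δ x))))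
      fun x => .num (((m x : ℝ) + n x + 2 + 1 / δ x) ^ exponent sym (n x) (δ x)) :=
    (Comp.iterate (S := fun _ => ℝ) (encS := fun _ => Val.num) (init := fun _ => 1)
      (step := fun x => (((m x : ℝ) + n x + 2 + 1 / δ x) * ·))
      (r := fun x => exponent sym (n x) (δ x)) (Comp.refl _ _).snd .one
      (Comp.mul (hb'.wk Sigma.fst) (Comp.refl _ _).snd)
      ⟨fun _ => 1, .const 1, fun _ _ => le_rfl⟩).congr fun x => by simp [mul_left_iterate]
  have s3 : CompWithin N O (fun x => .node (.node (F x) (.rng (n x)))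
      (.rng (exponent sym (n x) (δ x)))) fun x => .node (.node (.node (F x) (.rng (n x)))
      (.rng (exponent sym (n x) (δ x)))) (.rng (r x)) := by
    have h := range (N := N) hp fun x => by
      change BICMech.replicas sym (m x) (n x) (δ x) ≤ _
      rw [← hr, hN']; omega
    rw [funext hr]
    exact h
  exact ((s1.trans s2).trans s3).trans (of_comp (Comp.pair (Comp.refl _ _).fst.fst (Comp.refl _ _).snd))

/-- The program. -/
theorem exists_program (sym : Bool) : ∃ (p : Program) (T : ℕ → ℕ), PolyBd T ∧ ∀ x : Setup sym,
    x.r = replicas sym x.m x.n x.δ → Ev x.oracle p (inputVal x.C x.δ x.η x.v)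
      (.node (.alloc (allocOf x.M₁ sym x.η x.run x.r x.D' x.v x.ω))
        (.vec (payOf x.M₁ sym x.η x.r x.D' x.v x.ω)))
      (T (x.m * (2 * x.n + 4) + 13 + (x.n + exponent sym x.n x.δ + x.r))) := by
  have h0 : Comp (Setup.oracle (sym := sym)) (fun x => inputVal x.C x.δ x.η x.v)
      fun x => .node (.num x.δ) (.node (.num x.η) (.node (.nat x.m) (.node (.nat x.n)
        (.node (.family fun i => .nat (x.C i)) (.node (.profile x.v) .nil))))) := .refl _ _
  have h1 := CompWithin.replicas sym
    (r := fun x : {x : Setup sym // x.r = replicas sym x.m x.n x.δ} => x.1.r)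
    (h0.snd.snd.fst.comap Subtype.val) (h0.snd.snd.snd.fst.comap Subtype.val)
    (h0.fst.comap Subtype.val) fun x => x.2
  obtain ⟨p, T, hT, h⟩ := h1.trans (.of_comp ((Setup.comp_output sym).comap Subtype.val))
  exact ⟨p, T, hT, fun x hx => (h ⟨x, hx⟩).1.mono
    (hT.1 (Nat.add_le_add_right (size_inputVal_le _ _ _ _) _))⟩


/-! ### The theorem -/

theorem isBICTransform_replicas {sym : Bool} {m n : ℕ} {C : Fin m → ℕ} {δ η ε : ℝ} (hδ : 0 < δ)
    (hη : 0 < η) (hε : 0 < ε) {D D' : Fin m → Measure (Typ n)} [∀ i, IsProbabilityMeasure (D i)]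
    [∀ i, IsProbabilityMeasure (D' i)] [∀ i, Nonempty (Atom (D' i))]
    [∀ i, Fintype (Atom (D' i))] [NeZero (replicas sym m n δ)] (hdc : DiscretizedCoupled δ D D')
    {M₁ : Mechanism C n} (hM : IsInputMechanism D' η ε M₁) (hD : sym = true → ItemSymmetric D)
    (hD' : sym = true → ItemSymmetric D') (hsym : sym = true → RespectsItemSymmetry D' M₁) :
    IsBICTransform D D' δ η ε M₁ (BICTransform M₁ sym η D D' (positionLaw (replicas sym m n δ))
      (relabelLaw sym n)) :=
  isBICTransform hδ hη hε hdc hM hD hD' hsym positionLaw_map (fun _ => relabelLaw_map sym)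
    (ae_grp_relabelLaw sym) (replicas_pos hδ) (classCount_mul_le hδ)

theorem DiscretizedCoupled.isGrid {m n : ℕ} {δ : ℝ} {D D' : Fin m → Measure (Typ n)}
    (h : DiscretizedCoupled δ D D') (i : Fin m) : ∀ᵐ x ∂(D' i), IsGrid δ x :=
  (h.2.1 i).mp ((h.2.2.1 i).mono fun _ h1 h2 => ⟨h2, h1⟩)

theorem exists_isBICTransform {m n : ℕ} {C : Fin m → ℕ} {δ η ε : ℝ} (hδ : 0 < δ)
    (hη : 0 < η) (hε : 0 < ε) {D D' : Fin m → Measure (Typ n)} [∀ i, IsProbabilityMeasure (D i)]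
    [∀ i, IsProbabilityMeasure (D' i)] (hdc : DiscretizedCoupled δ D D')
    {M₁ : Mechanism C n} (hM : IsInputMechanism D' η ε M₁) :
    ∃ M₂ : Mechanism C n, IsBICTransform D D' δ η ε M₁ M₂ := by
  have : ∀ i, Nonempty (Atom (D' i)) := fun i => nonempty_atom hδ (hdc.isGrid i)
  have : ∀ i, Finite (Atom (D' i)) := fun i => finite_atom hδ (hdc.isGrid i)
  have : ∀ i, Fintype (Atom (D' i)) := fun i => .ofFinite _
  have : NeZero (replicas false m n δ) := ⟨(replicas_pos hδ).ne'⟩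
  exact ⟨_, isBICTransform_replicas (sym := false) hδ hη hε hdc hM nofun nofun nofun⟩

/-- The program depends on `sym` alone. Its time is polynomial in the displayed expression, which is
a polynomial in the growing parameter as soon as the exponent is constant. -/
theorem exists_program_implements (sym : Bool) : ∃ (p : Program) (T : ℕ → ℕ), PolyBd T ∧
    ∀ {m n : ℕ} {C : Fin m → ℕ} {δ η ε : ℝ}, 0 < δ → 0 < η → 0 < ε →
    ∀ {D D' : Fin m → Measure (Typ n)} [∀ i, IsProbabilityMeasure (D i)]
      [∀ i, IsProbabilityMeasure (D' i)], DiscretizedCoupled δ D D' →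
    ∀ {M₁ : Mechanism C n}, IsInputMechanism D' η ε M₁ → (sym = true → ItemSymmetric D) →
      (sym = true → ItemSymmetric D') → (sym = true → RespectsItemSymmetry D' M₁) →
    ∀ {run : Profile m n → ℝ → Alloc C n}, IsSampler M₁ run →
    ∀ B, T (m * (2 * n + 4) + 13 +
        (n + exponent sym n δ + (m + n + 2 + ⌈1 / δ⌉₊) ^ exponent sym n δ)) ≤ B →
      ∃ M₂ : Mechanism C n, IsBICTransform D D' δ η ε M₁ M₂ ∧
        Implements D D' δ η M₁ run p B M₂ := by
  obtain ⟨p, T, hT, h⟩ := exists_program sym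
  refine ⟨p, T, hT, ?_⟩
  intro m n C δ η ε hδ hη hε D D' _ _ hdc M₁ hM hD hD' hsym run hrun B hB
  have : ∀ i, Nonempty (Atom (D' i)) := fun i => nonempty_atom hδ (hdc.isGrid i)
  have : ∀ i, Finite (Atom (D' i)) := fun i => finite_atom hδ (hdc.isGrid i)
  have hfin : ∀ i, Fintype (Atom (D' i)) := fun i => .ofFinite _
  have hpos : NeZero (replicas sym m n δ) := ⟨(replicas_pos hδ).ne'⟩
  refine ⟨_, isBICTransform_replicas hδ hη hε hdc hM hD hD' hsym, fun v hv =>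
    ⟨allocOf M₁ sym η run (replicas sym m n δ) D' v, payOf M₁ sym η (replicas sym m n δ) D' v,
      allocOf_law hrun v, payOf_law hdc.1 hv, ?_⟩⟩
  filter_upwards [ae_draw_atom hδ hdc.isGrid] with ω hω
  obtain ⟨s, hs, e⟩ := h
    { m := m, n := n, r := replicas sym m n δ, C := C, δ := δ, η := η, D' := D', M₁ := M₁,
      run := run, ω := ω, v := v, prob := inferInstance, fin := hfin, pos := hpos, atom := hω,
      inv := hD' } rfl
  exact ⟨s, hs.trans ((hT.1 (Nat.add_le_add_left
    (Nat.add_le_add_left (replicas_le hδ) _) _)).trans hB), e⟩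

theorem maxAwarded_le {m n : ℕ} (C : Fin m → ℕ) : maxAwarded C n ≤ n :=
  Finset.sup_le fun _ _ => (Finset.card_le_univ _).trans_eq (Fintype.card_fin n)

/-- Item `j` goes to bidder `⌊j / c⌋`; the items of one bidder have different residues modulo `c`,
so there are at most `c` of them. -/
theorem maxAwarded_eq {m k c : ℕ} (h : k ≤ m * c) : maxAwarded (fun _ : Fin m => c) k = k := by
  refine (maxAwarded_le _).antisymm ?_
  let a : Alloc (fun _ : Fin m => c) k :=
    ⟨fun j => some ⟨j / c, Nat.div_lt_of_lt_mul (by rw [mul_comm]; exact j.2.trans_le h)⟩,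
      fun i => by
        rcases Nat.eq_zero_or_pos c with rfl | hc
        · have : k = 0 := by omega
          subst this
          simp
        · refine (Finset.card_le_card_of_injOn (fun j : Fin k => (j : ℕ) % c) (t := Finset.range c)
            (fun j _ => Finset.mem_coe.2 (Finset.mem_range.2 (Nat.mod_lt _ hc)))
            fun j hj l hl hjl => ?_).trans_eq (Finset.card_range c)
          simp only [Finset.coe_filter, Finset.mem_univ, true_and, Set.mem_ofPred_eq,
            Option.some.injEq, Fin.ext_iff] at hj hl
          ext
          rw [← Nat.div_add_mod (j : ℕ) c, ← Nat.div_add_mod (l : ℕ) c, hj, hl, show (j : ℕ) % c = l % c from hjl]⟩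
  refine le_trans ?_ (Finset.le_sup (f := fun a : Alloc (fun _ : Fin m => c) k =>
    (Finset.univ.filter fun j => a.1 j ≠ none).card) (Finset.mem_univ a))
  simp [a]

theorem maxAwarded_le_mul {m n : ℕ} (C : Fin m → ℕ) :
    maxAwarded C n ≤ m * Finset.univ.sup C := by
  refine Finset.sup_le fun a _ => ?_
  calc (Finset.univ.filter fun j => a.1 j ≠ none).card
      ≤ (Finset.univ.biUnion fun i => Finset.univ.filter fun j => a.1 j = some i).card := by
        refine Finset.card_le_card fun j hj => ?_
        simpa [Option.ne_none_iff_exists'] using hj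
    _ ≤ ∑ i, (Finset.univ.filter fun j => a.1 j = some i).card := Finset.card_biUnion_le
    _ ≤ ∑ _i : Fin m, Finset.univ.sup C :=
        Finset.sum_le_sum fun i _ => (a.2 i).trans (Finset.le_sup (Finset.mem_univ i))
    _ = m * Finset.univ.sup C := by simp

theorem PolyBd.exists_le_of_le {T S : ℕ → ℕ} (hT : PolyBd T) (hS : PolyBd S) (k : ℕ) :
    ∃ A d : ℕ, ∀ s, T (S s) ≤ A * (k + s + 1) ^ d ∧ T (S s) ≤ A * (s + k + 1) ^ d := by
  obtain ⟨-, A, d, h⟩ := hT.comp hS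
  refine ⟨A, d, fun s => ?_⟩
  rw [add_comm s k, and_self]
  exact (h s).trans (Nat.mul_le_mul_left _ (Nat.pow_le_pow_left (by omega) d))

end BICMech
end
open BICMech
theorem mainTheorem2 :
    -- every setting: existence of the transformed mechanism
    (∀ (m n : ℕ) (C : Fin m → ℕ) (δ η ε : ℝ), 0 < δ → δ < 1 → 0 < η → 0 < ε →
      ∀ (D D' : Fin m → Measure (Typ n))
        [∀ i, IsProbabilityMeasure (D i)] [∀ i, IsProbabilityMeasure (D' i)],
        DiscretizedCoupled δ D D' →
        ∀ M₁ : Mechanism C n, IsInputMechanism D' η ε M₁ →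
          ∃ M₂ : Mechanism C n, IsBICTransform D D' δ η ε M₁ M₂) ∧
    -- the `k`-items problem: one program, polynomial time for fixed `k`, `δ`, `η`
    (∃ prog : Program, ∀ (k : ℕ) (δ η : ℝ), 0 < δ → δ < 1 → 0 < η → ∃ A d : ℕ,
      ∀ (m : ℕ) (C : Fin m → ℕ) (ε : ℝ), 0 < ε →
      ∀ (D D' : Fin m → Measure (Typ k))
        [∀ i, IsProbabilityMeasure (D i)] [∀ i, IsProbabilityMeasure (D' i)],
        IdenticalBidders C D → IdenticalBidders C D' → DiscretizedCoupled δ D D' →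
        ∀ M₁ : Mechanism C k, IsInputMechanism D' η ε M₁ →
        ∀ run : Profile m k → ℝ → Alloc C k, IsSampler M₁ run →
          ∃ M₂ : Mechanism C k, IsBICTransform D D' δ η ε M₁ M₂ ∧
            Implements D D' δ η M₁ run prog (A * (k + m + 1) ^ d) M₂) ∧
    -- the `k`-bidders problem: likewise, for item-symmetric `M₁`
    (∃ prog : Program, ∀ (k : ℕ) (δ η : ℝ), 0 < δ → δ < 1 → 0 < η → ∃ A d : ℕ,
      ∀ (n : ℕ) (C : Fin k → ℕ) (ε : ℝ), 0 < ε →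
      ∀ (D D' : Fin k → Measure (Typ n))
        [∀ i, IsProbabilityMeasure (D i)] [∀ i, IsProbabilityMeasure (D' i)],
        ItemSymmetric D → ItemSymmetric D' → DiscretizedCoupled δ D D' →
        ∀ M₁ : Mechanism C n, IsInputMechanism D' η ε M₁ → RespectsItemSymmetry D' M₁ →
        ∀ run : Profile k n → ℝ → Alloc C n, IsSampler M₁ run →
          ∃ M₂ : Mechanism C n, IsBICTransform D D' δ η ε M₁ M₂ ∧
            Implements D D' δ η M₁ run prog (A * (n + k + 1) ^ d) M₂) ∧
    -- the value of `T` in the two problems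
    (∀ m k c : ℕ, maxAwarded (fun _ : Fin m => c) k ≤ k ∧
      (k ≤ m * c → maxAwarded (fun _ : Fin m => c) k = k)) ∧
    (∀ (k n : ℕ) (C : Fin k → ℕ), maxAwarded C n ≤ k * Finset.univ.sup C) := by
  refine ⟨fun m n C δ η ε hδ _ hη hε D D' _ _ hdc M₁ hM => exists_isBICTransform hδ hη hε hdc hM,
    ?_, ?_, fun m k c => ⟨maxAwarded_le _, maxAwarded_eq⟩, fun k n C => maxAwarded_le_mul C⟩
  · obtain ⟨p, T, hT, h⟩ := exists_program_implements false
    refine ⟨p, fun k δ η hδ _ hη => ?_⟩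
    -- With `k` items the exponent is fixed by `k`, so the expression is a polynomial in the number
    -- of bidders.
    obtain ⟨A, d, hA⟩ := hT.exists_le_of_le (S := fun m => m * (2 * k + 4) + 13 +
      (k + exponent false k δ + (m + k + 2 + ⌈1 / δ⌉₊) ^ exponent false k δ))
      (((PolyBd.id.mul (.const _)).add (.const _)).add ((PolyBd.const _).add
        ((((PolyBd.id.add (.const _)).add (.const _)).add (.const _)).pow _))) k
    exact ⟨A, d, fun m C ε hε D D' _ _ _ _ hdc M₁ hM run hrun =>
      h hδ hη hε hdc hM nofun nofun nofun hrun _ (hA m).1⟩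
  · obtain ⟨p, T, hT, h⟩ := exists_program_implements true
    refine ⟨p, fun k δ η hδ _ hη => ?_⟩
    -- In the symmetric case the exponent depends on `δ` alone, so `0` can stand for the number of
    -- items in it and the expression is a polynomial in `n`.
    obtain ⟨A, d, hA⟩ := hT.exists_le_of_le (S := fun n => k * (2 * n + 4) + 13 +
      (n + exponent true 0 δ + (k + n + 2 + ⌈1 / δ⌉₊) ^ exponent true 0 δ))
      ((((PolyBd.const _).mul (((PolyBd.const _).mul .id).add (.const _))).add (.const _)).add
        ((PolyBd.id.add (.const _)).add
          (((((PolyBd.const _).add .id).add (.const _)).add (.const _)).pow _))) k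
    exact ⟨A, d, fun n C ε hε D D' _ _ hD hD' hdc M₁ hM hsym run hrun =>
      h hδ hη hε hdc hM (fun _ => hD) (fun _ => hD') (fun _ => hsym) hrun _ (hA n).2⟩
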